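/- **Notation.** $h_n=\sum_{i=1}^{n}\frac1{2i-1}$. The Milgram constants are $t_k(n)=\sum_{m_n=0}^{k}\frac{1}{m_n+\frac n2}\sum_{m_{n-1}=0}^{m_n}\frac1{m_{n-1}+\frac{n-1}2}\cdots\sum_{m_1=0}^{m_2}\frac1{m_1+\frac12}$; in particular $t_n(1)=\sum_{m=0}^{n}\frac{1}{m+\frac12}$. $\psi^{(0)}=\Gamma'/\Gamma$ is the digamma function, $\psi^{(i)}$ its $i$-th derivative, and $H_x=\psi^{(0)}(x+1)+\gamma$ for real $x>-1$, where $\gamma$ is Euler's constant. $\zeta$ is the Riemann zeta function, $\mathrm{Li}_s(z)=\sum_{n\ge1}z^n/n^s$, $\beta(s)=\sum_{n\ge1}\frac{(-1)^{n+1}}{(2n-1)^s}$, $G=\beta(2)$, and $W(3)=\Im\,\mathrm{Li}_3\!\left(\frac{1+i}{2}\right)$. Empty sums are $0$. **Theorem 3.7.** Let $k\ge 0$ be an integer. All series below converge absolutely, and $$ \begin{aligned} &\sum_{n=1}^{\infty}\frac{2(-1)^{n+1}h_n}{n(2n+2k+1)^3}=\sum_{n=0}^{\infty}\frac{(-1)^n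 t_n(1)}{(n+1)(2n+2k+3)^3}\\ &=-\frac{2}{2k+1}\Bigg\{\sum_{j=1}^{k}\frac{(-1)^{j+1}}{512(k+1-j)^3}\Big(32\pi-32\psi^{(0)}(a_j)+32\psi^{(0)}(b_j)+16(k+1-j)\big(\psi^{(1)}(a_j)-\psi^{(1)}(b_j)\big)\\ &\qquad-4(k+1-j)^2\big(\psi^{(2)}(a_j)-\psi^{(2)}(b_j)\big)\Big)+(-1)^k\Big(\frac{7\pi}{64}\zeta(3)+\beta(4)-\frac{\pi^3\ln 2}{16}\Big)\Bigg\}\\ &\quad-\frac{2}{(2k+1)^2}\Bigg\{-\frac{\pi^2}{16}+\frac{k}{2k+1}\Big(\frac{\pi^2}{8}-\sum_{j=1}^{k}(-1)^{j+1}\frac{\pi+H_{\frac{2k-1-2j}{4}}-H_{\frac{2k+1-2j}{4}}}{2(k+1-j)}-(-1)^k2G+\frac{(-1)^k\pi\ln2}{2}\Big)\\ &\qquad-2\Big[\sum_{j=1}^{k}\frac{(-1)^{j+1}}{64(k+1-j)^2}\Big(-4\pi+4\psi^{(0)}(a_j)-4\psi^{(0)}(b_j)-2(k+1-j)\big(\psi^{(1)}(a_j)-\psi^{(1)}(b_j)\big)\Big)\\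 &\qquad\quad+\frac{(-1)^k}{96}\big(3\pi^3+6\pi\ln^2 2-192W(3)\big)\Big]\\ &\qquad+2\Big[\frac{(-1)^k}{8}(4G-\pi\ln2)+\sum_{j=1}^{k}(-1)^{j+1}\frac{\pi+H_{\frac{2k-1-2j}{4}}-H_{\frac{2k+1-2j}{4}}}{8(k+1-j)}\Big]\Bigg\}, \end{aligned} $$ where $a_j=\frac{2k+5-2j}{4}$ and $b_j=\frac{2k+3-2j}{4}$; and $$ \begin{aligned} &\sum_{n=1}^{\infty}\frac{2(-1)^{n+1}h_n}{n(2n+2k+2)^3}=\sum_{n=0}^{\infty}\frac{(-1)^n t_n(1)}{(n+1)(2n+2k+4)^3}\\ &=-\frac{1}{k+1}\Bigg\{\sum_{j=1}^{k+1}\frac{(-1)^{j+1}}{64(2k+3-2j)^3}\Big(32\pi-32\psi^{(0)}(c_j)+32\psi^{(0)}(d_j)+8(2k+3-2j)\big(\psi^{(1)}(c_j)-\psi^{(1)}(d_j)\big)\\ &\qquad-(2k+3-2j)^2\big(\psi^{(2)}(c_j)-\psi^{(2)}(d_j)\big)\Big)\\ &\qquad+(-1)^{k+1}\Big[\frac12\Big(\frac{11}{4}\zeta(4)-\frac74\zeta(3)\ln2+\frac12\zeta(2)\ln^22-\frac1{12}\ln^42-2\,\mathrm{Li}_4\big(\tfrac12\big)\Big)-\frac{25}{128}\zeta(4)\Big]\Bigg\}\\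 &\quad-\frac{1}{2(k+1)^2}\Bigg\{-\frac{\pi^2}{16}+\frac{2k+1}{4(k+1)}\Big(\frac{\pi^2}{8}+\frac{(-1)^k\pi^2}{8}-\sum_{j=1}^{k+1}(-1)^{j+1}\frac{\pi+H_{\frac{k-j}{2}}-H_{\frac{k-j+1}{2}}}{2k+3-2j}\Big)\\ &\qquad-2\Big[\sum_{j=1}^{k+1}\frac{(-1)^{j+1}}{16(2k+3-2j)^2}\Big(-4\pi+4\psi^{(0)}(c_j)-4\psi^{(0)}(d_j)-(2k+3-2j)\big(\psi^{(1)}(c_j)-\psi^{(1)}(d_j)\big)\Big)\\ &\qquad\quad+\frac{(-1)^{k+1}}{16}\big(-4G\pi+7\zeta(3)\big)\Big]\\ &\qquad+2\Big[\sum_{j=1}^{k+1}(-1)^{j+1}\frac{\pi+H_{\frac{k-j}{2}}-H_{\frac{k+1-j}{2}}}{4(2k+3-2j)}+\frac{(-1)^{k+1}\pi^2}{32}\Big]\Bigg\}, \end{aligned} $$ where $c_j=\frac{k+3-j}{2}$ and $d_j=\frac{k+2-j}{2}$. -/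

import Mathlib

/-- The odd harmonic number `h_n = 1 + 1/3 + ⋯ + 1/(2n-1)`. -/
noncomputable def oddHarmonic (n : ℕ) : ℝ :=
  ∑ k ∈ Finset.Icc 1 n, 1 / (2 * (k : ℝ) - 1)

/-- The Milgram constants: `milgram k n` is the `n`-fold nested sum
`t_k(n) = ∑_{m_n ≤ k} 1/(m_n + n/2) ∑_{m_{n-1} ≤ m_n} ⋯ ∑_{m_1 ≤ m_2} 1/(m_1 + 1/2)`,
all indices being natural numbers, with `t_k(0) = 1` (empty nested sum). -/
noncomputable def milgram (k : ℕ) : ℕ → ℝ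
  | 0 => 1
  | n + 1 => ∑ m ∈ Finset.range (k + 1), 1 / ((m : ℝ) + ((n : ℝ) + 1) / 2) * milgram m n

/-- The polygamma function `ψ^{(n)}` on the positive real axis: the `n`-th derivative of the digamma
function `ψ = Γ'/Γ`. -/
noncomputable def polygamma (n : ℕ) (x : ℝ) : ℝ :=
  iteratedDeriv n (logDeriv Real.Gamma) x

/-- The harmonic number `H_x` of real order `x > -1`, i.e. `H_x = ψ(x + 1) + γ`. -/
noncomputable def realHarmonic (x : ℝ) : ℝ :=
  polygamma 0 (x + 1) + Real.eulerMascheroniConstant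

/-- The polylogarithm `Li_s(z) = ∑_{k ≥ 1} z^k / k^s`, for an integer `s ≥ 2` and `‖z‖ ≤ 1`. -/
noncomputable def polylog (s : ℕ) (z : ℂ) : ℂ :=
  ∑' k : ℕ, z ^ (k + 1) / ((k : ℂ) + 1) ^ s

/-- The Dirichlet beta function `β(s) = ∑_{n ≥ 1} (-1)^{n+1} / (2n-1)^s` at integers `s ≥ 2`
(the summation index is shifted by one, so that it starts at `0`). -/
noncomputable def dirichletBeta (s : ℕ) : ℝ :=
  ∑' n : ℕ, (-1 : ℝ) ^ n / (2 * (n : ℝ) + 1) ^ s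

/-- Catalan's constant `G = β(2)`. -/
noncomputable def catalanG : ℝ := dirichletBeta 2

/-- The constant `W(3) = Im Li₃((1 + i)/2)`. -/
noncomputable def W3 : ℝ := (polylog 3 ((1 + Complex.I) / 2)).im

/-- The real number `Li₄(1/2)`. -/
noncomputable def Li4Half : ℝ := (polylog 4 (1 / 2)).re

/-- The real number `ζ(s)` for an integer `s ≥ 2`. -/
noncomputable def zetaReal (s : ℕ) : ℝ := (riemannZeta (s : ℂ)).re

/-! Put N = n + 1. Partial fractions give 1/(N (2N+m)^3) = 1/(m^3 N) - 2/(m^3 (2N+m)) - 2/(m^2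
(2N+m)^2) - 2/(m (2N+m)^3). Hence both series (m = 2k+1 and m = 2k+2) are combinations of ∑
(-1)^(N+1) h_N / N = π²/16 and of the shifted sums L_p(m) = ∑ (-1)^n 2 h_{n+1} / (2n+2+m)^p with p =
1, 2, 3 (`hasSum_of_shiftSum`). For p = 1 the convergence is only conditional, so `ShiftSum` speaks
of limits of partial sums.

Since h_{n+2} = h_{n+1} + 1/(2n+3), re-indexing gives L_p(q+2) = 2 A_p(q) - L_p(q), where A_p(q) = ∑
(-1)^n / ((2n+1) (2n+2+q)^p). Iterating this (`ShiftSum.iterate`) produces the alternating sums over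
j. Partial fractions reduce A_p(q) to Leibniz's series and to polygamma values; the arguments
(q+2)/4 and (q+4)/4 come from splitting n by parity. It remains to find the six base values L_p(0)
and L_p(1).

For p = 1 they come from the power series of arctan², by Abel's theorem and by integration over [0,
1].

Several of the others rest on computing an integral over 0 < θ < π/2 in two ways. Under t = tan(θ/2)
the function log cot(θ/2) becomes -log t, and termwise integration over [0, 1] yields an alternating
Euler sum. On the other side log cot(θ/2) and log(2 cos(θ/2)) are real parts of boundary values of
holomorphic logarithms, whose Fourier series may be integrated termwise (`hasSum_quarter_integral`).
Weight θ against log cot gives L_2(0). Weight θ against its square relates L_3(0) to ∑ h_N / N^3,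
which is a combination of ∑ H_{k-1} x^k / k^3 at x = 1 and x = -1; functional equations of
polylogarithms (`nielsen_three_neg_one`) and ζ(3,1) = ζ(4)/4 (`nielsen_three_one`) evaluate these.

For L_2(1), use h_m = H_{2m} - H_m/2. The H_{2m} part is the imaginary part of ∑ H_{k-1} z^k / k^2
at z = i, where Landen's transformation (`landen_three`) brings in W(3); the H_m part is tied to the
H_{2m} part by ∫ log cot · log cos. Finally L_3(1) comes from a double series summed in both orders
(`hasSum_oddHarmonic_div_odd_cube`). -/

open Finset Filter Topology

/-! ### Harmonic numbers -/

/-- The harmonic number `H_n`. -/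
noncomputable def harm (n : ℕ) : ℝ := ∑ i ∈ range n, 1 / ((i : ℝ) + 1)

@[simp] lemma harm_zero : harm 0 = 0 := by simp [harm]

lemma harm_succ (n : ℕ) : harm (n + 1) = harm n + 1 / ((n : ℝ) + 1) := sum_range_succ _ _

@[simp] lemma oddHarmonic_zero : oddHarmonic 0 = 0 := by simp [oddHarmonic]

lemma oddHarmonic_succ (n : ℕ) :
    oddHarmonic (n + 1) = oddHarmonic n + 1 / (2 * (n : ℝ) + 1) := by
  rw [oddHarmonic, sum_Icc_succ_top (by omega), ← oddHarmonic]
  push_cast; ring_nf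

lemma oddHarmonic_eq_sum (n : ℕ) : oddHarmonic n = ∑ i ∈ range n, 1 / (2 * (i : ℝ) + 1) := by
  induction n with
  | zero => simp
  | succ n ih => rw [oddHarmonic_succ, sum_range_succ, ih]

/-- Odd and even denominators are separated; this is how Euler sums in `oddHarmonic` are traded for
sums in `harm`. -/
lemma harm_two_mul (n : ℕ) : harm (2 * n) = oddHarmonic n + harm n / 2 := by
  induction n with
  | zero => simp
  | succ n ih =>
    rw [show 2 * (n + 1) = 2 * n + 1 + 1 by ring, harm_succ, harm_succ, ih, oddHarmonic_succ,
      harm_succ]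
    push_cast
    field_simp
    ring

lemma milgram_one (n : ℕ) : milgram n 1 = 2 * oddHarmonic (n + 1) := by
  simp only [milgram, oddHarmonic_eq_sum, mul_sum]
  refine sum_congr rfl fun i _ => ?_
  push_cast
  field_simp
  ring

lemma harm_nonneg (n : ℕ) : 0 ≤ harm n := sum_nonneg fun _ _ => by positivity

lemma oddHarmonic_nonneg (n : ℕ) : 0 ≤ oddHarmonic n := by
  rw [oddHarmonic_eq_sum]; exact sum_nonneg fun _ _ => by positivity

/-- Since 1/(n+1) ≤ 2(√(n+1) - √n), the sum telescopes. The bound is crude, but any power of n below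
1 makes ∑ H_n / n² converge. -/
lemma harm_le_sqrt (n : ℕ) : harm n ≤ 2 * √n := by
  induction n with
  | zero => simp
  | succ n ih =>
    rw [harm_succ]
    obtain ⟨x, hx⟩ : ∃ x, x = √(n : ℝ) := ⟨_, rfl⟩
    obtain ⟨y, hy⟩ : ∃ y, y = √((n : ℝ) + 1) := ⟨_, rfl⟩
    have h1 : x ^ 2 = n := by rw [hx]; exact Real.sq_sqrt (by positivity)
    have h2 : y ^ 2 = n + 1 := by rw [hy]; exact Real.sq_sqrt (by positivity)
    have h3 : 1 ≤ y := by
      rw [hy]; exact Real.one_le_sqrt.2 (by linarith [n.cast_nonneg (α := ℝ)])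
    have h4 : x ≤ y := by rw [hx, hy]; exact Real.sqrt_le_sqrt (by linarith)
    have h5 : 1 / ((n : ℝ) + 1) ≤ 2 * y - 2 * x := by
      rw [div_le_iff₀ (by positivity), ← h2]
      have h6 : (y - x) * (y + x) = 1 := by ring_nf; linarith
      nlinarith [mul_nonneg (sub_nonneg.2 h4) (sub_nonneg.2 h4),
        mul_nonneg (sub_nonneg.2 h4) (mul_nonneg (sub_nonneg.2 h3) (by linarith : 0 ≤ y))]
    rw [← hx] at ih
    push_cast
    rw [← hy]
    linarith

lemma oddHarmonic_le_harm (n : ℕ) : oddHarmonic n ≤ harm n := by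
  rw [oddHarmonic_eq_sum, harm]
  refine sum_le_sum fun i _ => ?_
  gcongr
  linarith [i.cast_nonneg (α := ℝ)]

lemma summable_harm_div_sq : Summable fun n : ℕ => harm (n + 1) / ((n : ℝ) + 1) ^ 2 := by
  have h := (Real.summable_one_div_nat_add_rpow 1 (3 / 2)).2 (by norm_num)
  refine Summable.of_nonneg_of_le (fun n => div_nonneg (harm_nonneg _) (by positivity)) (fun n => ?_)
    (h.mul_left 2)
  have hp : (0 : ℝ) < (n : ℝ) + 1 := by positivity
  rw [abs_of_pos hp, mul_one_div, div_le_div_iff₀ (by positivity) (by positivity)]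
  have := harm_le_sqrt (n + 1)
  rw [Real.sqrt_eq_rpow] at this
  push_cast at this
  calc harm (n + 1) * ((n : ℝ) + 1) ^ (3 / 2 : ℝ)
      ≤ 2 * ((n : ℝ) + 1) ^ (1 / 2 : ℝ) * ((n : ℝ) + 1) ^ (3 / 2 : ℝ) := by gcongr
    _ = 2 * ((n : ℝ) + 1) ^ 2 := by
      rw [mul_assoc, ← Real.rpow_add hp, ← Real.rpow_natCast]; norm_num

/-- Comparison with `∑ H_{n+1}/(n+1)^2`. -/
lemma summable_of_le_harm_div_sq {f : ℕ → ℝ} (C : ℝ)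
    (h : ∀ n, |f n| ≤ C * (harm (n + 1) / ((n : ℝ) + 1) ^ 2)) : Summable f :=
  Summable.of_norm (Summable.of_nonneg_of_le (fun _ => norm_nonneg _) h
    (summable_harm_div_sq.mul_left C))

/-! ### Partial fractions over antidiagonals -/

/-- For a + b = n one has (2a+1) + (2b+1) = 2(n+1), so each product is the sum of two reciprocals
over 2(n+1). These are the coefficients in the squares of arctan and `twoArtanh`. -/
lemma sum_antidiagonal_inv_mul_inv_odd (n : ℕ) :
    ∑ p ∈ antidiagonal n, 1 / (2 * (p.1 : ℝ) + 1) * (1 / (2 * (p.2 : ℝ) + 1)) =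
      oddHarmonic (n + 1) / ((n : ℝ) + 1) := by
  have h : ∀ p ∈ antidiagonal n, 1 / (2 * (p.1 : ℝ) + 1) * (1 / (2 * (p.2 : ℝ) + 1)) =
      1 / (2 * ((n : ℝ) + 1)) * (1 / (2 * (p.1 : ℝ) + 1)) +
        1 / (2 * ((n : ℝ) + 1)) * (1 / (2 * (p.2 : ℝ) + 1)) := by
    intro p hp
    rw [← mem_antidiagonal.1 hp]
    push_cast
    have : (0 : ℝ) < p.1 + p.2 + 1 := by positivity
    field_simp
    ring
  rw [sum_congr rfl h, sum_add_distrib, ← mul_sum, ← mul_sum,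
    Nat.sum_antidiagonal_eq_sum_range_succ (fun i _ => 1 / (2 * (i : ℝ) + 1)) n,
    ← Finset.Nat.sum_antidiagonal_swap]
  simp only [Prod.snd_swap]
  rw [
    Nat.sum_antidiagonal_eq_sum_range_succ (fun i _ => 1 / (2 * (i : ℝ) + 1)) n,
    ← oddHarmonic_eq_sum]
  field_simp
  ring

lemma sum_antidiagonal_inv_mul_inv (n : ℕ) :
    ∑ p ∈ antidiagonal n, 1 / ((p.1 : ℝ) + 1) * (1 / ((p.2 : ℝ) + 1)) =
      2 * harm (n + 1) / ((n : ℝ) + 2) := by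
  have h : ∀ p ∈ antidiagonal n, 1 / ((p.1 : ℝ) + 1) * (1 / ((p.2 : ℝ) + 1)) =
      1 / ((n : ℝ) + 2) * (1 / ((p.1 : ℝ) + 1)) + 1 / ((n : ℝ) + 2) * (1 / ((p.2 : ℝ) + 1)) := by
    intro p hp
    rw [← mem_antidiagonal.1 hp]
    push_cast
    have : (0 : ℝ) < p.1 + p.2 + 2 := by positivity
    field_simp
    ring
  rw [sum_congr rfl h, sum_add_distrib, ← mul_sum, ← mul_sum,
    Nat.sum_antidiagonal_eq_sum_range_succ (fun i _ => 1 / ((i : ℝ) + 1)) n,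
    ← Finset.Nat.sum_antidiagonal_swap]
  simp only [Prod.snd_swap]
  rw [
    Nat.sum_antidiagonal_eq_sum_range_succ (fun i _ => 1 / ((i : ℝ) + 1)) n, ← harm]
  field_simp
  ring

/-! ### Power series in the unit disc -/

/-- Cauchy product of two power series that converge absolutely. -/
lemma hasSum_cauchyProduct {R : Type*} [NormedRing R] [CompleteSpace R] {f g : ℕ → R} {s t : R} (hf : HasSum f s) (hg : HasSum g t)
    (hf' : Summable fun n => ‖f n‖) (hg' : Summable fun n => ‖g n‖) :
    HasSum (fun n => ∑ p ∈ antidiagonal n, f p.1 * g p.2) (s * t) := by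
  rw [← hf.tsum_eq, ← hg.tsum_eq, tsum_mul_tsum_eq_tsum_sum_antidiagonal_of_summable_norm hf' hg']
  exact (summable_norm_sum_mul_antidiagonal_of_summable_norm hf' hg').of_norm.hasSum

lemma summable_norm_mul_pow {𝕜 : Type*} [NormedField 𝕜] {c : ℕ → 𝕜} {e : ℕ → ℕ} {z : 𝕜} (hz : ‖z‖ < 1) (hc : ∀ n, ‖c n‖ ≤ 1)
    (he : ∀ n, n ≤ e n) : Summable fun n => ‖c n * z ^ e n‖ := by
  refine Summable.of_nonneg_of_le (fun _ => norm_nonneg _) (fun n => ?_)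
    (summable_geometric_of_lt_one (norm_nonneg z) hz)
  rw [norm_mul, norm_pow]
  calc ‖c n‖ * ‖z‖ ^ e n ≤ 1 * ‖z‖ ^ n :=
        mul_le_mul (hc n) (pow_le_pow_of_le_one (norm_nonneg _) hz.le (he n)) (by positivity)
          zero_le_one
    _ = ‖z‖ ^ n := one_mul _

lemma hasSum_neg_log_one_sub {z : ℂ} (hz : ‖z‖ < 1) :
    HasSum (fun n : ℕ => 1 / ((n : ℂ) + 1) * z ^ (n + 1)) (-Complex.log (1 - z)) := by
  have h := (hasSum_nat_add_iff' 1).2 (Complex.hasSum_taylorSeries_neg_log hz)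
  simp only [range_one, sum_singleton, pow_zero, Nat.cast_zero, div_zero, sub_zero] at h
  refine h.congr_fun fun n => ?_
  push_cast; ring

lemma norm_one_div_natCast_add_one_le (n : ℕ) : ‖1 / ((n : ℂ) + 1)‖ ≤ 1 := by
  rw [norm_div, norm_one, ← Nat.cast_add_one, Complex.norm_natCast]
  exact div_le_one_of_le₀ (by push_cast; linarith [n.cast_nonneg (α := ℝ)]) (by positivity)

lemma norm_one_div_two_mul_natCast_add_one_le (n : ℕ) : ‖1 / (2 * (n : ℂ) + 1)‖ ≤ 1 := by
  have := norm_one_div_natCast_add_one_le (2 * n)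
  push_cast at this
  exact this

lemma hasSum_log_one_sub_sq {z : ℂ} (hz : ‖z‖ < 1) :
    HasSum (fun n : ℕ => ((2 * harm (n + 1) / ((n : ℝ) + 2) : ℝ) : ℂ) * z ^ (n + 2))
      (Complex.log (1 - z) ^ 2) := by
  have h := hasSum_neg_log_one_sub hz
  have hs := summable_norm_mul_pow (e := fun n => n + 1) hz norm_one_div_natCast_add_one_le
    (fun n => n.le_succ)
  have := hasSum_cauchyProduct h h hs hs
  rw [neg_mul_neg, ← sq] at this
  refine this.congr_fun fun n => ?_
  rw [← sum_antidiagonal_inv_mul_inv, Complex.ofReal_sum, sum_mul]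
  refine sum_congr rfl fun p hp => ?_
  rw [← mem_antidiagonal.1 hp]
  push_cast
  ring

/-- The function `log ((1 + z) / (1 - z))` on the unit disc. -/
noncomputable def twoArtanh (z : ℂ) : ℂ := Complex.log (1 + z) - Complex.log (1 - z)

lemma hasSum_twoArtanh {z : ℂ} (hz : ‖z‖ < 1) :
    HasSum (fun n : ℕ => 2 * (1 / (2 * (n : ℂ) + 1)) * z ^ (2 * n + 1)) (twoArtanh z) := by
  have h1 := Complex.hasSum_taylorSeries_log hz
  have h2 := Complex.hasSum_taylorSeries_neg_log hz
  have h := h1.add h2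
  rw [← sub_eq_add_neg, ← twoArtanh] at h
  have hinj : Function.Injective fun n : ℕ => 2 * n + 1 := fun a b hab => by simpa using hab
  rw [← hinj.hasSum_iff] at h
  · refine h.congr_fun fun n => ?_
    simp only [Function.comp_apply]
    rw [show 2 * n + 1 + 1 = 2 * (n + 1) by ring, pow_mul (-1 : ℂ)]
    push_cast
    ring
  · intro m hm
    have : Even m := by
      by_contra hc
      obtain ⟨k, hk⟩ := Nat.not_even_iff_odd.1 hc
      exact hm ⟨k, hk.symm⟩
    rw [pow_succ, this.neg_one_pow]
    ring

lemma hasSum_twoArtanh_sq {z : ℂ} (hz : ‖z‖ < 1) :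
    HasSum (fun n : ℕ => ((4 * (oddHarmonic (n + 1) / ((n : ℝ) + 1)) : ℝ) : ℂ) * z ^ (2 * n + 2))
      (twoArtanh z ^ 2) := by
  have h := (hasSum_twoArtanh hz).mul_left (1 / 2)
  have hs := summable_norm_mul_pow (e := fun n => 2 * n + 1) hz
    norm_one_div_two_mul_natCast_add_one_le (fun n => by omega)
  have h' : HasSum (fun n : ℕ => 1 / (2 * (n : ℂ) + 1) * z ^ (2 * n + 1)) (1 / 2 * twoArtanh z) :=
    h.congr_fun fun n => by ring
  have := (hasSum_cauchyProduct h' h' hs hs).mul_left 4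
  rw [show 4 * (1 / 2 * twoArtanh z * (1 / 2 * twoArtanh z)) = twoArtanh z ^ 2 by ring] at this
  refine this.congr_fun fun n => ?_
  rw [← sum_antidiagonal_inv_mul_inv_odd, mul_sum, mul_sum, Complex.ofReal_sum, sum_mul]
  refine sum_congr rfl fun p hp => ?_
  rw [← mem_antidiagonal.1 hp]
  push_cast
  ring

/-! ### Integrals of boundary values of power series along a quarter of the unit circle -/

/-- The point `r e^{iθ}`. -/
noncomputable def polar (r θ : ℝ) : ℂ := r * Complex.exp (θ * Complex.I)

lemma norm_polar {r : ℝ} (hr : 0 ≤ r) (θ : ℝ) : ‖polar r θ‖ = r := by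
  rw [polar, norm_mul, Complex.norm_exp_ofReal_mul_I, mul_one, Complex.norm_real,
    Real.norm_of_nonneg hr]

lemma polar_re (r θ : ℝ) : (polar r θ).re = r * Real.cos θ := by
  rw [polar, Complex.re_ofReal_mul, Complex.exp_ofReal_mul_I_re]

lemma polar_im (r θ : ℝ) : (polar r θ).im = r * Real.sin θ := by
  rw [polar, Complex.im_ofReal_mul, Complex.exp_ofReal_mul_I_im]

lemma polar_pow (r θ : ℝ) (n : ℕ) :
    polar r θ ^ n = (r : ℂ) ^ n * Complex.exp (n * θ * Complex.I) := by
  rw [polar, mul_pow, ← Complex.exp_nat_mul]; ring_nf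

lemma continuous_polar (r : ℝ) : Continuous (polar r) := by unfold polar; fun_prop

/-! ### Bounds for logarithms near the quarter circle, uniform in the radius. -/

/-- The exponent -1/4 is chosen so that squares of logarithms are still dominated by the integrable
θ^(-1/2). With B = (2/θ)^(1/4) ≥ 1, the real part is at most 4B + 1 and the argument at most π < 4,
so the total is at most 9B ≤ 18 θ^(-1/4). -/
lemma norm_log_le_of_norm_bounds {w : ℂ} {θ : ℝ} (h0 : 0 < θ) (h2 : θ ≤ 2) (hl : θ / 2 ≤ ‖w‖)
    (hu : ‖w‖ ≤ 2) : ‖Complex.log w‖ ≤ 18 * θ ^ (-(1 / 4) : ℝ) := by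
  have hw : 0 < ‖w‖ := by linarith
  have h4 : (2 : ℝ) ^ (1 / 4 : ℝ) ≤ 2 := by
    calc (2 : ℝ) ^ (1 / 4 : ℝ) ≤ 2 ^ (1 : ℝ) :=
          Real.rpow_le_rpow_of_exponent_le (by norm_num) (by norm_num)
      _ = 2 := Real.rpow_one 2
  have hB : (2 / θ) ^ (1 / 4 : ℝ) ≤ 2 * θ ^ (-(1 / 4) : ℝ) := by
    rw [Real.div_rpow (by norm_num) h0.le, Real.rpow_neg h0.le, div_eq_mul_inv]
    gcongr
  have hB1 : 1 ≤ (2 / θ) ^ (1 / 4 : ℝ) :=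
    Real.one_le_rpow (by rw [le_div_iff₀ h0]; linarith) (by norm_num)
  have hlog : Real.log (2 / θ) ≤ 4 * (2 / θ) ^ (1 / 4 : ℝ) := by
    have := Real.log_le_rpow_div (x := 2 / θ) (by positivity) (show (0 : ℝ) < 1 / 4 by norm_num)
    linarith
  have h1 : |Real.log ‖w‖| ≤ 4 * (2 / θ) ^ (1 / 4 : ℝ) + 1 := by
    rw [abs_le]
    constructor
    · have : Real.log (θ / 2) ≤ Real.log ‖w‖ := Real.log_le_log (by positivity) hl
      have e : Real.log (θ / 2) = -Real.log (2 / θ) := by rw [← Real.log_inv, inv_div]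
      linarith
    · have : Real.log ‖w‖ ≤ ‖w‖ - 1 := Real.log_le_sub_one_of_pos hw
      linarith
  have h5 : ‖Complex.log w‖ ≤ |Real.log ‖w‖| + |Complex.arg w| := by
    have := Complex.norm_le_abs_re_add_abs_im (Complex.log w)
    rwa [Complex.log_re, Complex.log_im] at this
  have h6 := Complex.abs_arg_le_pi w
  have := Real.pi_lt_four
  linarith

lemma half_le_sin {θ : ℝ} (h0 : 0 ≤ θ) (h2 : θ ≤ Real.pi / 2) : θ / 2 ≤ Real.sin θ := by
  have h := Real.mul_le_sin h0 h2
  have : 1 / 2 ≤ 2 / Real.pi := by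
    rw [div_le_div_iff₀ (by norm_num) Real.pi_pos]; linarith [Real.pi_le_four]
  nlinarith

/-- The distance from 1 to the line through 0 in direction e^{iθ} is sin θ, whence a bound
independent of r. -/
lemma norm_one_sub_polar_ge {r θ : ℝ} (h0 : 0 ≤ θ) (h2 : θ ≤ Real.pi / 2) :
    θ / 2 ≤ ‖1 - polar r θ‖ := by
  refine (half_le_sin h0 h2).trans (abs_le_of_sq_le_sq' ?_ (norm_nonneg _)).2
  rw [Complex.sq_norm, Complex.normSq_apply]
  simp only [Complex.sub_re, Complex.sub_im, Complex.one_re, Complex.one_im, polar_re, polar_im]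
  nlinarith [Real.sin_sq_add_cos_sq θ, sq_nonneg (r - Real.cos θ)]

lemma norm_one_add_polar_ge {r θ : ℝ} (h0 : 0 ≤ θ) (h2 : θ ≤ Real.pi / 2) :
    θ / 2 ≤ ‖1 + polar r θ‖ := by
  refine (half_le_sin h0 h2).trans (abs_le_of_sq_le_sq' ?_ (norm_nonneg _)).2
  rw [Complex.sq_norm, Complex.normSq_apply]
  simp only [Complex.add_re, Complex.add_im, Complex.one_re, Complex.one_im, polar_re, polar_im]
  nlinarith [Real.sin_sq_add_cos_sq θ, sq_nonneg (r + Real.cos θ)]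

lemma norm_log_one_sub_polar_le {r θ : ℝ} (hr : 0 ≤ r) (hr1 : r ≤ 1) (h0 : 0 < θ)
    (h2 : θ ≤ Real.pi / 2) :
    ‖Complex.log (1 - polar r θ)‖ ≤ 18 * θ ^ (-(1 / 4) : ℝ) := by
  refine norm_log_le_of_norm_bounds h0 (by linarith [Real.pi_lt_four])
    (norm_one_sub_polar_ge h0.le h2) ?_
  have := norm_sub_le (1 : ℂ) (polar r θ)
  rw [norm_polar hr, norm_one] at this
  linarith

lemma norm_log_one_add_polar_le {r θ : ℝ} (hr : 0 ≤ r) (hr1 : r ≤ 1) (h0 : 0 < θ)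
    (h2 : θ ≤ Real.pi / 2) :
    ‖Complex.log (1 + polar r θ)‖ ≤ 18 * θ ^ (-(1 / 4) : ℝ) := by
  refine norm_log_le_of_norm_bounds h0 (by linarith [Real.pi_lt_four])
    (norm_one_add_polar_ge h0.le h2) ?_
  have := norm_add_le (1 : ℂ) (polar r θ)
  rw [norm_polar hr, norm_one] at this
  linarith

lemma one_sub_mem_slitPlane {z : ℂ} (hz : ‖z‖ ≤ 1) (h : z ≠ 1) : 1 - z ∈ Complex.slitPlane := by
  rw [Complex.mem_slitPlane_iff]
  have h1 : z.re ≤ 1 := (Complex.re_le_norm z).trans hz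
  rcases h1.lt_or_eq with h1 | h1
  · left; simpa using h1
  · exfalso
    apply h
    have h2 : z.re ^ 2 + z.im ^ 2 ≤ 1 := by
      have := Complex.normSq_apply z
      rw [← Complex.sq_norm] at this
      nlinarith [norm_nonneg z]
    rw [h1] at h2
    have h3 : z.im = 0 := by nlinarith [sq_nonneg z.im]
    exact Complex.ext (by simpa using h1) (by simpa using h3)

lemma one_add_mem_slitPlane {z : ℂ} (hz : ‖z‖ ≤ 1) (h : z ≠ -1) : 1 + z ∈ Complex.slitPlane := by
  have := one_sub_mem_slitPlane (z := -z) (by simpa using hz) (fun h' => h (by rw [← h', neg_neg]))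
  simpa using this

/-- A function of the form considered here: continuous on the closed disc off `±1`, with
singularities on the quarter circle that are integrable. -/
structure QuarterBound (F : ℂ → ℂ) : Prop where
  continuousAt : ∀ z, ‖z‖ ≤ 1 → z ≠ 1 → z ≠ -1 → ContinuousAt F z
  bound : ∃ K : ℝ, ∀ r θ : ℝ, 0 ≤ r → r ≤ 1 → 0 < θ → θ ≤ Real.pi / 2 →
    ‖F (polar r θ)‖ ≤ K * θ ^ (-(1 / 2) : ℝ)

lemma rpow_neg_quarter_le {θ : ℝ} (h0 : 0 < θ) (h2 : θ ≤ Real.pi / 2) :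
    θ ^ (-(1 / 4) : ℝ) ≤ 2 * θ ^ (-(1 / 2) : ℝ) := by
  have h : θ ^ (-(1 / 4) : ℝ) = θ ^ (1 / 4 : ℝ) * θ ^ (-(1 / 2) : ℝ) := by
    rw [← Real.rpow_add h0]; norm_num
  rw [h]
  gcongr
  calc θ ^ (1 / 4 : ℝ) ≤ 2 ^ (1 / 4 : ℝ) :=
        Real.rpow_le_rpow h0.le (by linarith [Real.pi_lt_four]) (by norm_num)
    _ ≤ 2 ^ (1 : ℝ) := Real.rpow_le_rpow_of_exponent_le (by norm_num) (by norm_num)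
    _ = 2 := Real.rpow_one 2

lemma norm_twoArtanh_polar_le {r θ : ℝ} (hr : 0 ≤ r) (hr1 : r ≤ 1) (h0 : 0 < θ)
    (h2 : θ ≤ Real.pi / 2) : ‖twoArtanh (polar r θ)‖ ≤ 36 * θ ^ (-(1 / 4) : ℝ) := by
  have := norm_sub_le (Complex.log (1 + polar r θ)) (Complex.log (1 - polar r θ))
  have h3 := norm_log_one_sub_polar_le hr hr1 h0 h2
  have h4 := norm_log_one_add_polar_le hr hr1 h0 h2
  rw [twoArtanh]; linarith

lemma norm_sq_le_of_quarter {w : ℂ} {θ K : ℝ} (h0 : 0 < θ) (h : ‖w‖ ≤ K * θ ^ (-(1 / 4) : ℝ)) :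
    ‖w ^ 2‖ ≤ K ^ 2 * θ ^ (-(1 / 2) : ℝ) := by
  rw [norm_pow]
  calc ‖w‖ ^ 2 ≤ (K * θ ^ (-(1 / 4) : ℝ)) ^ 2 := by gcongr
    _ = K ^ 2 * θ ^ (-(1 / 2) : ℝ) := by
      rw [mul_pow, ← Real.rpow_natCast (θ ^ _), ← Real.rpow_mul h0.le]; norm_num

lemma continuousAt_log_one_sub {z : ℂ} (hz : ‖z‖ ≤ 1) (h : z ≠ 1) :
    ContinuousAt (fun z => Complex.log (1 - z)) z :=
  (continuousAt_const.sub continuousAt_id).clog (one_sub_mem_slitPlane hz h)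

lemma continuousAt_log_one_add {z : ℂ} (hz : ‖z‖ ≤ 1) (h : z ≠ -1) :
    ContinuousAt (fun z => Complex.log (1 + z)) z :=
  (continuousAt_const.add continuousAt_id).clog (one_add_mem_slitPlane hz h)

lemma continuousAt_twoArtanh {z : ℂ} (hz : ‖z‖ ≤ 1) (h : z ≠ 1) (h' : z ≠ -1) :
    ContinuousAt twoArtanh z :=
  (continuousAt_log_one_add hz h').sub (continuousAt_log_one_sub hz h)

lemma quarterBound_log_one_add : QuarterBound fun z => Complex.log (1 + z) where
  continuousAt z hz _ h := continuousAt_log_one_add hz h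
  bound := ⟨36, fun r θ hr hr1 h0 h2 => by
    have h1 := norm_log_one_add_polar_le hr hr1 h0 h2
    have h2 := rpow_neg_quarter_le h0 h2
    linarith⟩

lemma quarterBound_twoArtanh : QuarterBound twoArtanh where
  continuousAt _ hz h h' := continuousAt_twoArtanh hz h h'
  bound := ⟨72, fun r θ hr hr1 h0 h2 => by
    have h1 := norm_twoArtanh_polar_le hr hr1 h0 h2
    have h2 := rpow_neg_quarter_le h0 h2
    linarith⟩

lemma quarterBound_twoArtanh_sq : QuarterBound fun z => twoArtanh z ^ 2 where
  continuousAt _ hz h h' := (continuousAt_twoArtanh hz h h').pow 2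
  bound := ⟨36 ^ 2, fun _ _ hr hr1 h0 h2 =>
    norm_sq_le_of_quarter h0 (norm_twoArtanh_polar_le hr hr1 h0 h2)⟩

lemma quarterBound_log_one_add_sq : QuarterBound fun z => Complex.log (1 + z) ^ 2 where
  continuousAt _ hz _ h' := (continuousAt_log_one_add hz h').pow 2
  bound := ⟨18 ^ 2, fun _ _ hr hr1 h0 h2 =>
    norm_sq_le_of_quarter h0 (norm_log_one_add_polar_le hr hr1 h0 h2)⟩

lemma quarterBound_log_one_sub_sq : QuarterBound fun z => Complex.log (1 - z) ^ 2 where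
  continuousAt _ hz h _ := (continuousAt_log_one_sub hz h).pow 2
  bound := ⟨18 ^ 2, fun _ _ hr hr1 h0 h2 =>
    norm_sq_le_of_quarter h0 (norm_log_one_sub_polar_le hr hr1 h0 h2)⟩

/-- The moments `∫_0^{π/2} w(θ) e^{ikθ} dθ`. -/
noncomputable def quarterMoment (w : ℝ → ℝ) (k : ℕ) : ℂ :=
  ∫ θ in (0 : ℝ)..Real.pi / 2, (w θ : ℂ) * Complex.exp (k * θ * Complex.I)

lemma polar_ne_of_mem {r θ : ℝ} (hr : 0 < r) (hθ : θ ∈ Set.Ioo 0 (Real.pi / 2)) :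
    polar r θ ≠ 1 ∧ polar r θ ≠ -1 := by
  have : 0 < (polar r θ).im := by
    rw [polar_im]
    exact mul_pos hr (Real.sin_pos_of_pos_of_lt_pi hθ.1 (by linarith [hθ.2, Real.pi_pos]))
  constructor <;> intro h <;> rw [h] at this <;> simp at this

lemma intervalIntegrable_rpow_neg_half (K : ℝ) :
    IntervalIntegrable (fun θ : ℝ => K * θ ^ (-(1 / 2) : ℝ)) MeasureTheory.volume 0
      (Real.pi / 2) :=
  (intervalIntegral.intervalIntegrable_rpow' (by norm_num)).const_mul K

lemma hasSum_quarter_integral_of_lt_one {F : ℂ → ℂ} {c : ℕ → ℂ} {e : ℕ → ℕ} {w : ℝ → ℝ}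
    (hF : ∀ z, ‖z‖ < 1 → HasSum (fun n => c n * z ^ e n) (F z)) (hw : Continuous w)
    {r : ℝ} (hr0 : 0 ≤ r) (hr1 : r < 1) :
    HasSum (fun n => c n * (r : ℂ) ^ e n * quarterMoment w (e n))
      (∫ θ in (0 : ℝ)..Real.pi / 2, (w θ : ℂ) * F (polar r θ)) := by
  have hs : Summable fun n => ‖c n * (r : ℂ) ^ e n‖ := by
    refine Summable.norm (hF (r : ℂ) ?_).summable
    rwa [Complex.norm_real, Real.norm_of_nonneg hr0]
  have key := intervalIntegral.hasSum_integral_of_dominated_convergence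
    (μ := MeasureTheory.volume) (a := 0) (b := Real.pi / 2)
    (F := fun n θ => (w θ : ℂ) * (c n * polar r θ ^ e n))
    (f := fun θ => (w θ : ℂ) * F (polar r θ))
    (fun n θ => |w θ| * ‖c n * (r : ℂ) ^ e n‖) ?_ ?_ ?_ ?_ ?_
  · refine key.congr_fun fun n => ?_
    rw [quarterMoment, ← intervalIntegral.integral_const_mul]
    refine intervalIntegral.integral_congr fun θ _ => ?_
    simp only [polar_pow]
    ring
  · intro n
    have := continuous_polar r
    exact Continuous.aestronglyMeasurable (by fun_prop)
  · intro n
    refine MeasureTheory.ae_of_all _ fun θ _ => ?_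
    rw [norm_mul, Complex.norm_real, Real.norm_eq_abs, norm_mul, norm_mul, norm_pow, norm_pow,
      norm_polar hr0, Complex.norm_real, Real.norm_of_nonneg hr0]
  · exact MeasureTheory.ae_of_all _ fun θ _ => hs.mul_left _
  · have : (fun t => ∑' n, |w t| * ‖c n * (r : ℂ) ^ e n‖) =
        fun t => |w t| * ∑' n, ‖c n * (r : ℂ) ^ e n‖ := by
      funext t; rw [tsum_mul_left]
    rw [this]
    exact (hw.abs.mul continuous_const).intervalIntegrable _ _
  · refine MeasureTheory.ae_of_all _ fun θ _ => ?_
    exact (hF _ (by rwa [norm_polar hr0])).mul_left _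

/-- The integral of the boundary values of a power series against a weight `w` is computed
termwise, as soon as the resulting series converges absolutely. -/
theorem hasSum_quarter_integral {F : ℂ → ℂ} {c : ℕ → ℂ} {e : ℕ → ℕ} {w : ℝ → ℝ}
    (hF : ∀ z, ‖z‖ < 1 → HasSum (fun n => c n * z ^ e n) (F z)) (hB : QuarterBound F)
    (hw : Continuous w) (hs : Summable fun n => ‖c n * quarterMoment w (e n)‖) :
    HasSum (fun n => c n * quarterMoment w (e n))
      (∫ θ in (0 : ℝ)..Real.pi / 2, (w θ : ℂ) * F (polar 1 θ)) := by
  obtain ⟨K, hK⟩ := hB.bound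
  obtain ⟨M, hM⟩ := (isCompact_Icc (a := (0 : ℝ)) (b := Real.pi / 2)).exists_bound_of_continuousOn
    hw.continuousOn
  have hpi : 0 ≤ Real.pi / 2 := by positivity
  have hev : ∀ᶠ r in 𝓝[<] (1 : ℝ), 0 < r ∧ r < 1 :=
    (eventually_nhdsWithin_of_eventually_nhds (lt_mem_nhds one_pos)).and self_mem_nhdsWithin
  -- Abel summation: the integrals over circles of radius r < 1 tend to the boundary integral
  -- (majorant M K θ^(-1/2)), the corresponding series tend to the series at r = 1 (majorant from
  -- `hs`), and the two agree for every r < 1.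
  have hlim1 : Tendsto (fun r : ℝ => ∫ θ in (0 : ℝ)..Real.pi / 2, (w θ : ℂ) * F (polar r θ))
      (𝓝[<] 1) (𝓝 (∫ θ in (0 : ℝ)..Real.pi / 2, (w θ : ℂ) * F (polar 1 θ))) := by
    refine intervalIntegral.tendsto_integral_filter_of_dominated_convergence
      (fun θ => (M * K) * θ ^ (-(1 / 2) : ℝ)) ?_ ?_ (intervalIntegrable_rpow_neg_half _) ?_
    · filter_upwards [hev] with r hr
      have hc : Continuous fun θ => F (polar r θ) := continuous_iff_continuousAt.2 fun θ => by
        have hn : ‖polar r θ‖ < 1 := by rw [norm_polar hr.1.le]; exact hr.2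
        refine (hB.continuousAt _ hn.le ?_ ?_).comp (continuous_polar r).continuousAt
        · rintro h; rw [h] at hn; simp at hn
        · rintro h; rw [h] at hn; simp at hn
      exact ((Complex.continuous_ofReal.comp hw).mul hc).aestronglyMeasurable
    · filter_upwards [hev] with r hr
      refine MeasureTheory.ae_of_all _ fun θ hθ => ?_
      rw [Set.uIoc_of_le hpi] at hθ
      rw [norm_mul, Complex.norm_real, mul_assoc]
      have h1 := hK r θ hr.1.le hr.2.le hθ.1 hθ.2
      have h2 := hM θ ⟨hθ.1.le, hθ.2⟩
      exact mul_le_mul h2 h1 (norm_nonneg _) ((norm_nonneg _).trans h2)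
    · have hne : ∀ᵐ θ : ℝ, θ ≠ Real.pi / 2 := by
        simp [MeasureTheory.ae_iff]
      filter_upwards [hne] with θ hne hθ
      rw [Set.uIoc_of_le hpi] at hθ
      have hθ' : θ ∈ Set.Ioo 0 (Real.pi / 2) := ⟨hθ.1, lt_of_le_of_ne hθ.2 hne⟩
      have h1 := polar_ne_of_mem one_pos hθ'
      have h2 : ContinuousAt F (polar 1 θ) :=
        hB.continuousAt _ (by rw [norm_polar zero_le_one]) h1.1 h1.2
      have h3 : Continuous fun r => polar r θ := by unfold polar; fun_prop
      have h4 : Tendsto (fun r => F (polar r θ)) (𝓝 1) (𝓝 (F (polar 1 θ))) :=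
        ContinuousAt.comp (f := fun r => polar r θ) (x := 1) h2 h3.continuousAt
      exact (h4.mono_left nhdsWithin_le_nhds).const_mul _
  have hlim2 : Tendsto (fun r : ℝ => ∑' n, c n * (r : ℂ) ^ e n * quarterMoment w (e n))
      (𝓝[<] 1) (𝓝 (∑' n, c n * quarterMoment w (e n))) := by
    refine tendsto_tsum_of_dominated_convergence hs (fun n => ?_) ?_
    · have : Continuous fun r : ℝ => c n * (r : ℂ) ^ e n * quarterMoment w (e n) := by fun_prop
      have h := this.tendsto 1
      simp only [Complex.ofReal_one, one_pow, mul_one] at h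
      exact h.mono_left nhdsWithin_le_nhds
    · filter_upwards [hev] with r hr n
      rw [mul_right_comm, norm_mul _ ((r : ℂ) ^ e n), norm_pow, Complex.norm_real,
        Real.norm_of_nonneg hr.1.le]
      exact mul_le_of_le_one_right (norm_nonneg _) (pow_le_one₀ hr.1.le hr.2.le)
  have heq : (fun r : ℝ => ∑' n, c n * (r : ℂ) ^ e n * quarterMoment w (e n)) =ᶠ[𝓝[<] 1]
      fun r : ℝ => ∫ θ in (0 : ℝ)..Real.pi / 2, (w θ : ℂ) * F (polar r θ) := by
    filter_upwards [hev] with r hr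
    exact (hasSum_quarter_integral_of_lt_one hF hw hr.1.le hr.2).tsum_eq
  rw [← tendsto_nhds_unique (hlim2.congr' heq) hlim1]
  exact hs.of_norm.hasSum

/-! ### Moments -/

lemma exp_natCast_mul_pi_div_two (k : ℕ) :
    Complex.exp (k * ((Real.pi / 2 : ℝ) : ℂ) * Complex.I) = Complex.I ^ k := by
  rw [mul_assoc, Complex.exp_nat_mul]
  push_cast
  rw [Complex.exp_pi_div_two_mul_I]

lemma hasDerivAt_exp_natCast_mul (k : ℕ) (θ : ℝ) :
    HasDerivAt (fun θ : ℝ => Complex.exp (k * θ * Complex.I))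
      (k * Complex.I * Complex.exp (k * θ * Complex.I)) θ := by
  have h : HasDerivAt (fun θ : ℝ => (k : ℂ) * θ * Complex.I) (k * 1 * Complex.I) θ :=
    ((Complex.ofRealCLM.hasDerivAt (x := θ)).const_mul (k : ℂ)).mul_const Complex.I
  convert h.cexp using 1
  ring

lemma quarterMoment_one {k : ℕ} (hk : k ≠ 0) :
    quarterMoment (fun _ => 1) k = (Complex.I ^ k - 1) / (k * Complex.I) := by
  have hk' : (k : ℂ) ≠ 0 := Nat.cast_ne_zero.2 hk
  have h := intervalIntegral.integral_eq_sub_of_hasDerivAt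
    (f := fun θ : ℝ => Complex.exp (k * θ * Complex.I) / (k * Complex.I))
    (f' := fun θ : ℝ => ((1 : ℝ) : ℂ) * Complex.exp (k * θ * Complex.I)) (a := 0)
    (b := Real.pi / 2) ?_ ?_
  · rw [quarterMoment, h, exp_natCast_mul_pi_div_two]
    simp only [Complex.ofReal_zero, mul_zero, zero_mul, Complex.exp_zero]
    ring
  · intro θ _
    refine ((hasDerivAt_exp_natCast_mul k θ).div_const (k * Complex.I)).congr_deriv ?_
    rw [Complex.ofReal_one, one_mul, mul_div_cancel_left₀ _ (mul_ne_zero hk' Complex.I_ne_zero)]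
  · exact Continuous.intervalIntegrable (by fun_prop) _ _

lemma quarterMoment_id {k : ℕ} (hk : k ≠ 0) :
    quarterMoment (fun θ => θ) k =
      ((Real.pi / 2 : ℝ) : ℂ) * Complex.I ^ k / (k * Complex.I) +
        (Complex.I ^ k - 1) / (k : ℂ) ^ 2 := by
  have hk' : (k : ℂ) ≠ 0 := Nat.cast_ne_zero.2 hk
  have h := intervalIntegral.integral_eq_sub_of_hasDerivAt
    (f := fun θ : ℝ => (θ : ℂ) * Complex.exp (k * θ * Complex.I) / (k * Complex.I) +
      Complex.exp (k * θ * Complex.I) / (k : ℂ) ^ 2)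
    (f' := fun θ : ℝ => (θ : ℂ) * Complex.exp (k * θ * Complex.I)) (a := 0)
    (b := Real.pi / 2) ?_ ?_
  · rw [quarterMoment, h, exp_natCast_mul_pi_div_two]
    simp only [Complex.ofReal_zero, mul_zero, zero_mul, Complex.exp_zero]
    ring
  · intro θ _
    have h1 := hasDerivAt_exp_natCast_mul k θ
    refine ((((Complex.ofRealCLM.hasDerivAt (x := θ)).mul h1).div_const (k * Complex.I)).add
      (h1.div_const ((k : ℂ) ^ 2))).congr_deriv ?_
    have h2 := Complex.I_sq
    have h3 := Complex.I_ne_zero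
    change (1 * Complex.exp (k * θ * Complex.I) +
      (θ : ℂ) * (k * Complex.I * Complex.exp (k * θ * Complex.I))) / (k * Complex.I) + _ = _
    field_simp
    linear_combination h2
  · exact Continuous.intervalIntegrable (by fun_prop) _ _

lemma norm_I_pow_sub_one_le (k : ℕ) : ‖Complex.I ^ k - 1‖ ≤ 2 := by
  refine (norm_sub_le _ _).trans ?_
  rw [norm_pow, Complex.norm_I, one_pow, norm_one]; norm_num

/-- The constant 4 is deliberately not sharp: it matches the bound for the weight θ, so that one
form of hypothesis serves both weights in `hasSum_quarter_integral_re`. -/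
lemma norm_quarterMoment_one_le {k : ℕ} (hk : k ≠ 0) :
    ‖quarterMoment (fun _ => 1) k‖ ≤ 4 / k := by
  rw [quarterMoment_one hk, norm_div, norm_mul, Complex.norm_I, mul_one, Complex.norm_natCast]
  gcongr
  exact (norm_I_pow_sub_one_le k).trans (by norm_num)

lemma norm_quarterMoment_id_le {k : ℕ} (hk : k ≠ 0) :
    ‖quarterMoment (fun θ => θ) k‖ ≤ 4 / k := by
  have hk1 : (1 : ℝ) ≤ k := by exact_mod_cast Nat.one_le_iff_ne_zero.2 hk
  rw [quarterMoment_id hk]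
  refine (norm_add_le _ _).trans ?_
  rw [norm_div, norm_mul, norm_mul, Complex.norm_I, mul_one, norm_div, norm_pow, norm_pow,
    Complex.norm_I, one_pow, mul_one, Complex.norm_natCast, Complex.norm_real,
    Real.norm_of_nonneg (by positivity)]
  have h1 : ‖Complex.I ^ k - 1‖ / (k : ℝ) ^ 2 ≤ 2 / k := by
    rw [div_le_div_iff₀ (by positivity) (by positivity)]
    nlinarith [norm_I_pow_sub_one_le k, norm_nonneg (Complex.I ^ k - 1),
      mul_le_mul_of_nonneg_right (norm_I_pow_sub_one_le k) (by linarith : (0 : ℝ) ≤ k)]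
  have h2 : Real.pi / 2 / k ≤ 2 / k := by
    gcongr; linarith [Real.pi_le_four]
  calc _ ≤ 2 / (k : ℝ) + 2 / k := add_le_add h2 h1
    _ = 4 / k := by ring

lemma re_ofReal_add_ofReal_mul_I (x y : ℝ) : ((x : ℂ) + (y : ℂ) * Complex.I).re = x := by simp

lemma I_pow_two_mul_add_one (m : ℕ) : Complex.I ^ (2 * m + 1) = ((-1 : ℝ) ^ m : ℝ) * Complex.I := by
  rw [pow_succ, pow_mul, Complex.I_sq]; push_cast; rfl

lemma I_pow_two_mul (m : ℕ) : Complex.I ^ (2 * m) = ((-1 : ℝ) ^ m : ℝ) := by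
  rw [pow_mul, Complex.I_sq]; push_cast; rfl

lemma quarterMoment_one_odd_re (m : ℕ) :
    (quarterMoment (fun _ => 1) (2 * m + 1)).re = (-1) ^ m / (2 * (m : ℝ) + 1) := by
  rw [quarterMoment_one (by omega), I_pow_two_mul_add_one]
  have h : ((((-1 : ℝ) ^ m : ℝ) : ℂ) * Complex.I - 1) / (((2 * m + 1 : ℕ) : ℂ) * Complex.I) =
      (((-1) ^ m / (2 * (m : ℝ) + 1) : ℝ) : ℂ) + ((1 / (2 * (m : ℝ) + 1) : ℝ) : ℂ) * Complex.I := by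
    have : (2 * (m : ℂ) + 1) ≠ 0 := by exact_mod_cast (2 * m).succ_ne_zero
    have h2 := Complex.I_sq
    have := Complex.I_ne_zero
    push_cast
    field_simp
    linear_combination -h2
  rw [h, re_ofReal_add_ofReal_mul_I]

lemma quarterMoment_one_even_re {m : ℕ} (hm : m ≠ 0) :
    (quarterMoment (fun _ => 1) (2 * m)).re = 0 := by
  rw [quarterMoment_one (by omega), I_pow_two_mul]
  have h : ((((-1 : ℝ) ^ m : ℝ) : ℂ) - 1) / (((2 * m : ℕ) : ℂ) * Complex.I) =
      ((((1 - (-1) ^ m) / (2 * (m : ℝ))) : ℝ) : ℂ) * Complex.I := by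
    have : (m : ℂ) ≠ 0 := Nat.cast_ne_zero.2 hm
    have h2 := Complex.I_sq
    have := Complex.I_ne_zero
    push_cast
    field_simp
    linear_combination (1 - (-1 : ℂ) ^ m) * (-h2)
  rw [h, Complex.re_ofReal_mul, Complex.I_re, mul_zero]

lemma quarterMoment_id_odd_re (m : ℕ) :
    (quarterMoment (fun θ => θ) (2 * m + 1)).re =
      Real.pi / 2 * (-1) ^ m / (2 * (m : ℝ) + 1) - 1 / (2 * (m : ℝ) + 1) ^ 2 := by
  rw [quarterMoment_id (by omega), I_pow_two_mul_add_one]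
  have h : ((Real.pi / 2 : ℝ) : ℂ) * ((((-1 : ℝ) ^ m : ℝ) : ℂ) * Complex.I) /
        (((2 * m + 1 : ℕ) : ℂ) * Complex.I) +
      ((((-1 : ℝ) ^ m : ℝ) : ℂ) * Complex.I - 1) / (((2 * m + 1 : ℕ) : ℂ)) ^ 2 =
      ((Real.pi / 2 * (-1) ^ m / (2 * (m : ℝ) + 1) - 1 / (2 * (m : ℝ) + 1) ^ 2 : ℝ) : ℂ) +
        (((-1) ^ m / (2 * (m : ℝ) + 1) ^ 2 : ℝ) : ℂ) * Complex.I := by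
    have : (2 * (m : ℂ) + 1) ≠ 0 := by exact_mod_cast (2 * m).succ_ne_zero
    have := Complex.I_ne_zero
    push_cast
    field_simp
    ring
  rw [h, re_ofReal_add_ofReal_mul_I]

lemma quarterMoment_id_even_re {m : ℕ} (hm : m ≠ 0) :
    (quarterMoment (fun θ => θ) (2 * m)).re = ((-1) ^ m - 1) / (2 * (m : ℝ)) ^ 2 := by
  rw [quarterMoment_id (by omega), I_pow_two_mul]
  have h : ((Real.pi / 2 : ℝ) : ℂ) * (((-1 : ℝ) ^ m : ℝ) : ℂ) / (((2 * m : ℕ) : ℂ) * Complex.I) +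
      ((((-1 : ℝ) ^ m : ℝ) : ℂ) - 1) / (((2 * m : ℕ) : ℂ)) ^ 2 =
      ((((-1) ^ m - 1) / (2 * (m : ℝ)) ^ 2 : ℝ) : ℂ) +
        ((-(Real.pi / 2 * (-1) ^ m / (2 * (m : ℝ))) : ℝ) : ℂ) * Complex.I := by
    have : (m : ℂ) ≠ 0 := Nat.cast_ne_zero.2 hm
    have h2 := Complex.I_sq
    have := Complex.I_ne_zero
    push_cast
    field_simp
    linear_combination (Real.pi : ℂ) * m * (-1 : ℂ) ^ m * h2
  rw [h, re_ofReal_add_ofReal_mul_I]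

/-! ### Boundary values -/

/-- Half-angle factorisation 1 + e^{iθ} = 2 cos(θ/2) e^{iθ/2}; the angle θ/2 is in the principal
range, so the branch needs no correction. -/
lemma log_one_add_polar {θ : ℝ} (h0 : 0 < θ) (h2 : θ ≤ Real.pi / 2) :
    Complex.log (1 + polar 1 θ) =
      (Real.log (2 * Real.cos (θ / 2)) : ℂ) + ((θ / 2 : ℝ) : ℂ) * Complex.I := by
  have hpi := Real.pi_pos
  have hc : 0 < 2 * Real.cos (θ / 2) :=
    mul_pos two_pos (Real.cos_pos_of_mem_Ioo ⟨by linarith, by linarith⟩)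
  have h : 1 + polar 1 θ =
      ((2 * Real.cos (θ / 2) : ℝ) : ℂ) * Complex.exp (((θ / 2 : ℝ) : ℂ) * Complex.I) := by
    apply Complex.ext
    · rw [Complex.re_ofReal_mul, Complex.exp_ofReal_mul_I_re, Complex.add_re, polar_re,
        Complex.one_re, one_mul]
      have := Real.cos_sq (θ / 2)
      rw [show 2 * (θ / 2) = θ by ring] at this
      nlinarith
    · rw [Complex.im_ofReal_mul, Complex.exp_ofReal_mul_I_im, Complex.add_im, polar_im,
        Complex.one_im, one_mul]
      have := Real.sin_two_mul (θ / 2)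
      rw [show 2 * (θ / 2) = θ by ring] at this
      linarith
  rw [h, Complex.log_ofReal_mul hc (Complex.exp_ne_zero _), Complex.log_exp]
  · simp only [Complex.mul_im, Complex.ofReal_re, Complex.I_im, Complex.ofReal_im, Complex.I_re]
    linarith
  · simp only [Complex.mul_im, Complex.ofReal_re, Complex.I_im, Complex.ofReal_im, Complex.I_re]
    linarith

/-- Likewise 1 - e^{iθ} = 2 sin(θ/2) e^{i(θ-π)/2}, again with a principal angle. -/
lemma log_one_sub_polar {θ : ℝ} (h0 : 0 < θ) (h2 : θ ≤ Real.pi / 2) :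
    Complex.log (1 - polar 1 θ) =
      (Real.log (2 * Real.sin (θ / 2)) : ℂ) + (((θ - Real.pi) / 2 : ℝ) : ℂ) * Complex.I := by
  have hpi := Real.pi_pos
  have hc : 0 < 2 * Real.sin (θ / 2) :=
    mul_pos two_pos (Real.sin_pos_of_pos_of_lt_pi (by linarith) (by linarith))
  have hs : Real.sin ((θ - Real.pi) / 2) = -Real.cos (θ / 2) := by
    rw [sub_div, Real.sin_sub_pi_div_two]
  have hcos : Real.cos ((θ - Real.pi) / 2) = Real.sin (θ / 2) := by
    rw [sub_div, Real.cos_sub_pi_div_two]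
  have h : 1 - polar 1 θ = ((2 * Real.sin (θ / 2) : ℝ) : ℂ) *
      Complex.exp ((((θ - Real.pi) / 2 : ℝ) : ℂ) * Complex.I) := by
    apply Complex.ext
    · rw [Complex.re_ofReal_mul, Complex.exp_ofReal_mul_I_re, Complex.sub_re, polar_re,
        Complex.one_re, one_mul, hcos]
      have := Real.cos_sq (θ / 2)
      rw [show 2 * (θ / 2) = θ by ring] at this
      nlinarith [Real.sin_sq_add_cos_sq (θ / 2)]
    · rw [Complex.im_ofReal_mul, Complex.exp_ofReal_mul_I_im, Complex.sub_im, polar_im,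
        Complex.one_im, one_mul, hs]
      have := Real.sin_two_mul (θ / 2)
      rw [show 2 * (θ / 2) = θ by ring] at this
      linarith
  rw [h, Complex.log_ofReal_mul hc (Complex.exp_ne_zero _), Complex.log_exp]
  · simp only [Complex.mul_im, Complex.ofReal_re, Complex.I_im, Complex.ofReal_im, Complex.I_re]
    linarith
  · simp only [Complex.mul_im, Complex.ofReal_re, Complex.I_im, Complex.ofReal_im, Complex.I_re]
    linarith

/-- `log (2 cos (θ/2))`, the real part of `log (1 + e^{iθ})`. -/
noncomputable def logCos (θ : ℝ) : ℝ := Real.log (2 * Real.cos (θ / 2))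

/-- `log (2 sin (θ/2))`, the real part of `log (1 - e^{iθ})`. -/
noncomputable def logSin (θ : ℝ) : ℝ := Real.log (2 * Real.sin (θ / 2))

/-- The map z ↦ (1+z)/(1-z) sends the upper half of the unit circle to the positive imaginary axis,
so the imaginary part is the constant π/2. The real part of the square is therefore just `logCot`
squared minus π²/4. -/
lemma twoArtanh_polar {θ : ℝ} (h0 : 0 < θ) (h2 : θ ≤ Real.pi / 2) :
    twoArtanh (polar 1 θ) =
      ((logCos θ - logSin θ : ℝ) : ℂ) + ((Real.pi / 2 : ℝ) : ℂ) * Complex.I := by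
  rw [twoArtanh, log_one_add_polar h0 h2, log_one_sub_polar h0 h2, logCos, logSin]
  push_cast; ring

lemma re_add_mul_I_sq (x y : ℝ) : (((x : ℂ) + (y : ℂ) * Complex.I) ^ 2).re = x ^ 2 - y ^ 2 := by
  simp [sq]

lemma intervalIntegrable_quarter {F : ℂ → ℂ} (hB : QuarterBound F) {w : ℝ → ℝ}
    (hw : Continuous w) :
    IntervalIntegrable (fun θ => (w θ : ℂ) * F (polar 1 θ)) MeasureTheory.volume 0
      (Real.pi / 2) := by
  obtain ⟨K, hK⟩ := hB.bound
  obtain ⟨M, hM⟩ := (isCompact_Icc (a := (0 : ℝ)) (b := Real.pi / 2)).exists_bound_of_continuousOn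
    hw.continuousOn
  have hpi : 0 ≤ Real.pi / 2 := by positivity
  refine (intervalIntegrable_rpow_neg_half (M * K)).mono_fun ?_ ?_
  · rw [Set.uIoc_of_le hpi]
    refine ContinuousOn.aestronglyMeasurable (fun θ hθ => ?_) measurableSet_Ioc
    have h1 : polar 1 θ ≠ 1 ∧ polar 1 θ ≠ -1 := by
      have : 0 < (polar 1 θ).im := by
        rw [polar_im, one_mul]
        exact Real.sin_pos_of_pos_of_lt_pi hθ.1 (by linarith [hθ.2, Real.pi_pos])
      constructor <;> intro h <;> rw [h] at this <;> simp at this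
    have h2 : ContinuousAt F (polar 1 θ) :=
      hB.continuousAt _ (by rw [norm_polar zero_le_one]) h1.1 h1.2
    exact ((Complex.continuous_ofReal.comp hw).continuousAt.mul
      (ContinuousAt.comp h2 (continuous_polar 1).continuousAt)).continuousWithinAt
  · rw [Set.uIoc_of_le hpi]
    refine (MeasureTheory.ae_restrict_iff' measurableSet_Ioc).2
      (MeasureTheory.ae_of_all _ fun θ hθ => ?_)
    simp only [norm_mul ((w θ : ℂ)), Complex.norm_real]
    rw [mul_assoc]
    have h1 := hK 1 θ zero_le_one le_rfl hθ.1 hθ.2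
    have h2 := hM θ ⟨hθ.1.le, hθ.2⟩
    exact (mul_le_mul h2 h1 (norm_nonneg _) ((norm_nonneg _).trans h2)).trans (le_abs_self _)

/-- Real part of `hasSum_quarter_integral`, for a power series with real coefficients. -/
theorem hasSum_quarter_integral_re {F : ℂ → ℂ} {c : ℕ → ℝ} {e : ℕ → ℕ} {w g : ℝ → ℝ}
    (hF : ∀ z, ‖z‖ < 1 → HasSum (fun n => (c n : ℂ) * z ^ e n) (F z)) (hB : QuarterBound F)
    (hw : Continuous w) (hs : Summable fun n => |c n| * (4 / (e n : ℝ)))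
    (hwm : ∀ n, ‖quarterMoment w (e n)‖ ≤ 4 / (e n : ℝ))
    (hg : ∀ θ, 0 < θ → θ ≤ Real.pi / 2 → (F (polar 1 θ)).re = g θ) :
    HasSum (fun n => c n * (quarterMoment w (e n)).re) (∫ θ in (0 : ℝ)..Real.pi / 2, w θ * g θ) ∧
      IntervalIntegrable (fun θ => w θ * g θ) MeasureTheory.volume 0 (Real.pi / 2) := by
  have hpi : 0 ≤ Real.pi / 2 := by positivity
  have hint := intervalIntegrable_quarter hB hw
  have h := hasSum_quarter_integral hF hB hw (Summable.of_nonneg_of_le (fun _ => norm_nonneg _)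
    (fun n => by
      rw [norm_mul, Complex.norm_real]
      exact mul_le_mul_of_nonneg_left (hwm n) (norm_nonneg _)) hs)
  have h2 := Complex.hasSum_re h
  have h3 : Set.EqOn (fun θ => ((w θ : ℂ) * F (polar 1 θ)).re) (fun θ => w θ * g θ)
      (Set.uIoc 0 (Real.pi / 2)) := by
    intro θ hθ
    rw [Set.uIoc_of_le hpi] at hθ
    simp only [Complex.re_ofReal_mul, hg θ hθ.1 hθ.2]
  have hre : (∫ θ in (0 : ℝ)..Real.pi / 2, (w θ : ℂ) * F (polar 1 θ)).re =
      ∫ θ in (0 : ℝ)..Real.pi / 2, w θ * g θ := by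
    have := Complex.reCLM.intervalIntegral_comp_comm hint
    simp only [Complex.reCLM_apply] at this
    rw [← this]
    exact intervalIntegral.integral_congr_ae (MeasureTheory.ae_of_all _ fun θ hθ => h3 hθ)
  rw [hre] at h2
  simp only [Complex.re_ofReal_mul] at h2
  refine ⟨h2, ?_⟩
  have hi : IntervalIntegrable (fun θ => ((w θ : ℂ) * F (polar 1 θ)).re) MeasureTheory.volume 0
      (Real.pi / 2) := by
    rw [intervalIntegrable_iff] at hint ⊢
    exact hint.re
  exact hi.congr h3

/-! ### Integrals over the quarter circle -/

lemma summable_one_div_two_mul_add_one_sq : Summable fun n : ℕ => 1 / (2 * (n : ℝ) + 1) ^ 2 := by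
  have h := (summable_nat_add_iff 1).2 (Real.summable_one_div_nat_pow.2 (one_lt_two))
  refine Summable.of_nonneg_of_le (fun n => by positivity) (fun n => ?_) h
  push_cast
  gcongr
  linarith [n.cast_nonneg (α := ℝ)]

lemma hasSum_catalanG : HasSum (fun n : ℕ => (-1 : ℝ) ^ n / (2 * (n : ℝ) + 1) ^ 2) catalanG := by
  refine Summable.hasSum (Summable.of_norm ?_)
  refine summable_one_div_two_mul_add_one_sq.congr fun n => ?_
  rw [norm_div, norm_pow, norm_neg, norm_one, one_pow, Real.norm_of_nonneg (by positivity)]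

/-- `Re log ((1 + e^{iθ})/(1 - e^{iθ})) = -log (tan (θ/2))`. -/
noncomputable def logCot (θ : ℝ) : ℝ := logCos θ - logSin θ

lemma summable_twoArtanh_coeff :
    Summable fun n : ℕ => |2 * (1 / (2 * (n : ℝ) + 1))| * (4 / ((2 * n + 1 : ℕ) : ℝ)) := by
  refine (summable_one_div_two_mul_add_one_sq.mul_left 8).congr fun n => ?_
  rw [abs_of_nonneg (by positivity)]
  push_cast
  field_simp
  norm_num

lemma hasSum_twoArtanh_real {z : ℂ} (hz : ‖z‖ < 1) :
    HasSum (fun n : ℕ => ((2 * (1 / (2 * (n : ℝ) + 1)) : ℝ) : ℂ) * z ^ (2 * n + 1))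
      (twoArtanh z) := by
  refine (hasSum_twoArtanh hz).congr_fun fun n => ?_
  push_cast; rfl

lemma re_twoArtanh_polar {θ : ℝ} (h0 : 0 < θ) (h2 : θ ≤ Real.pi / 2) :
    (twoArtanh (polar 1 θ)).re = logCot θ := by
  rw [twoArtanh_polar h0 h2, re_ofReal_add_ofReal_mul_I, logCot]

lemma integral_logCot :
    ∫ θ in (0 : ℝ)..Real.pi / 2, logCot θ = 2 * catalanG := by
  have h := (hasSum_quarter_integral_re (w := fun _ => 1) (fun z hz => hasSum_twoArtanh_real hz)
    quarterBound_twoArtanh continuous_const summable_twoArtanh_coeff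
    (fun n => norm_quarterMoment_one_le (by omega)) (fun θ => re_twoArtanh_polar)).1
  simp only [one_mul, quarterMoment_one_odd_re] at h
  refine h.unique ((hasSum_catalanG.mul_left 2).congr_fun fun n => ?_)
  field_simp

lemma intervalIntegrable_logCot :
    IntervalIntegrable logCot MeasureTheory.volume 0 (Real.pi / 2) := by
  simpa using (hasSum_quarter_integral_re (w := fun _ => 1)
    (fun z hz => hasSum_twoArtanh_real hz)
    quarterBound_twoArtanh continuous_const summable_twoArtanh_coeff
    (fun n => norm_quarterMoment_one_le (by omega)) (fun θ => re_twoArtanh_polar)).2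

lemma hasSum_integral_mul_logCot :
    HasSum (fun n : ℕ => Real.pi * ((-1) ^ n / (2 * (n : ℝ) + 1) ^ 2) - 2 / (2 * (n : ℝ) + 1) ^ 3)
      (∫ θ in (0 : ℝ)..Real.pi / 2, θ * logCot θ) := by
  have h := (hasSum_quarter_integral_re (w := fun θ => θ) (fun z hz => hasSum_twoArtanh_real hz)
    quarterBound_twoArtanh continuous_id summable_twoArtanh_coeff
    (fun n => norm_quarterMoment_id_le (by omega)) (fun θ => re_twoArtanh_polar)).1
  simp only [quarterMoment_id_odd_re] at h
  refine h.congr_fun fun n => ?_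
  field_simp

lemma summable_twoArtanh_sq_coeff :
    Summable fun n : ℕ =>
      |4 * (oddHarmonic (n + 1) / ((n : ℝ) + 1))| * (4 / ((2 * n + 2 : ℕ) : ℝ)) := by
  refine summable_of_le_harm_div_sq 8 fun n => ?_
  have h0 := oddHarmonic_nonneg (n + 1)
  rw [abs_of_nonneg (by positivity), abs_of_nonneg (by positivity)]
  have := oddHarmonic_le_harm (n + 1)
  calc _ = 8 * (oddHarmonic (n + 1) / ((n : ℝ) + 1) ^ 2) := by push_cast; field_simp; ring
    _ ≤ _ := by gcongr

lemma re_twoArtanh_sq_polar {θ : ℝ} (h0 : 0 < θ) (h2 : θ ≤ Real.pi / 2) :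
    (twoArtanh (polar 1 θ) ^ 2).re = logCot θ ^ 2 - (Real.pi / 2) ^ 2 := by
  rw [twoArtanh_polar h0 h2, re_add_mul_I_sq, logCot]

lemma intervalIntegrable_logCot_sq :
    IntervalIntegrable (fun θ => logCot θ ^ 2) MeasureTheory.volume 0 (Real.pi / 2) := by
  have h := (hasSum_quarter_integral_re (w := fun _ => 1) (fun z hz => hasSum_twoArtanh_sq hz)
    quarterBound_twoArtanh_sq continuous_const summable_twoArtanh_sq_coeff
    (fun n => norm_quarterMoment_one_le (by omega)) (fun θ => re_twoArtanh_sq_polar)).2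
  simp only [one_mul] at h
  refine (h.add (intervalIntegrable_const (c := (Real.pi / 2) ^ 2))).congr fun θ _ => ?_
  ring

/-- The squared series has only even frequencies, and their cosine integrals over (0, π/2) vanish.
Only the constant π²/4 contributes. -/
lemma integral_logCot_sq :
    ∫ θ in (0 : ℝ)..Real.pi / 2, logCot θ ^ 2 = Real.pi ^ 3 / 8 := by
  have h := (hasSum_quarter_integral_re (w := fun _ => 1) (fun z hz => hasSum_twoArtanh_sq hz)
    quarterBound_twoArtanh_sq continuous_const summable_twoArtanh_sq_coeff
    (fun n => norm_quarterMoment_one_le (by omega)) (fun θ => re_twoArtanh_sq_polar)).1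
  simp only [one_mul, show ∀ n : ℕ, 2 * n + 2 = 2 * (n + 1) from fun n => by ring,
    quarterMoment_one_even_re (Nat.succ_ne_zero _), mul_zero] at h
  rw [intervalIntegral.integral_sub intervalIntegrable_logCot_sq intervalIntegrable_const] at h
  have := h.unique hasSum_zero
  rw [intervalIntegral.integral_const] at this
  simp only [sub_zero, smul_eq_mul] at this
  linarith

lemma intervalIntegrable_mul_logCot_sq :
    IntervalIntegrable (fun θ => θ * logCot θ ^ 2) MeasureTheory.volume 0 (Real.pi / 2) :=
  intervalIntegrable_logCot_sq.continuousOn_mul continuous_id.continuousOn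

/-- The factor (-1)^(n+1) - 1 mixes the alternating and the positive sum of h_N / N^3. As the
integral itself equals the alternating sum (`hasSum_oddHarmonic_div_cube`), this is a linear
equation determining one from the other. -/
lemma hasSum_integral_mul_logCot_sq :
    HasSum (fun n : ℕ => ((-1) ^ (n + 1) - 1) * (oddHarmonic (n + 1) / ((n : ℝ) + 1) ^ 3))
      ((∫ θ in (0 : ℝ)..Real.pi / 2, θ * logCot θ ^ 2) - Real.pi ^ 4 / 32) := by
  have h := (hasSum_quarter_integral_re (w := fun θ => θ) (fun z hz => hasSum_twoArtanh_sq hz)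
    quarterBound_twoArtanh_sq continuous_id summable_twoArtanh_sq_coeff
    (fun n => norm_quarterMoment_id_le (by omega)) (fun θ => re_twoArtanh_sq_polar)).1
  simp only [show ∀ n : ℕ, 2 * n + 2 = 2 * (n + 1) from fun n => by ring,
    quarterMoment_id_even_re (Nat.succ_ne_zero _), mul_sub] at h
  rw [intervalIntegral.integral_sub intervalIntegrable_mul_logCot_sq
    (Continuous.intervalIntegrable (by fun_prop) _ _)] at h
  have e : ∫ θ in (0 : ℝ)..Real.pi / 2, θ * (Real.pi / 2) ^ 2 = Real.pi ^ 4 / 32 := by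
    rw [intervalIntegral.integral_mul_const, integral_id]; ring
  rw [e] at h
  refine h.congr_fun fun n => ?_
  push_cast
  field_simp
  norm_num

/-- `log² (1 + z) - log² (1 - z)`. -/
noncomputable def logSqDiff (z : ℂ) : ℂ := Complex.log (1 + z) ^ 2 - Complex.log (1 - z) ^ 2

lemma quarterBound_logSqDiff : QuarterBound logSqDiff where
  continuousAt z hz h h' := (quarterBound_log_one_add_sq.continuousAt z hz h h').sub
    (quarterBound_log_one_sub_sq.continuousAt z hz h h')
  bound := by
    obtain ⟨K, hK⟩ := quarterBound_log_one_add_sq.bound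
    obtain ⟨K', hK'⟩ := quarterBound_log_one_sub_sq.bound
    refine ⟨K + K', fun r θ hr hr1 h0 h2 => (norm_sub_le _ _).trans ?_⟩
    rw [add_mul]
    exact add_le_add (hK r θ hr hr1 h0 h2) (hK' r θ hr hr1 h0 h2)

lemma hasSum_logSqDiff {z : ℂ} (hz : ‖z‖ < 1) :
    HasSum (fun n : ℕ => ((-4 * (harm (2 * n + 2) / (2 * (n : ℝ) + 3)) : ℝ) : ℂ) * z ^ (2 * n + 3))
      (logSqDiff z) := by
  have h1 := hasSum_log_one_sub_sq (z := -z) (by simpa using hz)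
  rw [sub_neg_eq_add] at h1
  have h := h1.sub (hasSum_log_one_sub_sq hz)
  have hinj : Function.Injective fun n : ℕ => 2 * n + 1 := fun a b hab => by simpa using hab
  rw [← hinj.hasSum_iff] at h
  · refine h.congr_fun fun n => ?_
    simp only [Function.comp_apply]
    rw [neg_pow z, show 2 * n + 1 + 2 = 2 * (n + 1) + 1 by ring, pow_succ (-1 : ℂ), pow_mul (-1 : ℂ)]
    push_cast
    ring
  · intro m hm
    have : Even m := by
      by_contra hc
      obtain ⟨k, hk⟩ := Nat.not_even_iff_odd.1 hc
      exact hm ⟨k, hk.symm⟩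
    rw [neg_pow z, (this.add even_two).neg_one_pow]
    ring

/-- The Euler sum `∑ (-1)^m H_{2m} / (2m+1)^2`. -/
noncomputable def eulerSumEven : ℝ := ∑' m : ℕ, (-1 : ℝ) ^ m * harm (2 * m) / (2 * (m : ℝ) + 1) ^ 2

lemma harm_mono : Monotone harm := monotone_nat_of_le_succ fun n => by
  rw [harm_succ]; linarith [show 0 ≤ 1 / ((n : ℝ) + 1) by positivity]

lemma harm_two_mul_le (n : ℕ) : harm (2 * n) ≤ 2 * harm n := by
  rw [harm_two_mul]; linarith [oddHarmonic_le_harm n, harm_nonneg n]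

lemma summable_eulerSumEven :
    Summable fun m : ℕ => (-1 : ℝ) ^ m * harm (2 * m) / (2 * (m : ℝ) + 1) ^ 2 := by
  refine summable_of_le_harm_div_sq 2 fun n => ?_
  have h0 := harm_nonneg (2 * n)
  rw [abs_div, abs_mul, abs_pow, abs_neg, abs_one, one_pow, one_mul, abs_of_nonneg h0,
    abs_of_nonneg (by positivity)]
  calc harm (2 * n) / (2 * (n : ℝ) + 1) ^ 2 ≤ 2 * harm (n + 1) / ((n : ℝ) + 1) ^ 2 := by
        have h1 := harm_two_mul_le n
        have h2 := harm_mono n.le_succ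
        have h3 := harm_nonneg (n + 1)
        gcongr
        · linarith
        · linarith [n.cast_nonneg (α := ℝ)]
    _ = _ := by ring

lemma hasSum_eulerSumEven :
    HasSum (fun m : ℕ => (-1 : ℝ) ^ m * harm (2 * m) / (2 * (m : ℝ) + 1) ^ 2) eulerSumEven :=
  summable_eulerSumEven.hasSum

lemma summable_logSqDiff_coeff :
    Summable fun n : ℕ =>
      |-4 * (harm (2 * n + 2) / (2 * (n : ℝ) + 3))| * (4 / ((2 * n + 3 : ℕ) : ℝ)) := by
  refine summable_of_le_harm_div_sq 32 fun n => ?_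
  have h0 := harm_nonneg (2 * n + 2)
  rw [abs_of_nonneg (by positivity), neg_mul, abs_neg, abs_of_nonneg (by positivity)]
  have h1 := harm_two_mul_le (n + 1)
  rw [show 2 * (n + 1) = 2 * n + 2 by ring] at h1
  have h3 := harm_nonneg (n + 1)
  calc _ = 16 * (harm (2 * n + 2) / (2 * (n : ℝ) + 3) ^ 2) := by
        push_cast; field_simp; ring
    _ ≤ 16 * (2 * harm (n + 1) / ((n : ℝ) + 1) ^ 2) := by
        gcongr
        · linarith [n.cast_nonneg (α := ℝ)]
        · norm_num
    _ = _ := by ring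

lemma re_logSqDiff_polar {θ : ℝ} (h0 : 0 < θ) (h2 : θ ≤ Real.pi / 2) :
    (logSqDiff (polar 1 θ)).re =
      logCos θ ^ 2 - logSin θ ^ 2 + (Real.pi ^ 2 / 4 - Real.pi / 2 * θ) := by
  rw [logSqDiff, log_one_add_polar h0 h2, log_one_sub_polar h0 h2, Complex.sub_re,
    re_add_mul_I_sq, re_add_mul_I_sq, ← logCos, ← logSin]
  ring

/-- The difference of squares keeps only odd powers of z, and the weight 1 turns them into the Euler
sum. The imaginary parts θ/2 and (θ-π)/2 account for the polynomial π²/4 - πθ/2. -/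
lemma integral_logCos_sq_sub_logSin_sq :
    (∫ θ in (0 : ℝ)..Real.pi / 2, (logCos θ ^ 2 - logSin θ ^ 2)) =
        -4 * eulerSumEven - Real.pi ^ 3 / 16 ∧
      IntervalIntegrable (fun θ => logCos θ ^ 2 - logSin θ ^ 2) MeasureTheory.volume 0
        (Real.pi / 2) := by
  obtain ⟨h, hi⟩ := hasSum_quarter_integral_re (w := fun _ => 1) (fun z hz => hasSum_logSqDiff hz)
    quarterBound_logSqDiff continuous_const summable_logSqDiff_coeff
    (fun n => norm_quarterMoment_one_le (by omega)) (fun θ => re_logSqDiff_polar)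
  simp only [one_mul] at h hi
  have hc : IntervalIntegrable (fun θ : ℝ => Real.pi ^ 2 / 4 - Real.pi / 2 * θ)
      MeasureTheory.volume 0 (Real.pi / 2) := Continuous.intervalIntegrable (by fun_prop) _ _
  have hi' : IntervalIntegrable (fun θ => logCos θ ^ 2 - logSin θ ^ 2) MeasureTheory.volume 0
      (Real.pi / 2) := by simpa using hi.sub hc
  refine ⟨?_, hi'⟩
  rw [intervalIntegral.integral_add hi' hc] at h
  have e : ∫ θ in (0 : ℝ)..Real.pi / 2, (Real.pi ^ 2 / 4 - Real.pi / 2 * θ) = Real.pi ^ 3 / 16 := by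
    rw [intervalIntegral.integral_sub intervalIntegrable_const
      (Continuous.intervalIntegrable (by fun_prop) _ _), intervalIntegral.integral_const_mul,
      integral_id, intervalIntegral.integral_const, smul_eq_mul]
    ring
  rw [e] at h
  -- The term m = 0 is zero because `harm 0 = 0`, so dropping it costs nothing.
  have h2 := (hasSum_nat_add_iff' 1).2 hasSum_eulerSumEven
  simp only [range_one, sum_singleton, mul_zero, harm_zero, zero_div, sub_zero] at h2
  have h3 := h.unique ((h2.mul_left (-4)).congr_fun fun n => ?_)
  · linarith
  · rw [show 2 * n + 3 = 2 * (n + 1) + 1 by ring, quarterMoment_one_odd_re,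
      show 2 * (n + 1) = 2 * n + 2 by ring]
    push_cast
    field_simp
    ring

/-- With c = `logCos` and s = `logSin`, (c - s)c = ((c² - s²) + (c - s)²)/2, and both integrals on
the right are known. -/
lemma integral_logCot_mul_logCos :
    (∫ θ in (0 : ℝ)..Real.pi / 2, logCot θ * logCos θ) =
        Real.pi ^ 3 / 32 - 2 * eulerSumEven ∧
      IntervalIntegrable (fun θ => logCot θ * logCos θ) MeasureTheory.volume 0 (Real.pi / 2) := by
  obtain ⟨h, hi⟩ := integral_logCos_sq_sub_logSin_sq
  have e : (fun θ => logCot θ * logCos θ) = fun θ =>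
      (1 / 2) * ((logCos θ ^ 2 - logSin θ ^ 2) + logCot θ ^ 2) := by
    funext θ; rw [logCot]; ring
  rw [e]
  refine ⟨?_, (hi.add intervalIntegrable_logCot_sq).const_mul _⟩
  rw [intervalIntegral.integral_const_mul,
    intervalIntegral.integral_add hi intervalIntegrable_logCot_sq, h, integral_logCot_sq]
  ring

lemma integral_logCos :
    (∫ θ in (0 : ℝ)..Real.pi / 2, logCos θ) = catalanG ∧
      IntervalIntegrable logCos MeasureTheory.volume 0 (Real.pi / 2) := by
  have hF : ∀ z : ℂ, ‖z‖ < 1 → HasSum (fun n : ℕ => (((-1 : ℝ) ^ n / ((n : ℝ) + 1) : ℝ) : ℂ) *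
      z ^ (n + 1)) (Complex.log (1 + z)) := fun z hz => by
    have := (hasSum_neg_log_one_sub (z := -z) (by simpa using hz)).neg
    rw [neg_neg, sub_neg_eq_add] at this
    refine this.congr_fun fun n => ?_
    rw [neg_pow z, pow_succ (-1 : ℂ)]
    push_cast
    ring
  have hs : Summable fun n : ℕ => |(-1 : ℝ) ^ n / ((n : ℝ) + 1)| * (4 / ((n + 1 : ℕ) : ℝ)) := by
    refine (((summable_nat_add_iff 1).2 (Real.summable_one_div_nat_pow.2 one_lt_two)).mul_left
      4).congr fun n => ?_
    rw [abs_div, abs_pow, abs_neg, abs_one, one_pow, abs_of_nonneg (by positivity)]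
    push_cast
    field_simp
  obtain ⟨h, hi⟩ := hasSum_quarter_integral_re (w := fun _ => 1) (g := logCos) hF
    quarterBound_log_one_add continuous_const hs
    (fun n => norm_quarterMoment_one_le (by omega)) (fun θ h0 h2 => by
      rw [log_one_add_polar h0 h2, re_ofReal_add_ofReal_mul_I, logCos])
  simp only [one_mul] at h hi
  refine ⟨?_, hi⟩
  have hinj : Function.Injective fun n : ℕ => 2 * n := fun a b hab => by simpa using hab
  rw [← hinj.hasSum_iff] at h
  · refine h.unique (hasSum_catalanG.congr_fun fun n => ?_)
    simp only [Function.comp_apply]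
    rw [quarterMoment_one_odd_re, pow_mul]
    push_cast
    field_simp
    norm_num
  · intro m hm
    have : Odd m := by
      by_contra hc
      obtain ⟨k, hk⟩ := Nat.not_odd_iff_even.1 hc
      exact hm ⟨k, by simp [hk]; ring⟩
    obtain ⟨k, rfl⟩ := this
    rw [show 2 * k + 1 + 1 = 2 * (k + 1) by ring, quarterMoment_one_even_re (Nat.succ_ne_zero _),
      mul_zero]

lemma HasSum.congr_both {f g : ℕ → ℝ} {a b : ℝ} (h : HasSum f a) (hab : b = a)
    (hfg : ∀ n, g n = f n) : HasSum g b := by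
  rw [hab, funext hfg]; exact h

/-! ### Logarithmic moments on the unit interval -/

/-- Termwise integration of a power series against a nonnegative weight with known moments. -/
lemma hasSum_integral_mul_weight {c : ℕ → ℝ} {e : ℕ → ℕ} {f ω : ℝ → ℝ} {m : ℕ → ℝ}
    (hω : ∀ x ∈ Set.Ioo (0 : ℝ) 1, 0 ≤ ω x)
    (hi : ∀ k : ℕ, IntervalIntegrable (fun x => x ^ k * ω x) MeasureTheory.volume 0 1)
    (hm : ∀ k : ℕ, ∫ x in (0 : ℝ)..1, x ^ k * ω x = m k)
    (hf : ∀ x ∈ Set.Ioo (0 : ℝ) 1, HasSum (fun n => c n * x ^ e n) (f x))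
    (hs : Summable fun n => |c n| * m (e n)) :
    HasSum (fun n => c n * m (e n)) (∫ x in (0 : ℝ)..1, f x * ω x) := by
  simp only [intervalIntegral.integral_of_le zero_le_one,
    MeasureTheory.integral_Ioc_eq_integral_Ioo] at hm ⊢
  have hi : ∀ k : ℕ, MeasureTheory.IntegrableOn (fun x => x ^ k * ω x) (Set.Ioo 0 1) := fun k =>
    ((intervalIntegrable_iff_integrableOn_Ioc_of_le zero_le_one).1 (hi k)).mono_set
      Set.Ioo_subset_Ioc_self
  have key := MeasureTheory.hasSum_integral_of_summable_integral_norm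
    (μ := MeasureTheory.volume.restrict (Set.Ioo (0 : ℝ) 1))
    (F := fun n x => c n * (x ^ e n * ω x)) (fun n => (hi (e n)).const_mul (c n)) ?_
  · have h1 : ∀ n, ∫ x in Set.Ioo (0 : ℝ) 1, c n * (x ^ e n * ω x) = c n * m (e n) := fun n => by
      rw [MeasureTheory.integral_const_mul, hm]
    simp only [h1] at key
    refine key.congr_both ?_ fun _ => rfl
    refine MeasureTheory.setIntegral_congr_fun measurableSet_Ioo fun x hx => ?_
    simp only [← ((hf x hx).mul_right (ω x)).tsum_eq]
    exact tsum_congr fun n => by ring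
  · refine hs.congr fun n => ?_
    rw [← hm, ← MeasureTheory.integral_const_mul]
    refine MeasureTheory.setIntegral_congr_fun measurableSet_Ioo fun x hx => ?_
    simp only [norm_mul, Real.norm_eq_abs, abs_of_nonneg (hω x hx),
      abs_of_nonneg (pow_nonneg hx.1.le _)]

lemma continuous_pow_succ_mul_log (k : ℕ) : Continuous fun x : ℝ => x ^ (k + 1) * Real.log x := by
  have : (fun x : ℝ => x ^ (k + 1) * Real.log x) = fun x => x ^ k * (x * Real.log x) := by
    funext x; ring
  rw [this]
  exact (continuous_pow k).mul Real.continuous_mul_log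

/-- Writing x log² x = 4 (√x log √x)² inherits continuity at 0 from x log x. -/
lemma continuousOn_pow_succ_mul_log_sq (k : ℕ) :
    ContinuousOn (fun x : ℝ => x ^ (k + 1) * Real.log x ^ 2) (Set.Ici 0) := by
  have h : ContinuousOn (fun x : ℝ => x ^ k * (4 * (√x * Real.log (√x)) ^ 2)) (Set.Ici 0) :=
    ((continuous_pow k).mul (continuous_const.mul
      ((Real.continuous_mul_log.comp Real.continuous_sqrt).pow 2))).continuousOn
  refine h.congr fun x hx => ?_
  have h1 : √x ^ 2 = x := Real.sq_sqrt hx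
  simp only [Real.log_sqrt hx, mul_pow, h1]
  ring

/-- The integrand has constant sign, so its integrability comes for free from an antiderivative
continuous on [0, 1]. The same applies to `integral_pow_mul_log_sq`. -/
lemma integral_pow_mul_neg_log (k : ℕ) :
    IntervalIntegrable (fun x : ℝ => x ^ k * -Real.log x) MeasureTheory.volume 0 1 ∧
      ∫ x in (0 : ℝ)..1, x ^ k * -Real.log x = 1 / ((k : ℝ) + 1) ^ 2 := by
  have hc : Continuous fun x : ℝ =>
      x ^ (k + 1) / ((k : ℝ) + 1) ^ 2 - x ^ (k + 1) * Real.log x / ((k : ℝ) + 1) :=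
    ((continuous_pow _).div_const _).sub ((continuous_pow_succ_mul_log k).div_const _)
  have hd : ∀ x ∈ Set.Ioo (0 : ℝ) 1, HasDerivAt (fun x : ℝ =>
      x ^ (k + 1) / ((k : ℝ) + 1) ^ 2 - x ^ (k + 1) * Real.log x / ((k : ℝ) + 1))
      (x ^ k * -Real.log x) x := fun x hx => by
    have hx0 : x ≠ 0 := hx.1.ne'
    refine (((hasDerivAt_pow (k + 1) x).div_const _).sub
      (((hasDerivAt_pow (k + 1) x).mul (Real.hasDerivAt_log hx0)).div_const _)).congr_deriv ?_
    have : (k : ℝ) + 1 ≠ 0 := by positivity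
    simp only [Nat.add_sub_cancel]
    push_cast
    field_simp
    ring
  have hi : IntervalIntegrable (fun x : ℝ => x ^ k * -Real.log x) MeasureTheory.volume 0 1 := by
    refine intervalIntegral.intervalIntegrable_deriv_of_nonneg hc.continuousOn
      (by simpa using hd) fun x hx => ?_
    rw [min_eq_left zero_le_one, max_eq_right zero_le_one] at hx
    exact mul_nonneg (pow_nonneg hx.1.le _) (by linarith [Real.log_nonpos hx.1.le hx.2.le])
  refine ⟨hi, ?_⟩
  rw [intervalIntegral.integral_eq_sub_of_hasDerivAt_of_le zero_le_one hc.continuousOn hd hi]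
  simp

lemma integral_pow_mul_log_sq (k : ℕ) :
    IntervalIntegrable (fun x : ℝ => x ^ k * Real.log x ^ 2) MeasureTheory.volume 0 1 ∧
      ∫ x in (0 : ℝ)..1, x ^ k * Real.log x ^ 2 = 2 / ((k : ℝ) + 1) ^ 3 := by
  have hc : ContinuousOn (fun x : ℝ =>
      x ^ (k + 1) * Real.log x ^ 2 / ((k : ℝ) + 1) - 2 * (x ^ (k + 1) * Real.log x) /
        ((k : ℝ) + 1) ^ 2 + 2 * x ^ (k + 1) / ((k : ℝ) + 1) ^ 3) (Set.Icc 0 1) :=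
    ((((continuousOn_pow_succ_mul_log_sq k).mono Set.Icc_subset_Ici_self).div_const _).sub
      ((continuous_const.mul (continuous_pow_succ_mul_log k)).div_const _).continuousOn).add
      ((continuous_const.mul (continuous_pow _)).div_const _).continuousOn
  have hd : ∀ x ∈ Set.Ioo (0 : ℝ) 1, HasDerivAt (fun x : ℝ =>
      x ^ (k + 1) * Real.log x ^ 2 / ((k : ℝ) + 1) - 2 * (x ^ (k + 1) * Real.log x) /
        ((k : ℝ) + 1) ^ 2 + 2 * x ^ (k + 1) / ((k : ℝ) + 1) ^ 3)
      (x ^ k * Real.log x ^ 2) x := fun x hx => by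
    have hx0 : x ≠ 0 := hx.1.ne'
    have hp := hasDerivAt_pow (k + 1) x
    have hl := Real.hasDerivAt_log hx0
    refine ((((hp.mul (hl.pow 2)).div_const _).sub (((hp.mul hl).const_mul 2).div_const _)).add
      ((hp.const_mul 2).div_const _)).congr_deriv ?_
    have : (k : ℝ) + 1 ≠ 0 := by positivity
    simp only [Nat.add_sub_cancel, Pi.pow_apply]
    push_cast
    field_simp
    ring
  have hi : IntervalIntegrable (fun x : ℝ => x ^ k * Real.log x ^ 2) MeasureTheory.volume 0 1 := by
    refine intervalIntegral.intervalIntegrable_deriv_of_nonneg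
      (by rwa [Set.uIcc_of_le zero_le_one]) (by simpa using hd) fun x hx => ?_
    rw [min_eq_left zero_le_one, max_eq_right zero_le_one] at hx
    exact mul_nonneg (pow_nonneg hx.1.le _) (sq_nonneg _)
  refine ⟨hi, ?_⟩
  rw [intervalIntegral.integral_eq_sub_of_hasDerivAt_of_le zero_le_one hc hd hi]
  simp

/-! ### Power series of arctangent type -/

lemma hasSum_arctan_mul_geometric {x : ℝ} (hx : x ∈ Set.Ioo (0 : ℝ) 1) :
    HasSum (fun n : ℕ => (-1) ^ n * oddHarmonic (n + 1) * x ^ (2 * n + 1))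
      (Real.arctan x / (1 + x ^ 2)) := by
  have hx1 : ‖x‖ < 1 := by rw [Real.norm_of_nonneg hx.1.le]; exact hx.2
  have h1 : HasSum (fun n : ℕ => (-1) ^ n / (2 * (n : ℝ) + 1) * x ^ (2 * n + 1))
      (Real.arctan x) := by
    refine (Real.hasSum_arctan hx1).congr_fun fun n => ?_
    push_cast; ring
  have h2 : HasSum (fun n : ℕ => (-1) ^ n * x ^ (2 * n)) (1 / (1 + x ^ 2)) := by
    have : ‖-x ^ 2‖ < 1 := by
      rw [norm_neg, norm_pow]; exact pow_lt_one₀ (norm_nonneg _) hx1 two_ne_zero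
    have h := hasSum_geometric_of_norm_lt_one this
    rw [sub_neg_eq_add, ← one_div] at h
    refine h.congr_fun fun n => ?_
    rw [neg_pow (x ^ 2), ← pow_mul]
  have n1 : ∀ n : ℕ, ‖(-1 : ℝ) ^ n / (2 * (n : ℝ) + 1)‖ ≤ 1 := fun n => by
    rw [norm_div, norm_pow, norm_neg, norm_one, one_pow, Real.norm_of_nonneg (by positivity)]
    exact div_le_one_of_le₀ (by linarith [n.cast_nonneg (α := ℝ)]) (by positivity)
  have h := hasSum_cauchyProduct h1 h2
    (summable_norm_mul_pow (e := fun n => 2 * n + 1) hx1 n1 (fun n => by omega))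
    (summable_norm_mul_pow (c := fun n => (-1) ^ n) (e := fun n => 2 * n) hx1
      (fun n => by simp) (fun n => by omega))
  rw [mul_one_div] at h
  refine h.congr_fun fun n => ?_
  rw [oddHarmonic_eq_sum, ← Nat.sum_antidiagonal_eq_sum_range_succ
    (fun i _ => 1 / (2 * (i : ℝ) + 1)) n, mul_sum, sum_mul]
  refine sum_congr rfl fun p hp => ?_
  rw [← mem_antidiagonal.1 hp]
  ring

lemma hasSum_log_mul_geometric {x : ℝ} (hx : x ∈ Set.Ioo (0 : ℝ) 1) :
    HasSum (fun n : ℕ => (-1) ^ n * harm (n + 1) * x ^ (2 * n + 2))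
      (Real.log (1 + x ^ 2) / (1 + x ^ 2)) := by
  have hx1 : ‖x‖ < 1 := by rw [Real.norm_of_nonneg hx.1.le]; exact hx.2
  have hx2 : ‖-x ^ 2‖ < 1 := by
    rw [norm_neg, norm_pow]; exact pow_lt_one₀ (norm_nonneg _) hx1 two_ne_zero
  have h1 : HasSum (fun n : ℕ => (-1) ^ n / ((n : ℝ) + 1) * x ^ (2 * n + 2))
      (Real.log (1 + x ^ 2)) := by
    have h := (Real.hasSum_pow_div_log_of_abs_lt_one hx2).neg
    rw [neg_neg, sub_neg_eq_add] at h
    refine h.congr_fun fun n => ?_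
    rw [neg_pow (x ^ 2), ← pow_mul]; ring
  have h2 : HasSum (fun n : ℕ => (-1) ^ n * x ^ (2 * n)) (1 / (1 + x ^ 2)) := by
    have h := hasSum_geometric_of_norm_lt_one hx2
    rw [sub_neg_eq_add, ← one_div] at h
    refine h.congr_fun fun n => ?_
    rw [neg_pow (x ^ 2), ← pow_mul]
  have n1 : ∀ n : ℕ, ‖(-1 : ℝ) ^ n / ((n : ℝ) + 1)‖ ≤ 1 := fun n => by
    rw [norm_div, norm_pow, norm_neg, norm_one, one_pow, Real.norm_of_nonneg (by positivity)]
    exact div_le_one_of_le₀ (by linarith [n.cast_nonneg (α := ℝ)]) (by positivity)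
  have h := hasSum_cauchyProduct h1 h2
    (summable_norm_mul_pow (e := fun n => 2 * n + 2) hx1 n1 (fun n => by omega))
    (summable_norm_mul_pow (c := fun n => (-1) ^ n) (e := fun n => 2 * n) hx1
      (fun n => by simp) (fun n => by omega))
  rw [mul_one_div] at h
  refine h.congr_fun fun n => ?_
  rw [harm, ← Nat.sum_antidiagonal_eq_sum_range_succ
    (fun i _ => 1 / ((i : ℝ) + 1)) n, mul_sum, sum_mul]
  refine sum_congr rfl fun p hp => ?_
  rw [← mem_antidiagonal.1 hp]
  ring

/-! ### The half-angle substitution -/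

/-- The substitution t = tan(θ/2). It turns `logCot` into -log t and the weight θ into 2 arctan t.
-/
lemma integral_half_angle (g : ℝ → ℝ) :
    ∫ θ in (0 : ℝ)..Real.pi / 2, g θ =
      ∫ t in (0 : ℝ)..1, 2 / (1 + t ^ 2) * g (2 * Real.arctan t) := by
  have himg : (fun t => 2 * Real.arctan t) '' Set.Ioo (0 : ℝ) 1 = Set.Ioo 0 (Real.pi / 2) := by
    ext θ
    constructor
    · rintro ⟨t, ht, rfl⟩
      have h1 := Real.arctan_strictMono ht.1
      have h2 := Real.arctan_strictMono ht.2
      rw [Real.arctan_zero] at h1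
      rw [Real.arctan_one] at h2
      constructor <;> simp only <;> linarith
    · intro hθ
      refine ⟨Real.tan (θ / 2), ⟨?_, ?_⟩, ?_⟩
      · exact Real.tan_pos_of_pos_of_lt_pi_div_two (by linarith [hθ.1])
          (by linarith [hθ.2, Real.pi_pos])
      · rw [← Real.tan_pi_div_four]
        exact Real.tan_lt_tan_of_nonneg_of_lt_pi_div_two (by linarith [hθ.1])
          (by linarith [Real.pi_pos]) (by linarith [hθ.2])
      · simp only
        rw [Real.arctan_tan (by linarith [hθ.1, Real.pi_pos]) (by linarith [hθ.2, Real.pi_pos])]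
        ring
  rw [intervalIntegral.integral_of_le (by positivity), intervalIntegral.integral_of_le zero_le_one,
    MeasureTheory.integral_Ioc_eq_integral_Ioo, MeasureTheory.integral_Ioc_eq_integral_Ioo, ← himg,
    MeasureTheory.integral_image_eq_integral_abs_deriv_smul measurableSet_Ioo
      (f' := fun t => 2 * (1 / (1 + t ^ 2)))
      (fun t _ => ((Real.hasDerivAt_arctan t).const_mul 2).hasDerivWithinAt)
      (fun a _ b _ h => Real.arctan_injective (by simpa using h))]
  refine MeasureTheory.setIntegral_congr_fun measurableSet_Ioo fun t _ => ?_
  simp only [smul_eq_mul]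
  rw [abs_of_nonneg (by positivity)]
  ring

lemma logCos_two_mul_arctan (t : ℝ) :
    logCos (2 * Real.arctan t) = Real.log 2 - Real.log (1 + t ^ 2) / 2 := by
  have h : 0 < 1 + t ^ 2 := by positivity
  rw [logCos, show 2 * Real.arctan t / 2 = Real.arctan t by ring, Real.cos_arctan,
    Real.log_mul two_ne_zero (by positivity), one_div, Real.log_inv, Real.log_sqrt h.le]
  ring

lemma logCot_two_mul_arctan {t : ℝ} (ht : 0 < t) : logCot (2 * Real.arctan t) = -Real.log t := by
  have h : 0 < 1 + t ^ 2 := by positivity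
  rw [logCot, logCos_two_mul_arctan, logSin, show 2 * Real.arctan t / 2 = Real.arctan t by ring,
    Real.sin_arctan, Real.log_mul two_ne_zero (by positivity), Real.log_div ht.ne' (by positivity),
    Real.log_sqrt h.le]
  ring

lemma neg_log_nonneg_of_mem {x : ℝ} (hx : x ∈ Set.Ioo (0 : ℝ) 1) : 0 ≤ -Real.log x := by
  linarith [Real.log_nonpos hx.1.le hx.2.le]

/-- After the half-angle substitution the integrand is 4 · arctan t / (1+t²) · (-log t), one factor
2 coming from dθ and one from θ = 2 arctan t. The expansion of arctan t / (1+t²) has coefficients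
(-1)^n h_{n+1}, and the moment of t^(2n+1) is 1/(2n+2)². -/
lemma hasSum_oddHarmonic_div_sq :
    HasSum (fun n : ℕ => (-1) ^ n * oddHarmonic (n + 1) / ((n : ℝ) + 1) ^ 2)
      (∫ θ in (0 : ℝ)..Real.pi / 2, θ * logCot θ) := by
  have h := (hasSum_integral_mul_weight (ω := fun x => -Real.log x) (e := fun n => 2 * n + 1)
    (fun x hx => neg_log_nonneg_of_mem hx)
    (fun k => (integral_pow_mul_neg_log k).1) (fun k => (integral_pow_mul_neg_log k).2)
    (fun x hx => hasSum_arctan_mul_geometric hx) ?_).mul_left 4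
  · rw [integral_half_angle]
    refine h.congr_both ?_ fun n => ?_
    · rw [← intervalIntegral.integral_const_mul]
      refine intervalIntegral.integral_congr_Ioo_of_le zero_le_one fun t ht => ?_
      simp only [logCot_two_mul_arctan ht.1]
      ring
    · push_cast
      field_simp
      ring
  · refine summable_of_le_harm_div_sq 1 fun n => ?_
    have h0 := oddHarmonic_nonneg (n + 1)
    rw [abs_of_nonneg (by positivity), abs_mul, abs_pow, abs_neg, abs_one, one_pow, one_mul, one_mul,
      abs_of_nonneg h0, mul_one_div]
    have := oddHarmonic_le_harm (n + 1)
    push_cast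
    have hn : (0 : ℝ) ≤ n := n.cast_nonneg
    gcongr <;> linarith

lemma hasSum_oddHarmonic_div_cube :
    HasSum (fun n : ℕ => (-1) ^ n * oddHarmonic (n + 1) / ((n : ℝ) + 1) ^ 3)
      (∫ θ in (0 : ℝ)..Real.pi / 2, θ * logCot θ ^ 2) := by
  have h := (hasSum_integral_mul_weight (ω := fun x => Real.log x ^ 2) (e := fun n => 2 * n + 1)
    (fun x _ => sq_nonneg _)
    (fun k => (integral_pow_mul_log_sq k).1) (fun k => (integral_pow_mul_log_sq k).2)
    (fun x hx => hasSum_arctan_mul_geometric hx) ?_).mul_left 4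
  · rw [integral_half_angle]
    refine h.congr_both ?_ fun n => ?_
    · rw [← intervalIntegral.integral_const_mul]
      refine intervalIntegral.integral_congr_Ioo_of_le zero_le_one fun t ht => ?_
      simp only [logCot_two_mul_arctan ht.1]
      ring
    · push_cast
      field_simp
      ring
  · refine summable_of_le_harm_div_sq 2 fun n => ?_
    have h0 := oddHarmonic_nonneg (n + 1)
    rw [abs_of_nonneg (by positivity), abs_mul, abs_pow, abs_neg, abs_one, one_pow, one_mul,
      abs_of_nonneg h0]
    have := oddHarmonic_le_harm (n + 1)
    have h3 := harm_nonneg (n + 1)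
    have hn : (0 : ℝ) ≤ n := n.cast_nonneg
    calc oddHarmonic (n + 1) * (2 / (((2 * n + 1 : ℕ) : ℝ) + 1) ^ 3)
        ≤ harm (n + 1) * (2 / ((n : ℝ) + 1) ^ 2) := by
          have : ((n : ℝ) + 1) ^ 2 ≤ (((2 * n + 1 : ℕ) : ℝ) + 1) ^ 3 := by
            push_cast
            nlinarith [pow_nonneg hn 3, pow_nonneg hn 2]
          gcongr
      _ = _ := by ring

lemma summable_log_mul_geometric_moment :
    Summable fun n : ℕ =>
      |(-1 : ℝ) ^ n * harm (n + 1)| * (1 / (((2 * n + 2 : ℕ) : ℝ) + 1) ^ 2) := by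
  refine summable_of_le_harm_div_sq 1 fun n => ?_
  have h0 := harm_nonneg (n + 1)
  rw [abs_of_nonneg (by positivity), abs_mul, abs_pow, abs_neg, abs_one, one_pow, one_mul, one_mul,
    abs_of_nonneg h0, mul_one_div]
  push_cast
  gcongr
  linarith [n.cast_nonneg (α := ℝ)]

/-- `∑ (-1)^m H_m / (2m+1)^2` in terms of `∑ (-1)^m H_{2m} / (2m+1)^2`. -/
lemma hasSum_harm_div_odd_sq :
    HasSum (fun m : ℕ => (-1) ^ m * harm m / (2 * (m : ℝ) + 1) ^ 2)
      (Real.pi ^ 3 / 32 - 2 * eulerSumEven - 2 * Real.log 2 * catalanG) := by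
  have h := (hasSum_integral_mul_weight (ω := fun x => -Real.log x) (e := fun n => 2 * n + 2)
    (fun x hx => neg_log_nonneg_of_mem hx)
    (fun k => (integral_pow_mul_neg_log k).1) (fun k => (integral_pow_mul_neg_log k).2)
    (fun x hx => hasSum_log_mul_geometric hx) summable_log_mul_geometric_moment).neg
  rw [← hasSum_nat_add_iff' 1]
  refine h.congr_both ?_ fun n => ?_
  · obtain ⟨h1, h2⟩ := integral_logCot_mul_logCos
    -- In the variable t, the product `logCot` · (`logCos` - log 2) is log t · log(1+t²) / 2;
    -- subtracting log 2 removes the constant in `logCos_two_mul_arctan`.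
    have e : ∫ θ in (0 : ℝ)..Real.pi / 2, (logCot θ * logCos θ - logCot θ * Real.log 2) =
        Real.pi ^ 3 / 32 - 2 * eulerSumEven - 2 * Real.log 2 * catalanG := by
      rw [intervalIntegral.integral_sub h2 (intervalIntegrable_logCot.mul_const _), h1,
        intervalIntegral.integral_mul_const, integral_logCot]
      ring
    rw [← e, integral_half_angle, ← intervalIntegral.integral_neg]
    simp only [range_one, sum_singleton, harm_zero, mul_zero, zero_div, sub_zero]
    refine intervalIntegral.integral_congr_Ioo_of_le zero_le_one fun t ht => ?_
    simp only [logCot_two_mul_arctan ht.1, logCos_two_mul_arctan]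
    ring
  · push_cast
    field_simp
    ring

lemma integral_log_one_add_sq_div :
    ∫ t in (0 : ℝ)..1, Real.log (1 + t ^ 2) / (1 + t ^ 2) =
      Real.pi / 2 * Real.log 2 - catalanG := by
  obtain ⟨h1, h2⟩ := integral_logCos
  have e : ∫ θ in (0 : ℝ)..Real.pi / 2, (Real.log 2 - logCos θ) =
      Real.pi / 2 * Real.log 2 - catalanG := by
    rw [intervalIntegral.integral_sub intervalIntegrable_const h2, h1,
      intervalIntegral.integral_const]
    simp
  rw [← e, integral_half_angle]
  refine intervalIntegral.integral_congr fun t _ => ?_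
  simp only [logCos_two_mul_arctan]
  ring

/-! ### Polylogarithms and harmonic power series in the closed unit disc -/

section PowerSeries

variable {𝕜 : Type*} [RCLike 𝕜]

lemma hasDerivAt_tsum_mul_pow {c : ℕ → 𝕜} (hc : ∀ n, ‖c n‖ ≤ 1) {z : 𝕜} (hz : ‖z‖ < 1) :
    HasDerivAt (fun z => ∑' n, c n * z ^ (n + 1)) (∑' n, c n * ((n + 1 : ℕ) * z ^ n)) z := by
  obtain ⟨r, hzr, hr1⟩ := exists_between hz
  have hr0 : 0 ≤ r := (norm_nonneg z).trans hzr.le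
  have hu : Summable fun n : ℕ => ((n : ℝ) + 1) * r ^ n := by
    have h1 := summable_pow_mul_geometric_of_norm_lt_one 1
      (show ‖r‖ < 1 by rwa [Real.norm_of_nonneg hr0])
    have h2 := summable_geometric_of_lt_one hr0 hr1
    refine (h1.add h2).congr fun n => ?_
    rw [pow_one]; ring
  refine hasDerivAt_tsum_of_isPreconnected (g := fun n y => c n * y ^ (n + 1))
    (g' := fun n y => c n * ((n + 1 : ℕ) * y ^ n)) (t := Metric.ball (0 : 𝕜) r) (y₀ := 0) hu
    Metric.isOpen_ball (convex_ball (0 : 𝕜) r).isPreconnected (fun n y _ => ?_) (fun n y hy => ?_)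
    (Metric.mem_ball_self ((norm_nonneg z).trans_lt hzr)) ?_ (by simpa using hzr)
  · exact (hasDerivAt_pow (n + 1) y).const_mul (c n)
  · rw [mem_ball_zero_iff] at hy
    rw [norm_mul, norm_mul, norm_pow, RCLike.norm_natCast]
    push_cast
    calc ‖c n‖ * (((n : ℝ) + 1) * ‖y‖ ^ n) ≤ 1 * (((n : ℝ) + 1) * r ^ n) := by
          gcongr
          exact hc n
      _ = _ := one_mul _
  · simp

/-- The polylogarithm as a power series over `ℝ` or `ℂ`. -/
noncomputable def pl (s : ℕ) (z : 𝕜) : 𝕜 := ∑' k : ℕ, z ^ (k + 1) / ((k : 𝕜) + 1) ^ s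

/-- The Nielsen-type series `∑ H_{k-1} z^k / k^s`. -/
noncomputable def nielsen (s : ℕ) (z : 𝕜) : 𝕜 :=
  ∑' k : ℕ, (harm k : 𝕜) / ((k : 𝕜) + 1) ^ s * z ^ (k + 1)

lemma norm_natCast_add_one (n : ℕ) : ‖(n : 𝕜) + 1‖ = (n : ℝ) + 1 := by
  rw [← Nat.cast_add_one, RCLike.norm_natCast, Nat.cast_add_one]

lemma harm_le (n : ℕ) : harm n ≤ n := by
  induction n with
  | zero => simp
  | succ n ih =>
    rw [harm_succ]
    push_cast
    have : 1 / ((n : ℝ) + 1) ≤ 1 := div_le_one_of_le₀ (by linarith [n.cast_nonneg (α := ℝ)])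
      (by positivity)
    linarith

lemma norm_pl_coeff_le (s n : ℕ) : ‖1 / ((n : 𝕜) + 1) ^ s‖ ≤ 1 := by
  rw [norm_div, norm_one, norm_pow, norm_natCast_add_one]
  exact div_le_one_of_le₀ (one_le_pow₀ (by linarith [n.cast_nonneg (α := ℝ)])) (by positivity)

lemma norm_nielsen_coeff (s n : ℕ) :
    ‖(harm n : 𝕜) / ((n : 𝕜) + 1) ^ s‖ = harm n / ((n : ℝ) + 1) ^ s := by
  rw [norm_div, norm_pow, norm_natCast_add_one, RCLike.norm_ofReal, abs_of_nonneg (harm_nonneg n)]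

lemma norm_nielsen_coeff_le {s : ℕ} (hs : 1 ≤ s) (n : ℕ) :
    ‖(harm n : 𝕜) / ((n : 𝕜) + 1) ^ s‖ ≤ 1 := by
  rw [norm_nielsen_coeff]
  refine div_le_one_of_le₀ ?_ (by positivity)
  have h1 : (1 : ℝ) ≤ (n : ℝ) + 1 := by linarith [n.cast_nonneg (α := ℝ)]
  calc harm n ≤ (n : ℝ) + 1 := (harm_le n).trans (by linarith)
    _ = ((n : ℝ) + 1) ^ 1 := (pow_one _).symm
    _ ≤ _ := pow_le_pow_right₀ h1 hs

lemma hasDerivAt_pl (s : ℕ) {z : 𝕜} (hz : ‖z‖ < 1) (h0 : z ≠ 0) :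
    HasDerivAt (pl (s + 1)) (pl s z / z) z := by
  have h := hasDerivAt_tsum_mul_pow (fun n => norm_pl_coeff_le (𝕜 := 𝕜) (s + 1) n) hz
  have e1 : pl (s + 1) = fun z : 𝕜 => ∑' n : ℕ, 1 / ((n : 𝕜) + 1) ^ (s + 1) * z ^ (n + 1) := by
    funext z; unfold pl; exact tsum_congr fun n => by ring
  rw [e1]
  convert h using 1
  rw [pl, ← tsum_div_const]
  refine tsum_congr fun n => ?_
  have : (n : 𝕜) + 1 ≠ 0 := Nat.cast_add_one_ne_zero n
  push_cast
  field_simp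
  ring

lemma hasDerivAt_nielsen {s : ℕ} {z : 𝕜} (hz : ‖z‖ < 1) (h0 : z ≠ 0) :
    HasDerivAt (nielsen (s + 1)) (nielsen s z / z) z := by
  have h := hasDerivAt_tsum_mul_pow
    (fun n => norm_nielsen_coeff_le (𝕜 := 𝕜) (show 1 ≤ s + 1 by omega) n) hz
  unfold nielsen
  convert h using 1
  rw [← tsum_div_const]
  refine tsum_congr fun n => ?_
  have : (n : 𝕜) + 1 ≠ 0 := Nat.cast_add_one_ne_zero n
  push_cast
  field_simp
  ring

lemma summable_pl_coeff {s : ℕ} (hs : 2 ≤ s) : Summable fun n : ℕ => 1 / ((n : ℝ) + 1) ^ s := by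
  have := (summable_nat_add_iff 1).2 (Real.summable_one_div_nat_pow.2 hs)
  simpa using this

lemma summable_nielsen_coeff {s : ℕ} (hs : 2 ≤ s) :
    Summable fun n : ℕ => harm n / ((n : ℝ) + 1) ^ s := by
  refine summable_of_le_harm_div_sq 1 fun n => ?_
  have h0 := harm_nonneg n
  rw [abs_of_nonneg (by positivity), one_mul]
  have h1 : (1 : ℝ) ≤ (n : ℝ) + 1 := by linarith [n.cast_nonneg (α := ℝ)]
  have h2 := harm_mono n.le_succ
  exact div_le_div₀ (harm_nonneg _) h2 (by positivity) (pow_le_pow_right₀ h1 hs)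

lemma continuousOn_tsum_mul_pow {c : ℕ → 𝕜} (hc : Summable fun n => ‖c n‖) :
    ContinuousOn (fun z => ∑' n, c n * z ^ (n + 1)) (Metric.closedBall 0 1) := by
  refine continuousOn_tsum (u := fun n => ‖c n‖) (fun n => by fun_prop) hc fun n z hz => ?_
  rw [mem_closedBall_zero_iff] at hz
  rw [norm_mul, norm_pow]
  exact mul_le_of_le_one_right (norm_nonneg _) (pow_le_one₀ (norm_nonneg _) hz)

lemma continuousOn_pl {s : ℕ} (hs : 2 ≤ s) :
    ContinuousOn (pl s : 𝕜 → 𝕜) (Metric.closedBall 0 1) := by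
  have h := continuousOn_tsum_mul_pow (𝕜 := 𝕜) (c := fun n => 1 / ((n : 𝕜) + 1) ^ s)
    ((summable_pl_coeff hs).congr fun n => by
      rw [norm_div, norm_one, norm_pow, norm_natCast_add_one])
  refine h.congr fun z _ => ?_
  exact tsum_congr fun n => by ring

lemma continuousOn_nielsen {s : ℕ} (hs : 2 ≤ s) :
    ContinuousOn (nielsen s : 𝕜 → 𝕜) (Metric.closedBall 0 1) :=
  continuousOn_tsum_mul_pow (𝕜 := 𝕜) (c := fun n => (harm n : 𝕜) / ((n : 𝕜) + 1) ^ s)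
    ((summable_nielsen_coeff hs).congr fun n => (norm_nielsen_coeff s n).symm)

lemma hasSum_pl {s : ℕ} (hs : 2 ≤ s) {z : 𝕜} (hz : ‖z‖ ≤ 1) :
    HasSum (fun k : ℕ => z ^ (k + 1) / ((k : 𝕜) + 1) ^ s) (pl s z) := by
  refine (Summable.of_norm (Summable.of_nonneg_of_le (fun _ => norm_nonneg _) (fun n => ?_)
    (summable_pl_coeff hs))).hasSum
  rw [norm_div, norm_pow, norm_pow, norm_natCast_add_one]
  gcongr
  exact pow_le_one₀ (norm_nonneg _) hz

lemma hasSum_nielsen {s : ℕ} (hs : 2 ≤ s) {z : 𝕜} (hz : ‖z‖ ≤ 1) :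
    HasSum (fun k : ℕ => (harm k : 𝕜) / ((k : 𝕜) + 1) ^ s * z ^ (k + 1)) (nielsen s z) := by
  refine (Summable.of_norm (Summable.of_nonneg_of_le (fun _ => norm_nonneg _) (fun n => ?_)
    (summable_nielsen_coeff hs))).hasSum
  rw [norm_mul, norm_nielsen_coeff, norm_pow]
  exact mul_le_of_le_one_right (div_nonneg (harm_nonneg _) (by positivity))
    (pow_le_one₀ (norm_nonneg _) hz)

@[simp] lemma pl_zero (s : ℕ) : pl s (0 : 𝕜) = 0 := by simp [pl]

@[simp] lemma nielsen_zero (s : ℕ) : nielsen s (0 : 𝕜) = 0 := by simp [nielsen]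

end PowerSeries

lemma pl_one_complex {z : ℂ} (hz : ‖z‖ < 1) : pl 1 z = -Complex.log (1 - z) := by
  rw [← (hasSum_neg_log_one_sub hz).tsum_eq, pl]
  exact tsum_congr fun n => by ring

lemma pl_one_real {x : ℝ} (hx : |x| < 1) : pl 1 x = -Real.log (1 - x) := by
  rw [← (Real.hasSum_pow_div_log_of_abs_lt_one hx).tsum_eq, pl]
  exact tsum_congr fun n => by ring

lemma nielsen_one_complex {z : ℂ} (hz : ‖z‖ < 1) : nielsen 1 z = Complex.log (1 - z) ^ 2 / 2 := by
  rw [← (hasSum_log_one_sub_sq hz).tsum_eq, nielsen, Summable.tsum_eq_zero_add, ← tsum_div_const]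
  · rw [harm_zero]
    simp only [RCLike.ofReal_zero, zero_div, zero_mul, zero_add]
    refine tsum_congr fun n => ?_
    rw [show ((RCLike.ofReal (harm (n + 1)) : ℂ)) = ((harm (n + 1) : ℝ) : ℂ) from rfl]
    push_cast
    have : (n : ℂ) + 2 ≠ 0 := by exact_mod_cast (n + 1).succ_ne_zero
    have : (n : ℂ) + 1 + 1 ≠ 0 := by exact_mod_cast (n + 1).succ_ne_zero
    field_simp
    ring
  · exact (summable_norm_mul_pow (e := fun n => n + 1) hz (fun n => norm_nielsen_coeff_le le_rfl n)
      (fun n => n.le_succ)).of_norm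

lemma ofReal_pl (s : ℕ) (x : ℝ) : ((pl s x : ℝ) : ℂ) = pl s (x : ℂ) := by
  rw [pl, pl, Complex.ofReal_tsum]
  exact tsum_congr fun n => by push_cast; rfl

lemma ofReal_nielsen (s : ℕ) (x : ℝ) : ((nielsen s x : ℝ) : ℂ) = nielsen s (x : ℂ) := by
  rw [nielsen, nielsen, Complex.ofReal_tsum]
  exact tsum_congr fun n => by push_cast; rfl

lemma nielsen_one_real {x : ℝ} (hx : |x| < 1) : nielsen 1 x = Real.log (1 - x) ^ 2 / 2 := by
  have h := nielsen_one_complex (z := (x : ℂ)) (by simpa using hx)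
  have h1 : (0 : ℝ) ≤ 1 - x := by linarith [(abs_lt.1 hx).2]
  rw [← ofReal_nielsen, ← Complex.ofReal_one, ← Complex.ofReal_sub, ← Complex.ofReal_log h1] at h
  exact_mod_cast h

/-! ### Landen's transformation along a ray in the left half plane -/

/-- A continuous function on `[0, 1]` with vanishing derivative inside is constant. -/
lemma eq_of_hasDerivAt_zero {E : Type*} [NormedAddCommGroup E] [NormedSpace ℝ E] [CompleteSpace E]
    {f : ℝ → E} {a b : ℝ} (hab : a ≤ b) (hc : ContinuousOn f (Set.Icc a b))
    (hd : ∀ x ∈ Set.Ioo a b, HasDerivAt f 0 x) : f b = f a := by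
  have := intervalIntegral.integral_eq_sub_of_hasDerivAt_of_le hab hc hd intervalIntegrable_const
  rw [intervalIntegral.integral_zero] at this
  exact (sub_eq_zero.1 this.symm)

section Landen

variable {ζ : ℂ}

lemma hasDerivAt_ofReal_mul (ζ : ℂ) (t : ℝ) : HasDerivAt (fun t : ℝ => (t : ℂ) * ζ) ζ t := by
  simpa using (Complex.ofRealCLM.hasDerivAt (x := t)).mul_const ζ

lemma norm_ofReal_mul_lt (hζ : ‖ζ‖ = 1) {t : ℝ} (ht : t ∈ Set.Ioo (0 : ℝ) 1) :
    ‖(t : ℂ) * ζ‖ < 1 := by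
  rw [norm_mul, hζ, mul_one, Complex.norm_real, Real.norm_of_nonneg ht.1.le]; exact ht.2

lemma norm_ofReal_mul_le (hζ : ‖ζ‖ = 1) {t : ℝ} (ht : t ∈ Set.Icc (0 : ℝ) 1) :
    ‖(t : ℂ) * ζ‖ ≤ 1 := by
  rw [norm_mul, hζ, mul_one, Complex.norm_real, Real.norm_of_nonneg ht.1]; exact ht.2

lemma one_sub_re_pos (hre : ζ.re ≤ 0) {t : ℝ} (ht : 0 ≤ t) : 0 < (1 - (t : ℂ) * ζ).re := by
  have : t * ζ.re ≤ 0 := mul_nonpos_of_nonneg_of_nonpos ht hre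
  simp only [Complex.sub_re, Complex.one_re, Complex.re_ofReal_mul]
  linarith

lemma one_sub_ne_zero' (hre : ζ.re ≤ 0) {t : ℝ} (ht : 0 ≤ t) : 1 - (t : ℂ) * ζ ≠ 0 := fun h => by
  have := one_sub_re_pos hre ht
  rw [h] at this; simp at this

/-- Landen's substitution `z ↦ z / (z - 1)`. -/
noncomputable def landen (z : ℂ) : ℂ := z / (z - 1)

/-- A point with nonpositive real part is nearer to 0 than to 1. Hence Landen's image stays in the
open unit disc and the series converge on both sides of the transformation. -/
lemma norm_landen_lt (hre : ζ.re ≤ 0) {t : ℝ} (ht : 0 ≤ t) : ‖landen ((t : ℂ) * ζ)‖ < 1 := by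
  have h0 := one_sub_ne_zero' hre ht
  have h1 : (t : ℂ) * ζ - 1 ≠ 0 := fun h => h0 (by linear_combination -h)
  rw [landen, norm_div, div_lt_one (norm_pos_iff.2 h1)]
  refine lt_of_pow_lt_pow_left₀ 2 (norm_nonneg _) ?_
  rw [Complex.sq_norm, Complex.sq_norm, Complex.normSq_apply, Complex.normSq_apply]
  have : t * ζ.re ≤ 0 := mul_nonpos_of_nonneg_of_nonpos ht hre
  simp only [Complex.sub_re, Complex.sub_im, Complex.one_re, Complex.one_im, Complex.re_ofReal_mul,
    Complex.im_ofReal_mul]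
  nlinarith

lemma hasDerivAt_landen (hre : ζ.re ≤ 0) {t : ℝ} (ht : 0 < t) :
    HasDerivAt (fun t : ℝ => landen ((t : ℂ) * ζ))
      (landen ((t : ℂ) * ζ) / ((1 - (t : ℂ) * ζ) * t)) t := by
  have h0 := one_sub_ne_zero' hre ht.le
  have h1 : (t : ℂ) * ζ - 1 ≠ 0 := fun h => h0 (by linear_combination -h)
  have ht' : (t : ℂ) ≠ 0 := by exact_mod_cast ht.ne'
  have h := hasDerivAt_ofReal_mul ζ t
  refine (h.div (h.sub_const 1) h1).congr_deriv ?_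
  rw [landen, show (t : ℂ) * ζ - 1 = -(1 - t * ζ) by ring]
  field_simp
  ring

lemma landen_ne_zero (hre : ζ.re ≤ 0) (hζ : ζ ≠ 0) {t : ℝ} (ht : 0 < t) :
    landen ((t : ℂ) * ζ) ≠ 0 := by
  have h0 := one_sub_ne_zero' hre ht.le
  have h1 : (t : ℂ) * ζ - 1 ≠ 0 := fun h => h0 (by linear_combination -h)
  have ht' : (t : ℂ) ≠ 0 := by exact_mod_cast ht.ne'
  exact div_ne_zero (mul_ne_zero ht' hζ) h1

lemma log_one_sub_landen (hre : ζ.re ≤ 0) {t : ℝ} (ht : 0 ≤ t) :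
    Complex.log (1 - landen ((t : ℂ) * ζ)) = -Complex.log (1 - (t : ℂ) * ζ) := by
  have h0 := one_sub_ne_zero' hre ht
  have h1 : (t : ℂ) * ζ - 1 ≠ 0 := fun h => h0 (by linear_combination -h)
  have : 1 - landen ((t : ℂ) * ζ) = (1 - (t : ℂ) * ζ)⁻¹ := by
    rw [landen]; field_simp; ring
  rw [this, Complex.log_inv]
  exact Complex.slitPlane_arg_ne_pi (Or.inl (one_sub_re_pos hre ht))

lemma hasDerivAt_pl_ray (s : ℕ) (hζ : ‖ζ‖ = 1) {t : ℝ} (ht : t ∈ Set.Ioo (0 : ℝ) 1) :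
    HasDerivAt (fun t : ℝ => pl (s + 1) ((t : ℂ) * ζ)) (pl s ((t : ℂ) * ζ) / t) t := by
  have ht' : (t : ℂ) ≠ 0 := by exact_mod_cast ht.1.ne'
  have hζ0 : ζ ≠ 0 := fun h => by rw [h, norm_zero] at hζ; exact zero_ne_one hζ
  refine ((hasDerivAt_pl s (norm_ofReal_mul_lt hζ ht) (mul_ne_zero ht' hζ0)).comp_of_eq t
    (hasDerivAt_ofReal_mul ζ t) rfl).congr_deriv ?_
  field_simp

lemma hasDerivAt_nielsen_ray (s : ℕ) (hζ : ‖ζ‖ = 1) {t : ℝ} (ht : t ∈ Set.Ioo (0 : ℝ) 1) :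
    HasDerivAt (fun t : ℝ => nielsen (s + 1) ((t : ℂ) * ζ)) (nielsen s ((t : ℂ) * ζ) / t) t := by
  have ht' : (t : ℂ) ≠ 0 := by exact_mod_cast ht.1.ne'
  have hζ0 : ζ ≠ 0 := fun h => by rw [h, norm_zero] at hζ; exact zero_ne_one hζ
  refine ((hasDerivAt_nielsen (norm_ofReal_mul_lt hζ ht) (mul_ne_zero ht' hζ0)).comp_of_eq t
    (hasDerivAt_ofReal_mul ζ t) rfl).congr_deriv ?_
  field_simp

lemma hasDerivAt_pl_landen (s : ℕ) (hζ : ‖ζ‖ = 1) (hre : ζ.re ≤ 0) {t : ℝ} (ht : 0 < t) :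
    HasDerivAt (fun t : ℝ => pl (s + 1) (landen ((t : ℂ) * ζ)))
      (pl s (landen ((t : ℂ) * ζ)) / ((1 - (t : ℂ) * ζ) * t)) t := by
  have hζ0 : ζ ≠ 0 := fun h => by rw [h, norm_zero] at hζ; exact zero_ne_one hζ
  have h1 := landen_ne_zero hre hζ0 ht
  refine ((hasDerivAt_pl s (norm_landen_lt hre ht.le) h1).comp_of_eq t
    (hasDerivAt_landen hre ht) rfl).congr_deriv ?_
  field_simp

lemma hasDerivAt_log_ray (hre : ζ.re ≤ 0) {t : ℝ} (ht : 0 < t) :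
    HasDerivAt (fun t : ℝ => Complex.log (1 - (t : ℂ) * ζ))
      (-((t : ℂ) * ζ) / ((1 - (t : ℂ) * ζ) * t)) t := by
  have h0 := one_sub_ne_zero' hre ht.le
  have ht' : (t : ℂ) ≠ 0 := by exact_mod_cast ht.ne'
  refine (((hasDerivAt_ofReal_mul ζ t).const_sub 1).clog_real
    (Or.inl (one_sub_re_pos hre ht.le))).congr_deriv ?_
  field_simp

lemma continuousOn_ray (hζ : ‖ζ‖ = 1) {f : ℂ → ℂ} (hf : ContinuousOn f (Metric.closedBall 0 1)) :
    ContinuousOn (fun t : ℝ => f ((t : ℂ) * ζ)) (Set.Icc 0 1) :=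
  hf.comp (by fun_prop) fun t ht => by
    rw [mem_closedBall_zero_iff]; exact norm_ofReal_mul_le hζ ht

lemma continuousOn_landen_ray (hre : ζ.re ≤ 0) {f : ℂ → ℂ}
    (hf : ContinuousOn f (Metric.closedBall 0 1)) :
    ContinuousOn (fun t : ℝ => f (landen ((t : ℂ) * ζ))) (Set.Icc 0 1) := by
  refine hf.comp (fun t ht => ?_) fun t ht => by
    rw [mem_closedBall_zero_iff]; exact (norm_landen_lt hre ht.1).le
  have h0 := one_sub_ne_zero' hre ht.1
  have h1 : (t : ℂ) * ζ - 1 ≠ 0 := fun h => h0 (by linear_combination -h)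
  have h2 : Continuous fun t : ℝ => (t : ℂ) * ζ := by fun_prop
  exact (h2.continuousAt.div (h2.sub continuous_const).continuousAt h1).continuousWithinAt

lemma continuousOn_log_ray (hre : ζ.re ≤ 0) :
    ContinuousOn (fun t : ℝ => Complex.log (1 - (t : ℂ) * ζ)) (Set.Icc 0 1) :=
  ContinuousOn.clog (by fun_prop) fun _ ht => Or.inl (one_sub_re_pos hre ht.1)

/-- Landen's identity for the dilogarithm. -/
lemma landen_two (hζ : ‖ζ‖ = 1) (hre : ζ.re ≤ 0) {t : ℝ} (ht : t ∈ Set.Icc (0 : ℝ) 1) :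
    pl 2 (landen ((t : ℂ) * ζ)) =
      -pl 2 ((t : ℂ) * ζ) - Complex.log (1 - (t : ℂ) * ζ) ^ 2 / 2 := by
  -- The identity is proved along the whole ray, not only at t = 1, because it enters the derivative
  -- computation in `landen_three`.
  have key := eq_of_hasDerivAt_zero (f := fun t : ℝ => pl 2 (landen ((t : ℂ) * ζ)) +
    pl 2 ((t : ℂ) * ζ) + Complex.log (1 - (t : ℂ) * ζ) ^ 2 / 2) ht.1 ?_ ?_
  · simp only [Complex.ofReal_zero, zero_mul, landen, zero_div, pl_zero, sub_zero, Complex.log_one]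
      at key
    rw [landen]
    linear_combination key
  · refine ContinuousOn.mono ?_ (Set.Icc_subset_Icc_right ht.2)
    exact ((continuousOn_landen_ray hre (continuousOn_pl le_rfl)).add
      (continuousOn_ray hζ (continuousOn_pl le_rfl))).add (((continuousOn_log_ray hre).pow 2).div_const _)
  · intro x hx
    have hx1 : x ∈ Set.Ioo (0 : ℝ) 1 := ⟨hx.1, hx.2.trans_le ht.2⟩
    have h0 := one_sub_ne_zero' hre hx1.1.le
    have hx' : (x : ℂ) ≠ 0 := by exact_mod_cast hx.1.ne'
    refine (((hasDerivAt_pl_landen 1 hζ hre hx.1).add (hasDerivAt_pl_ray 1 hζ hx1)).add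
      (((hasDerivAt_log_ray hre hx.1).pow 2).div_const 2)).congr_deriv ?_
    rw [pl_one_complex (norm_landen_lt hre hx.1.le), pl_one_complex (norm_ofReal_mul_lt hζ hx1),
      log_one_sub_landen hre hx.1.le]
    push_cast
    field_simp
    ring

/-- Landen's identity for the trilogarithm. -/
lemma landen_three (hζ : ‖ζ‖ = 1) (hre : ζ.re ≤ 0) :
    nielsen 2 ζ = pl 3 (landen ζ) + pl 3 ζ - Complex.log (1 - ζ) * pl 2 ζ -
      Complex.log (1 - ζ) ^ 3 / 6 := by
  have key := eq_of_hasDerivAt_zero (f := fun t : ℝ => pl 3 (landen ((t : ℂ) * ζ)) +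
    pl 3 ((t : ℂ) * ζ) - Complex.log (1 - (t : ℂ) * ζ) * pl 2 ((t : ℂ) * ζ) -
    Complex.log (1 - (t : ℂ) * ζ) ^ 3 / 6 - nielsen 2 ((t : ℂ) * ζ)) zero_le_one ?_ ?_
  · simp only [Complex.ofReal_zero, zero_mul, landen, zero_div, pl_zero, sub_zero, Complex.log_one,
      Complex.ofReal_one, one_mul, nielsen_zero] at key
    rw [landen]
    linear_combination -key
  · exact ((((continuousOn_landen_ray hre (continuousOn_pl (by norm_num))).add
      (continuousOn_ray hζ (continuousOn_pl (by norm_num)))).sub ((continuousOn_log_ray hre).mul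
      (continuousOn_ray hζ (continuousOn_pl le_rfl)))).sub
      (((continuousOn_log_ray hre).pow 3).div_const _)).sub
      (continuousOn_ray hζ (continuousOn_nielsen le_rfl))
  · intro x hx
    have h0 := one_sub_ne_zero' hre hx.1.le
    have hx' : (x : ℂ) ≠ 0 := by exact_mod_cast hx.1.ne'
    refine (((((hasDerivAt_pl_landen 2 hζ hre hx.1).add (hasDerivAt_pl_ray 2 hζ hx)).sub
      ((hasDerivAt_log_ray hre hx.1).mul (hasDerivAt_pl_ray 1 hζ hx))).sub
      (((hasDerivAt_log_ray hre hx.1).pow 3).div_const 6)).sub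
      (hasDerivAt_nielsen_ray 1 hζ hx)).congr_deriv ?_
    rw [landen_two hζ hre ⟨hx.1.le, hx.2.le⟩, pl_one_complex (norm_ofReal_mul_lt hζ hx),
      nielsen_one_complex (norm_ofReal_mul_lt hζ hx)]
    push_cast
    field_simp
    ring

end Landen

/-! ### Identities of real polylogarithms -/

section RealPolylog

variable {x : ℝ}

lemma hasDerivAt_pl_real (s : ℕ) (hx : x ∈ Set.Ioo (0 : ℝ) 1) :
    HasDerivAt (pl (s + 1)) (pl s x / x) x :=
  hasDerivAt_pl s (by rw [Real.norm_of_nonneg hx.1.le]; exact hx.2) hx.1.ne'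

lemma hasDerivAt_nielsen_real (s : ℕ) (hx : x ∈ Set.Ioo (0 : ℝ) 1) :
    HasDerivAt (nielsen (s + 1)) (nielsen s x / x) x :=
  hasDerivAt_nielsen (by rw [Real.norm_of_nonneg hx.1.le]; exact hx.2) hx.1.ne'

lemma one_sub_mem_Ioo (hx : x ∈ Set.Ioo (0 : ℝ) 1) : 1 - x ∈ Set.Ioo (0 : ℝ) 1 :=
  ⟨by linarith [hx.2], by linarith [hx.1]⟩

lemma hasDerivAt_pl_one_sub (s : ℕ) (hx : x ∈ Set.Ioo (0 : ℝ) 1) :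
    HasDerivAt (fun x : ℝ => pl (s + 1) (1 - x)) (-(pl s (1 - x) / (1 - x))) x := by
  have := (hasDerivAt_pl_real s (one_sub_mem_Ioo hx)).comp_of_eq x
    ((hasDerivAt_id x).const_sub 1) rfl
  exact this.congr_deriv (by ring)

lemma hasDerivAt_nielsen_one_sub (s : ℕ) (hx : x ∈ Set.Ioo (0 : ℝ) 1) :
    HasDerivAt (fun x : ℝ => nielsen (s + 1) (1 - x)) (-(nielsen s (1 - x) / (1 - x))) x := by
  have := (hasDerivAt_nielsen_real s (one_sub_mem_Ioo hx)).comp_of_eq x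
    ((hasDerivAt_id x).const_sub 1) rfl
  exact this.congr_deriv (by ring)

lemma hasDerivAt_log_one_sub (hx : x ∈ Set.Ioo (0 : ℝ) 1) :
    HasDerivAt (fun x : ℝ => Real.log (1 - x)) (-1 / (1 - x)) x :=
  ((hasDerivAt_id x).const_sub 1).log (one_sub_mem_Ioo hx).1.ne'

lemma abs_lt_one_of_mem (hx : x ∈ Set.Ioo (0 : ℝ) 1) : |x| < 1 := by
  rw [abs_of_pos hx.1]; exact hx.2

end RealPolylog

/-! ### Functional equations on [0, 1/2]. -/

lemma mem_Ioo_one_of_half {x : ℝ} (hx : x ∈ Set.Ioo (0 : ℝ) (1 / 2)) : x ∈ Set.Ioo (0 : ℝ) 1 :=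
  ⟨hx.1, by linarith [hx.2]⟩

lemma Icc_half_subset : Set.Icc (0 : ℝ) (1 / 2) ⊆ Metric.closedBall 0 1 := fun x hx => by
  rw [mem_closedBall_zero_iff, Real.norm_of_nonneg hx.1]; linarith [hx.2]

lemma continuousOn_one_sub_half {f : ℝ → ℝ} (hf : ContinuousOn f (Metric.closedBall 0 1)) :
    ContinuousOn (fun x : ℝ => f (1 - x)) (Set.Icc 0 (1 / 2)) :=
  hf.comp (by fun_prop) fun x hx => by
    rw [mem_closedBall_zero_iff, Real.norm_of_nonneg (by linarith [hx.2])]; linarith [hx.1]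

lemma continuousOn_log_one_sub_half :
    ContinuousOn (fun x : ℝ => Real.log (1 - x)) (Set.Icc 0 (1 / 2)) :=
  ContinuousOn.log (by fun_prop) fun x hx => by linarith [hx.2]

/-- A function vanishing to first order at `0` cancels a logarithmic singularity. -/
lemma continuousOn_log_mul {g : ℝ → ℝ} {g' : ℝ} (hg : ContinuousOn g (Set.Icc 0 (1 / 2)))
    (h0 : g 0 = 0) (hd : HasDerivAt g g' 0) :
    ContinuousOn (fun x => Real.log x * g x) (Set.Icc 0 (1 / 2)) := by
  intro x hx
  rcases hx.1.eq_or_lt with rfl | hx0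
  -- At 0 the product has the value `Real.log 0 * g 0 = 0`, and near 0 it is O(x log x), which tends
  -- to 0.
  · refine ContinuousAt.continuousWithinAt ?_
    have h1 : (fun x => Real.log x * g x) =O[𝓝 0] fun x : ℝ => Real.log x * x := by
      have := hd.isBigO_sub
      simp only [h0, sub_zero] at this
      exact (Asymptotics.isBigO_refl _ _).mul this
    have h2 : Tendsto (fun x : ℝ => Real.log x * x) (𝓝 0) (𝓝 0) := by
      have := Real.continuous_mul_log.tendsto 0
      simp only [zero_mul] at this
      exact this.congr fun x => mul_comm _ _
    have := h1.trans_tendsto h2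
    rw [ContinuousAt, h0, mul_zero]
    exact this
  · exact ((Real.continuousAt_log hx0.ne').continuousWithinAt).mul (hg x hx)

lemma hasDerivAt_log_one_sub_zero : HasDerivAt (fun x : ℝ => Real.log (1 - x)) (-1) 0 := by
  have := ((hasDerivAt_id (0 : ℝ)).const_sub 1).log (by norm_num)
  simpa using this

/-- The formula in `hasDerivAt_nielsen` divides by z and so excludes 0. Here only differentiability
at 0 matters, as input to `continuousOn_log_mul`. -/
lemma hasDerivAt_nielsen_zero {s : ℕ} (hs : 1 ≤ s) : HasDerivAt (nielsen s : ℝ → ℝ)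
    (∑' n, (harm n : ℝ) / ((n : ℝ) + 1) ^ s * ((n + 1 : ℕ) * 0 ^ n)) 0 :=
  hasDerivAt_tsum_mul_pow (𝕜 := ℝ) (fun n => norm_nielsen_coeff_le (𝕜 := ℝ) hs n) (by simp)

/-- `Li_2(1/2)`. -/
lemma pl_two_half : pl 2 (1 / 2 : ℝ) = pl 2 (1 : ℝ) / 2 - Real.log 2 ^ 2 / 2 := by
  -- Euler's reflection formula, used only up to 1/2, the fixed point of x ↦ 1 - x; the constant is
  -- read off at x = 0, where the logarithmic term vanishes.
  have key := eq_of_hasDerivAt_zero (f := fun x : ℝ => pl 2 x + pl 2 (1 - x) +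
    Real.log x * Real.log (1 - x)) (show (0 : ℝ) ≤ 1 / 2 by norm_num) ?_ ?_
  · have e : (1 : ℝ) - 1 / 2 = 1 / 2 := by norm_num
    have l : Real.log (1 / 2) = -Real.log 2 := by rw [one_div, Real.log_inv]
    simp only [pl_zero, sub_zero, Real.log_one, e, l] at key
    linear_combination key / 2
  · exact ((((continuousOn_pl le_rfl).mono Icc_half_subset)).add
      (continuousOn_one_sub_half (continuousOn_pl le_rfl))).add
      (continuousOn_log_mul continuousOn_log_one_sub_half (by simp) hasDerivAt_log_one_sub_zero)
  · intro x hx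
    have hx1 := mem_Ioo_one_of_half hx
    have hx0 := hx.1.ne'
    have hx2 := (one_sub_mem_Ioo hx1).1.ne'
    refine (((hasDerivAt_pl_real 1 hx1).add (hasDerivAt_pl_one_sub 1 hx1)).add
      ((Real.hasDerivAt_log hx0).mul (hasDerivAt_log_one_sub hx1))).congr_deriv ?_
    rw [pl_one_real (abs_lt_one_of_mem hx1), pl_one_real (abs_lt_one_of_mem (one_sub_mem_Ioo hx1)),
      sub_sub_cancel]
    field_simp
    ring

/-- Reflection for `∑ H_{k-1} x^k / k^2`, at `x = 1/2`. -/
lemma nielsen_two_half : nielsen 2 (1 / 2 : ℝ) = pl 3 (1 : ℝ) - pl 3 (1 / 2 : ℝ) -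
    Real.log 2 * pl 2 (1 / 2 : ℝ) - Real.log 2 ^ 3 / 2 := by
  have key := eq_of_hasDerivAt_zero (f := fun x : ℝ => nielsen 2 x + pl 3 (1 - x) -
    Real.log (1 - x) * pl 2 (1 - x) - Real.log x * (Real.log (1 - x) ^ 2 / 2))
    (show (0 : ℝ) ≤ 1 / 2 by norm_num) ?_ ?_
  · have e : (1 : ℝ) - 1 / 2 = 1 / 2 := by norm_num
    have l : Real.log (1 / 2) = -Real.log 2 := by rw [one_div, Real.log_inv]
    simp only [nielsen_zero, sub_zero, Real.log_one, e, l] at key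
    linear_combination key
  · exact ((((continuousOn_nielsen le_rfl).mono Icc_half_subset).add
      (continuousOn_one_sub_half (continuousOn_pl (by norm_num)))).sub
      (continuousOn_log_one_sub_half.mul (continuousOn_one_sub_half (continuousOn_pl le_rfl)))).sub
      (continuousOn_log_mul ((continuousOn_log_one_sub_half.pow 2).div_const 2) (by simp)
        ((hasDerivAt_log_one_sub_zero.pow 2).div_const 2))
  · intro x hx
    have hx1 := mem_Ioo_one_of_half hx
    have hx0 := hx.1.ne'
    have hx2 := (one_sub_mem_Ioo hx1).1.ne'
    have hl := hasDerivAt_log_one_sub hx1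
    refine ((((hasDerivAt_nielsen_real 1 hx1).add (hasDerivAt_pl_one_sub 2 hx1)).sub
      (hl.mul (hasDerivAt_pl_one_sub 1 hx1))).sub
      ((Real.hasDerivAt_log hx0).mul ((hl.pow 2).div_const 2))).congr_deriv ?_
    rw [nielsen_one_real (abs_lt_one_of_mem hx1),
      pl_one_real (abs_lt_one_of_mem (one_sub_mem_Ioo hx1)), sub_sub_cancel]
    simp only [Pi.pow_apply]
    push_cast
    field_simp
    ring

/-- Reflection for `∑ H_{k-1} x^k / k^3`, at `x = 1/2`. -/
lemma nielsen_three_half : nielsen 3 (1 / 2 : ℝ) = nielsen 3 (1 : ℝ) / 2 -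
    Real.log 2 * nielsen 2 (1 / 2 : ℝ) - Real.log 2 ^ 4 / 8 := by
  have key := eq_of_hasDerivAt_zero (f := fun x : ℝ => nielsen 3 x + nielsen 3 (1 - x) -
    Real.log x * nielsen 2 x - Real.log (1 - x) * nielsen 2 (1 - x) +
    (Real.log x * Real.log (1 - x)) ^ 2 / 4) (show (0 : ℝ) ≤ 1 / 2 by norm_num) ?_ ?_
  · have e : (1 : ℝ) - 1 / 2 = 1 / 2 := by norm_num
    have l : Real.log (1 / 2) = -Real.log 2 := by rw [one_div, Real.log_inv]
    simp only [nielsen_zero, sub_zero, Real.log_one, e, l] at key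
    linear_combination key / 2
  · exact (((((continuousOn_nielsen (by norm_num)).mono Icc_half_subset).add
      (continuousOn_one_sub_half (continuousOn_nielsen (by norm_num)))).sub
      (continuousOn_log_mul ((continuousOn_nielsen le_rfl).mono Icc_half_subset) (nielsen_zero 2)
        (hasDerivAt_nielsen_zero one_le_two))).sub
      (continuousOn_log_one_sub_half.mul
        (continuousOn_one_sub_half (continuousOn_nielsen le_rfl)))).add
      (((continuousOn_log_mul continuousOn_log_one_sub_half (by simp)
        hasDerivAt_log_one_sub_zero).pow 2).div_const 4)
  · intro x hx
    have hx1 := mem_Ioo_one_of_half hx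
    have hx0 := hx.1.ne'
    have hx2 := (one_sub_mem_Ioo hx1).1.ne'
    have hl := hasDerivAt_log_one_sub hx1
    have hl' := Real.hasDerivAt_log hx0
    refine (((((hasDerivAt_nielsen_real 2 hx1).add (hasDerivAt_nielsen_one_sub 2 hx1)).sub
      (hl'.mul (hasDerivAt_nielsen_real 1 hx1))).sub
      (hl.mul (hasDerivAt_nielsen_one_sub 1 hx1))).add
      (((hl'.mul hl).pow 2).div_const 4)).congr_deriv ?_
    rw [nielsen_one_real (abs_lt_one_of_mem hx1),
      nielsen_one_real (abs_lt_one_of_mem (one_sub_mem_Ioo hx1)), sub_sub_cancel]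
    simp only [Pi.mul_apply]
    push_cast
    field_simp
    ring

/-! The substitution `x ↦ -x/(1-x)` for `∑ H_{k-1} x^k / k^s`. -/

lemma neg_div_one_sub_mem {x : ℝ} (hx : x ∈ Set.Icc (0 : ℝ) (1 / 2)) :
    -x / (1 - x) ∈ Metric.closedBall (0 : ℝ) 1 := by
  have : 0 < 1 - x := by linarith [hx.2]
  rw [mem_closedBall_zero_iff, norm_div, norm_neg, Real.norm_of_nonneg hx.1,
    Real.norm_of_nonneg this.le, div_le_one this]
  linarith [hx.2]

lemma abs_neg_div_one_sub_lt {x : ℝ} (hx : x ∈ Set.Ioo (0 : ℝ) (1 / 2)) :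
    ‖-x / (1 - x)‖ < 1 := by
  have : 0 < 1 - x := by linarith [hx.2]
  rw [norm_div, norm_neg, Real.norm_of_nonneg hx.1.le, Real.norm_of_nonneg this.le, div_lt_one this]
  linarith [hx.2]

lemma hasDerivAt_nielsen_neg_div (s : ℕ) {x : ℝ} (hx : x ∈ Set.Ioo (0 : ℝ) (1 / 2)) :
    HasDerivAt (fun x : ℝ => nielsen (s + 1) (-x / (1 - x)))
      (nielsen s (-x / (1 - x)) / (x * (1 - x))) x := by
  have hx0 := hx.1.ne'
  have hx2 := (one_sub_mem_Ioo (mem_Ioo_one_of_half hx)).1.ne'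
  have h1 : HasDerivAt (fun x : ℝ => -x / (1 - x)) (-1 / (1 - x) ^ 2) x := by
    refine ((hasDerivAt_id x).neg.div ((hasDerivAt_id x).const_sub 1) hx2).congr_deriv ?_
    simp only [id_eq, Pi.neg_apply]
    field_simp
    ring
  refine ((hasDerivAt_nielsen (abs_neg_div_one_sub_lt hx)
    (div_ne_zero (neg_ne_zero.2 hx0) hx2)).comp_of_eq x h1 rfl).congr_deriv ?_
  field_simp

lemma continuousOn_nielsen_neg_div {s : ℕ} (hs : 2 ≤ s) :
    ContinuousOn (fun x : ℝ => nielsen s (-x / (1 - x))) (Set.Icc 0 (1 / 2)) :=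
  (continuousOn_nielsen hs).comp (ContinuousOn.div (by fun_prop) (by fun_prop)
    fun x hx => by linarith [hx.2]) fun _ hx => neg_div_one_sub_mem hx

/-- For u = -x/(1-x) one has du/u = dx/(x(1-x)) and log(1-u) = -log(1-x). So the left side has
derivative log²(1-x)/(2x) + log²(1-x)/(2(1-x)), and the two terms integrate to the two terms on the
right. -/
lemma nielsen_two_neg_div {x : ℝ} (hx : x ∈ Set.Icc (0 : ℝ) (1 / 2)) :
    nielsen 2 (-x / (1 - x)) = nielsen 2 x - Real.log (1 - x) ^ 3 / 6 := by
  have hsub : Set.Icc 0 x ⊆ Set.Icc (0 : ℝ) (1 / 2) := Set.Icc_subset_Icc_right hx.2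
  have key := eq_of_hasDerivAt_zero (f := fun x : ℝ => nielsen 2 (-x / (1 - x)) -
    nielsen 2 x + Real.log (1 - x) ^ 3 / 6) hx.1 ?_ ?_
  · simp only [neg_zero, zero_div, nielsen_zero, sub_zero, Real.log_one] at key
    linear_combination key
  · exact (((continuousOn_nielsen_neg_div le_rfl).sub ((continuousOn_nielsen le_rfl).mono
      Icc_half_subset)).add ((continuousOn_log_one_sub_half.pow 3).div_const 6)).mono hsub
  · intro y hy
    have hy' : y ∈ Set.Ioo (0 : ℝ) (1 / 2) := ⟨hy.1, hy.2.trans_le hx.2⟩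
    have hx1 := mem_Ioo_one_of_half hy'
    have hx0 := hy.1.ne'
    have hx2 := (one_sub_mem_Ioo hx1).1.ne'
    refine (((hasDerivAt_nielsen_neg_div 1 hy').sub (hasDerivAt_nielsen_real 1 hx1)).add
      (((hasDerivAt_log_one_sub hx1).pow 3).div_const 6)).congr_deriv ?_
    rw [nielsen_one_real (abs_lt_one_of_mem hx1), nielsen_one_real (abs_neg_div_one_sub_lt hy'),
      show 1 - -y / (1 - y) = (1 - y)⁻¹ by field_simp; ring, Real.log_inv]
    push_cast
    field_simp
    ring

/-- The same substitution one weight higher; x = 1/2 goes to -1. With L = log(1-x), integrating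
(`nielsen 2 x` - L³/6)(1/x + 1/(1-x)) by parts leaves ∫ L³/(3x) dx. The last bracket is an
antiderivative of this, built from polylogarithms at 1 - x; its value at x = 0 gives the term -2
Li_4(1). -/
lemma nielsen_three_neg_one : nielsen 3 (-1 : ℝ) = nielsen 3 (1 / 2 : ℝ) +
    Real.log 2 * nielsen 2 (1 / 2 : ℝ) + Real.log 2 ^ 4 / 24 - 2 * pl 4 (1 : ℝ) +
    (Real.log 2 ^ 4 + 3 * Real.log 2 ^ 2 * pl 2 (1 / 2 : ℝ) + 6 * Real.log 2 * pl 3 (1 / 2 : ℝ) +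
      6 * pl 4 (1 / 2 : ℝ)) / 3 := by
  have key := eq_of_hasDerivAt_zero (f := fun x : ℝ => nielsen 3 (-x / (1 - x)) - nielsen 3 x +
    Real.log (1 - x) * nielsen 2 x - Real.log (1 - x) ^ 4 / 24 -
    (Real.log x * Real.log (1 - x) ^ 3 + 3 * (Real.log (1 - x) ^ 2 * pl 2 (1 - x)) -
      6 * (Real.log (1 - x) * pl 3 (1 - x)) + 6 * pl 4 (1 - x)) / 3)
    (show (0 : ℝ) ≤ 1 / 2 by norm_num) ?_ ?_
  · have e : (1 : ℝ) - 1 / 2 = 1 / 2 := by norm_num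
    have e' : (-(1 / 2) : ℝ) / (1 / 2) = -1 := by norm_num
    have l : Real.log (1 / 2) = -Real.log 2 := by rw [one_div, Real.log_inv]
    simp only [neg_zero, zero_div, nielsen_zero, sub_zero, Real.log_one, e, e', l] at key
    linear_combination key
  · have hl := continuousOn_log_one_sub_half
    have hp : ∀ s, 2 ≤ s → ContinuousOn (fun x : ℝ => pl s (1 - x)) (Set.Icc 0 (1 / 2)) :=
      fun s hs => continuousOn_one_sub_half (continuousOn_pl hs)
    have hL := continuousOn_log_mul (hl.pow 3) (by simp) (hasDerivAt_log_one_sub_zero.pow 3)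
    exact (((((continuousOn_nielsen_neg_div (by norm_num)).sub
      ((continuousOn_nielsen (by norm_num)).mono Icc_half_subset)).add
      (hl.mul ((continuousOn_nielsen le_rfl).mono Icc_half_subset))).sub
      ((hl.pow 4).div_const 24)).sub
      ((((hL.add (((hl.pow 2).mul (hp 2 le_rfl)).const_smul (3 : ℝ))).sub
        ((hl.mul (hp 3 (by norm_num))).const_smul (6 : ℝ))).add
        ((hp 4 (by norm_num)).const_smul (6 : ℝ))).div_const 3))
  · intro x hx
    have hx1 := mem_Ioo_one_of_half hx
    have hx0 := hx.1.ne'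
    have hx2 := (one_sub_mem_Ioo hx1).1.ne'
    have hl := hasDerivAt_log_one_sub hx1
    have hl' := Real.hasDerivAt_log hx0
    refine (((((hasDerivAt_nielsen_neg_div 2 hx).sub (hasDerivAt_nielsen_real 2 hx1)).add
      (hl.mul (hasDerivAt_nielsen_real 1 hx1))).sub ((hl.pow 4).div_const 24)).sub
      ((((((hl'.mul (hl.pow 3)).add (((hl.pow 2).mul (hasDerivAt_pl_one_sub 1 hx1)).const_mul 3)).sub
        ((hl.mul (hasDerivAt_pl_one_sub 2 hx1)).const_mul 6)).add
        ((hasDerivAt_pl_one_sub 3 hx1).const_mul 6))).div_const 3)).congr_deriv ?_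
    rw [nielsen_one_real (abs_lt_one_of_mem hx1), nielsen_two_neg_div ⟨hx.1.le, hx.2.le⟩,
      pl_one_real (abs_lt_one_of_mem (one_sub_mem_Ioo hx1)), sub_sub_cancel]
    simp only [Pi.pow_apply]
    push_cast
    field_simp
    ring

/-! ### Splitting series by parity -/

lemma injective_two_mul_add_one : Function.Injective fun n : ℕ => 2 * n + 1 :=
  fun a b hab => by simpa using hab

lemma injective_two_mul : Function.Injective fun n : ℕ => 2 * n :=
  fun a b hab => by simpa using hab

lemma hasSum_even_of_odd {f : ℕ → ℝ} {a b : ℝ} (hf : HasSum f a)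
    (ho : HasSum (fun n => f (2 * n + 1)) b) : HasSum (fun n => f (2 * n)) (a - b) := by
  have he : Summable fun n => f (2 * n) := hf.summable.comp_injective injective_two_mul
  have := he.hasSum.even_add_odd ho
  rw [hf.unique this, add_sub_cancel_right]
  exact he.hasSum

lemma hasSum_alternating_of_odd {f : ℕ → ℝ} {a b : ℝ} (hf : HasSum f a)
    (ho : HasSum (fun n => f (2 * n + 1)) b) : HasSum (fun n => (-1) ^ n * f n) (a - 2 * b) := by
  have he := hasSum_even_of_odd hf ho
  have h := HasSum.even_add_odd (f := fun n => (-1) ^ n * f n) (m := a - b) (m' := -b)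
    (he.congr_fun fun n => by rw [pow_mul]; simp) (ho.neg.congr_fun fun n => by
      rw [pow_succ, pow_mul]; simp)
  convert h using 1
  ring

/-! ### Zeta values -/

lemma hasSum_zetaReal {s : ℕ} (hs : 2 ≤ s) :
    HasSum (fun n : ℕ => 1 / ((n : ℝ) + 1) ^ s) (zetaReal s) := by
  have h := (summable_pl_coeff hs).hasSum
  have e : riemannZeta (s : ℂ) = ((∑' n : ℕ, 1 / ((n : ℝ) + 1) ^ s : ℝ) : ℂ) := by
    rw [zeta_eq_tsum_one_div_nat_add_one_cpow (by rw [Complex.natCast_re]; exact_mod_cast hs),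
      Complex.ofReal_tsum]
    refine tsum_congr fun n => ?_
    push_cast
    rw [Complex.cpow_natCast]
  rw [zetaReal, e, Complex.ofReal_re]
  exact h

lemma pl_one_eq_zetaReal {s : ℕ} (hs : 2 ≤ s) : pl s (1 : ℝ) = zetaReal s := by
  rw [← (hasSum_zetaReal hs).tsum_eq, pl]
  exact tsum_congr fun n => by rw [one_pow]

lemma zetaReal_two : zetaReal 2 = Real.pi ^ 2 / 6 := by
  have h := (hasSum_nat_add_iff' 1).2 hasSum_zeta_two
  refine (hasSum_zetaReal le_rfl).unique (h.congr_both ?_ fun n => ?_)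
  · simp
  · push_cast; rfl

lemma zetaReal_four : zetaReal 4 = Real.pi ^ 4 / 90 := by
  have h := (hasSum_nat_add_iff' 1).2 hasSum_zeta_four
  refine (hasSum_zetaReal (by norm_num)).unique (h.congr_both ?_ fun n => ?_)
  · simp
  · push_cast; rfl

lemma hasSum_one_div_even_pow {s : ℕ} (hs : 2 ≤ s) :
    HasSum (fun n : ℕ => 1 / (((2 * n + 1 : ℕ) : ℝ) + 1) ^ s) (1 / 2 ^ s * zetaReal s) := by
  refine ((hasSum_zetaReal hs).mul_left (1 / 2 ^ s)).congr_fun fun n => ?_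
  push_cast
  rw [show (2 * (n : ℝ) + 1 + 1) = 2 * (n + 1) by ring, mul_pow]
  field_simp

lemma hasSum_one_div_odd_pow {s : ℕ} (hs : 2 ≤ s) :
    HasSum (fun n : ℕ => 1 / (2 * (n : ℝ) + 1) ^ s) ((1 - 1 / 2 ^ s) * zetaReal s) := by
  refine (hasSum_even_of_odd (hasSum_zetaReal hs) (hasSum_one_div_even_pow hs)).congr_both ?_
    fun n => ?_
  · ring
  · push_cast; rfl

lemma pl_neg_one {s : ℕ} (hs : 2 ≤ s) : pl s (-1 : ℝ) = -(1 - 2 / 2 ^ s) * zetaReal s := by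
  have h := (hasSum_alternating_of_odd (hasSum_zetaReal hs) (hasSum_one_div_even_pow hs)).neg
  refine (hasSum_pl hs (by simp)).unique (h.congr_both ?_ fun n => ?_)
  · ring
  · rw [pow_succ]; ring

lemma hasSum_dirichletBeta_three :
    HasSum (fun n : ℕ => (-1 : ℝ) ^ n / (2 * (n : ℝ) + 1) ^ 3) (Real.pi ^ 3 / 32) := by
  have h := hasSum_L_function_mod_four_eval_three
  rw [← injective_two_mul_add_one.hasSum_iff] at h
  · refine h.congr_fun fun n => ?_
    simp only [Function.comp_apply]
    have : Real.pi * ((2 * n + 1 : ℕ) : ℝ) / 2 = Real.pi / 2 + n * Real.pi := by push_cast; ring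
    rw [this, Real.sin_add_nat_mul_pi, Real.sin_pi_div_two]
    push_cast; ring
  · intro m hm
    have : Even m := by
      by_contra hc
      obtain ⟨k, hk⟩ := Nat.not_even_iff_odd.1 hc
      exact hm ⟨k, hk.symm⟩
    obtain ⟨k, rfl⟩ := this
    have : Real.pi * ((k + k : ℕ) : ℝ) / 2 = k * Real.pi := by push_cast; ring
    rw [this, Real.sin_nat_mul_pi, mul_zero]

/-! ### Values at `i` -/

lemma re_pl_I {s : ℕ} (hs : 2 ≤ s) : (pl s Complex.I).re = pl s (-1 : ℝ) / 2 ^ s := by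
  have h := Complex.hasSum_re (hasSum_pl (𝕜 := ℂ) hs (z := Complex.I) (by simp))
  rw [← injective_two_mul_add_one.hasSum_iff] at h
  · refine h.unique (((hasSum_pl hs (z := (-1 : ℝ)) (by simp)).div_const (2 ^ s)).congr_fun
      fun n => ?_)
    simp only [Function.comp_apply]
    have : Complex.I ^ (2 * n + 1 + 1) / (((2 * n + 1 : ℕ) : ℂ) + 1) ^ s =
        (((-1) ^ (n + 1) / (2 * ((n : ℝ) + 1)) ^ s : ℝ) : ℂ) := by
      rw [show 2 * n + 1 + 1 = 2 * (n + 1) by ring, I_pow_two_mul]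
      push_cast
      ring_nf
    rw [this, Complex.ofReal_re, mul_pow]
    field_simp
  · intro m hm
    have : Even m := by
      by_contra hc
      obtain ⟨k, hk⟩ := Nat.not_even_iff_odd.1 hc
      exact hm ⟨k, hk.symm⟩
    obtain ⟨k, rfl⟩ := this
    have : Complex.I ^ (k + k + 1) / (((k + k : ℕ) : ℂ) + 1) ^ s =
        (((-1) ^ k / (2 * (k : ℝ) + 1) ^ s : ℝ) : ℂ) * Complex.I := by
      rw [← two_mul, I_pow_two_mul_add_one]
      push_cast; ring
    rw [this, Complex.re_ofReal_mul, Complex.I_re, mul_zero]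

lemma hasSum_im_I {c : ℕ → ℝ} {s : ℕ} {a : ℂ}
    (h : HasSum (fun n : ℕ => (c n : ℂ) / ((n : ℂ) + 1) ^ s * Complex.I ^ (n + 1)) a) :
    HasSum (fun n : ℕ => (-1) ^ n * c (2 * n) / (2 * (n : ℝ) + 1) ^ s) a.im := by
  have h := Complex.hasSum_im h
  rw [← injective_two_mul.hasSum_iff] at h
  · refine h.congr_fun fun n => ?_
    simp only [Function.comp_apply]
    have : (c (2 * n) : ℂ) / (((2 * n : ℕ) : ℂ) + 1) ^ s * Complex.I ^ (2 * n + 1) =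
        (((-1) ^ n * c (2 * n) / (2 * (n : ℝ) + 1) ^ s : ℝ) : ℂ) * Complex.I := by
      rw [I_pow_two_mul_add_one]
      push_cast; ring
    rw [this, Complex.im_ofReal_mul, Complex.I_im, mul_one]
  · intro m hm
    have : Odd m := by
      by_contra hc
      obtain ⟨k, hk⟩ := Nat.not_odd_iff_even.1 hc
      exact hm ⟨k, by simp [hk]; ring⟩
    obtain ⟨k, rfl⟩ := this
    have : (c (2 * k + 1) : ℂ) / (((2 * k + 1 : ℕ) : ℂ) + 1) ^ s * Complex.I ^ (2 * k + 1 + 1) =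
        ((c (2 * k + 1) / (((2 * k + 1 : ℕ) : ℝ) + 1) ^ s * (-1) ^ (k + 1) : ℝ) : ℂ) := by
      rw [show 2 * k + 1 + 1 = 2 * (k + 1) by ring, I_pow_two_mul]
      push_cast; ring
    rw [this, Complex.ofReal_im]

lemma hasSum_im_pl_I {s : ℕ} (hs : 2 ≤ s) :
    HasSum (fun n : ℕ => (-1 : ℝ) ^ n / (2 * (n : ℝ) + 1) ^ s) (pl s Complex.I).im := by
  have h := hasSum_pl (𝕜 := ℂ) hs (z := Complex.I) (by simp)
  have h' : HasSum (fun n : ℕ => ((1 : ℝ) : ℂ) / ((n : ℂ) + 1) ^ s * Complex.I ^ (n + 1))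
      (pl s Complex.I) := h.congr_fun fun n => by push_cast; ring
  exact (hasSum_im_I (c := fun _ => 1) h').congr_fun fun n => by ring

lemma im_nielsen_I : (nielsen 2 Complex.I).im = eulerSumEven :=
  (hasSum_im_I (c := harm) (hasSum_nielsen (𝕜 := ℂ) le_rfl (z := Complex.I) (by simp))).unique
    hasSum_eulerSumEven

/-- Landen's map sends i to (1-i)/2, the conjugate of the point defining `W3`; hence the sign. -/
lemma im_pl_three_landen_I : (pl 3 (landen Complex.I)).im = -W3 := by
  have e : landen Complex.I = (starRingEnd ℂ) ((1 + Complex.I) / 2) := by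
    have h1 : Complex.I - 1 ≠ 0 := fun h => by
      have := congrArg Complex.re h; simp at this
    rw [landen, div_eq_iff h1]
    simp only [map_div₀, map_add, map_one, Complex.conj_I, map_ofNat]
    linear_combination (1 / 2 : ℂ) * Complex.I_sq
  have h2 : pl 3 (landen Complex.I) = (starRingEnd ℂ) (polylog 3 ((1 + Complex.I) / 2)) := by
    rw [e, pl, polylog, Complex.conj_tsum]
    refine tsum_congr fun n => ?_
    simp only [map_div₀, map_pow, map_add, map_natCast, map_one]
  rw [h2, Complex.conj_im, W3]

lemma log_one_sub_I : Complex.log (1 - Complex.I) =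
    ((Real.log 2 / 2 : ℝ) : ℂ) + ((-(Real.pi / 4) : ℝ) : ℂ) * Complex.I := by
  have h := log_one_sub_polar (θ := Real.pi / 2) (by positivity) le_rfl
  have e : polar 1 (Real.pi / 2) = Complex.I := by
    rw [polar]; push_cast; rw [Complex.exp_pi_div_two_mul_I]; simp
  have e2 : Real.pi / 2 / 2 = Real.pi / 4 := by ring
  rw [e, e2, Real.sin_pi_div_four] at h
  rw [h]
  have : 2 * (√2 / 2) = √2 := by ring
  rw [this, Real.log_sqrt (by norm_num)]
  push_cast; ring

lemma im_ofReal_add_ofReal_mul_I (x y : ℝ) : ((x : ℂ) + (y : ℂ) * Complex.I).im = y := by simp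

/-- This is the imaginary part of `landen_three` at i, with log(1-i) = (log 2)/2 - iπ/4, Li_2(i) =
-π²/48 + iG and Im Li_3(i) = π³/32. -/
lemma eulerSumEven_eq : eulerSumEven = -W3 - Real.log 2 * catalanG / 2 +
    Real.pi * Real.log 2 ^ 2 / 32 + 3 * Real.pi ^ 3 / 128 := by
  have h := congrArg Complex.im (landen_three (ζ := Complex.I) (by simp) (by simp))
  have h2 : pl 2 Complex.I = ((-(Real.pi ^ 2 / 48) : ℝ) : ℂ) + (catalanG : ℂ) * Complex.I := by
    apply Complex.ext
    · rw [re_pl_I le_rfl, pl_neg_one le_rfl, zetaReal_two, re_ofReal_add_ofReal_mul_I]; ring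
    · rw [(hasSum_im_pl_I le_rfl).unique hasSum_catalanG, im_ofReal_add_ofReal_mul_I]
  rw [im_nielsen_I, log_one_sub_I, h2] at h
  have e3 : ∀ x y : ℝ, (((x : ℂ) + (y : ℂ) * Complex.I) ^ 3 / 6).im = (3 * x ^ 2 * y - y ^ 3) / 6 := by
    intro x y
    have : ((x : ℂ) + (y : ℂ) * Complex.I) ^ 3 / 6 = (((x ^ 3 - 3 * x * y ^ 2) / 6 : ℝ) : ℂ) +
        (((3 * x ^ 2 * y - y ^ 3) / 6 : ℝ) : ℂ) * Complex.I := by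
      push_cast
      linear_combination (1 / 6 : ℂ) * (3 * x * y ^ 2 + y ^ 3 * Complex.I) * Complex.I_sq
    rw [this]; simp only [Complex.add_im, Complex.ofReal_im, Complex.im_ofReal_mul, Complex.I_im]
    ring
  have e2 : ∀ x y u v : ℝ, (((x : ℂ) + (y : ℂ) * Complex.I) * ((u : ℂ) + (v : ℂ) * Complex.I)).im =
      x * v + y * u := by
    intro x y u v; simp
  rw [Complex.sub_im, Complex.sub_im, Complex.add_im, im_pl_three_landen_I, e2, e3,
    (hasSum_im_pl_I (by norm_num)).unique hasSum_dirichletBeta_three] at h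
  rw [h]; ring

/-! ### The double zeta value `ζ(3,1)` -/

/-- `∑_{i<n} 1/(i+1)^2`. -/
noncomputable def harmTwo (n : ℕ) : ℝ := ∑ i ∈ range n, 1 / ((i : ℝ) + 1) ^ 2

/-- The identity ∑_{i<j} a_i a_j = ((∑ a)² - ∑ a²)/2 already holds for partial sums. -/
lemma hasSum_harmTwo_div_sq :
    HasSum (fun n : ℕ => harmTwo n / ((n : ℝ) + 1) ^ 2) ((zetaReal 2 ^ 2 - zetaReal 4) / 2) := by
  have h2 := hasSum_zetaReal (s := 2) le_rfl
  have h4 := hasSum_zetaReal (s := 4) (by norm_num)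
  refine (hasSum_iff_tendsto_nat_of_nonneg (f := fun n => harmTwo n / ((n : ℝ) + 1) ^ 2)
    (fun n => div_nonneg (by unfold harmTwo; exact sum_nonneg fun _ _ => by positivity)
      (by positivity)) _).2 ?_
  refine (((h2.tendsto_sum_nat.pow 2).sub h4.tendsto_sum_nat).div_const 2).congr fun N => ?_
  induction N with
  | zero => simp
  | succ N ih =>
    rw [sum_range_succ _ N, sum_range_succ _ N, sum_range_succ _ N, ← ih, harmTwo]
    field_simp
    ring

lemma sum_antidiagonal_inv_sq (n : ℕ) :
    ∑ p ∈ antidiagonal n, 1 / ((p.1 : ℝ) + 1) ^ 2 * (1 / ((p.2 : ℝ) + 1) ^ 2) =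
      2 * (harmTwo (n + 1) / ((n : ℝ) + 2) ^ 2) + 4 * (harm (n + 1) / ((n : ℝ) + 2) ^ 3) := by
  have h : ∀ p ∈ antidiagonal n, 1 / ((p.1 : ℝ) + 1) ^ 2 * (1 / ((p.2 : ℝ) + 1) ^ 2) =
      (1 / ((n : ℝ) + 2) ^ 2 * (1 / ((p.1 : ℝ) + 1) ^ 2) +
        1 / ((n : ℝ) + 2) ^ 2 * (1 / ((p.2 : ℝ) + 1) ^ 2)) +
      2 / ((n : ℝ) + 2) ^ 2 * (1 / ((p.1 : ℝ) + 1) * (1 / ((p.2 : ℝ) + 1))) := by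
    intro p hp
    rw [← mem_antidiagonal.1 hp]
    push_cast
    have : (0 : ℝ) < p.1 + p.2 + 2 := by positivity
    field_simp
    ring
  rw [sum_congr rfl h, sum_add_distrib, sum_add_distrib, ← mul_sum, ← mul_sum, ← mul_sum,
    sum_antidiagonal_inv_mul_inv,
    Nat.sum_antidiagonal_eq_sum_range_succ (fun i _ => 1 / ((i : ℝ) + 1) ^ 2) n,
    ← Finset.Nat.sum_antidiagonal_swap]
  simp only [Prod.snd_swap]
  rw [Nat.sum_antidiagonal_eq_sum_range_succ (fun i _ => 1 / ((i : ℝ) + 1) ^ 2) n, ← harmTwo]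
  field_simp
  ring

/-- Two expansions of ζ(2)². The Cauchy product with partial fractions gives 2ζ(2,2) + 4ζ(3,1),
while `hasSum_harmTwo_div_sq` gives 2ζ(2,2) = ζ(2)² - ζ(4). -/
lemma nielsen_three_one : nielsen 3 (1 : ℝ) = zetaReal 4 / 4 := by
  have h2 := hasSum_zetaReal (s := 2) le_rfl
  have hn : Summable fun n : ℕ => ‖1 / ((n : ℝ) + 1) ^ 2‖ := h2.summable.norm
  have hC := hasSum_cauchyProduct h2 h2 hn hn
  simp only [sum_antidiagonal_inv_sq] at hC
  have h3 := (hasSum_nat_add_iff' 1).2 hasSum_harmTwo_div_sq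
  have h4 := (hasSum_nat_add_iff' 1).2 (hasSum_nielsen (s := 3) (by norm_num) (z := (1 : ℝ)) (by simp))
  simp only [range_one, sum_singleton, harm_zero, harmTwo, range_zero, sum_empty, zero_div,
    sub_zero, one_pow, mul_one, RCLike.ofReal_real_eq_id, id_eq] at h3 h4
  have h5 := hC.unique (((h3.mul_left 2).add (h4.mul_left 4)).congr_fun fun n => ?_)
  · linarith
  · rw [harmTwo]; push_cast
    ring

/-! ### The Euler sum `∑ (-1)^n h_{n+1} / (n+1)^3` -/

lemma hasSum_nielsen_even :
    HasSum (fun n : ℕ => harm (2 * n + 1) / (2 * (n : ℝ) + 2) ^ 3)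
      ((nielsen 3 (1 : ℝ) + nielsen 3 (-1 : ℝ)) / 2) := by
  have h1 := hasSum_nielsen (s := 3) (by norm_num) (z := (1 : ℝ)) (by simp)
  have h2 := hasSum_nielsen (s := 3) (by norm_num) (z := (-1 : ℝ)) (by simp)
  have h := (h1.add h2).div_const 2
  rw [← injective_two_mul_add_one.hasSum_iff] at h
  · refine h.congr_fun fun n => ?_
    simp only [Function.comp_apply, RCLike.ofReal_real_eq_id, id_eq]
    rw [show 2 * n + 1 + 1 = 2 * (n + 1) by ring, pow_mul (-1 : ℝ)]
    push_cast
    simp only [one_pow, neg_one_sq]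
    ring
  · intro m hm
    have : Even m := by
      by_contra hc
      obtain ⟨k, hk⟩ := Nat.not_even_iff_odd.1 hc
      exact hm ⟨k, hk.symm⟩
    rw [pow_succ (-1 : ℝ), this.neg_one_pow, one_pow]
    ring

/-- Uses h_{n+1} = H_{2n+1} - H_n/2. The first part is the even-denominator half of `nielsen 3`,
scaled by 2³; the second is `nielsen 3 1`. -/
lemma hasSum_oddHarmonic_div_cube_pos :
    HasSum (fun n : ℕ => oddHarmonic (n + 1) / ((n : ℝ) + 1) ^ 3)
      (7 / 2 * nielsen 3 (1 : ℝ) + 4 * nielsen 3 (-1 : ℝ)) := by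
  have h1 := hasSum_nielsen (s := 3) (by norm_num) (z := (1 : ℝ)) (by simp)
  refine ((hasSum_nielsen_even.mul_left 8).sub (h1.div_const 2)).congr_both (by ring) fun n => ?_
  have h2 := harm_two_mul (n + 1)
  rw [show 2 * (n + 1) = 2 * n + 1 + 1 by ring, harm_succ (2 * n + 1), harm_succ n] at h2
  push_cast at h2
  have h3 : oddHarmonic (n + 1) = harm (2 * n + 1) - harm n / 2 := by
    have : 1 / (2 * (n : ℝ) + 1 + 1) = 1 / ((n : ℝ) + 1) / 2 := by field_simp; ring
    linarith
  rw [h3]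
  simp only [one_pow, mul_one, RCLike.ofReal_real_eq_id, id_eq]
  field_simp
  ring

lemma li4Half_eq : Li4Half = pl 4 (1 / 2 : ℝ) := by
  have : polylog 4 (1 / 2) = ((pl 4 (1 / 2 : ℝ) : ℝ) : ℂ) := by
    rw [ofReal_pl]; push_cast; rfl
  rw [Li4Half, this, Complex.ofReal_re]

/-- `nielsen 2 (-1)` is computed twice: by Landen's identity at -1, and by `nielsen_two_neg_div` at
1/2 followed by reflection. Li_3(1/2) enters the two results with opposite signs and can be solved
for. -/
lemma pl_three_half : pl 3 (1 / 2 : ℝ) =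
    7 / 8 * zetaReal 3 - Real.pi ^ 2 * Real.log 2 / 12 + Real.log 2 ^ 3 / 6 := by
  have h := landen_three (ζ := -1) (by simp) (by simp)
  have e : landen (-1) = ((1 / 2 : ℝ) : ℂ) := by rw [landen]; push_cast; norm_num
  have e1 : (1 : ℂ) - -1 = ((2 : ℝ) : ℂ) := by push_cast; norm_num
  have e2 : (-1 : ℂ) = ((-1 : ℝ) : ℂ) := by push_cast; rfl
  rw [e, e1, e2, ← Complex.ofReal_log (by norm_num), ← ofReal_pl, ← ofReal_pl, ← ofReal_pl,
    ← ofReal_nielsen] at h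
  have h' : nielsen 2 (-1 : ℝ) = pl 3 (1 / 2 : ℝ) + pl 3 (-1 : ℝ) - Real.log 2 * pl 2 (-1 : ℝ) -
      Real.log 2 ^ 3 / 6 := by exact_mod_cast h
  have h2 := nielsen_two_neg_div (x := 1 / 2) (by norm_num)
  have e3 : (-(1 / 2) : ℝ) / (1 - 1 / 2) = -1 := by norm_num
  have e4 : Real.log (1 - 1 / 2) = -Real.log 2 := by
    rw [show (1 : ℝ) - 1 / 2 = 2⁻¹ by norm_num, Real.log_inv]
  rw [e3, e4, nielsen_two_half, pl_two_half, pl_one_eq_zetaReal le_rfl,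
    pl_one_eq_zetaReal (by norm_num)] at h2
  rw [pl_neg_one le_rfl, pl_neg_one (by norm_num)] at h'
  rw [zetaReal_two] at h' h2
  linear_combination (h2 - h') / 2

/-- The alternating Euler sum `∑ (-1)^{n+1} h_n / n^3`. -/
lemma hasSum_alternating_oddHarmonic_div_cube :
    HasSum (fun n : ℕ => (-1) ^ n * oddHarmonic (n + 1) / ((n : ℝ) + 1) ^ 3)
      (4 * (1 / 2 * (11 / 4 * zetaReal 4 - 7 / 4 * zetaReal 3 * Real.log 2
        + 1 / 2 * zetaReal 2 * Real.log 2 ^ 2 - 1 / 12 * Real.log 2 ^ 4 - 2 * Li4Half)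
        - 25 / 128 * zetaReal 4)) := by
  refine hasSum_oddHarmonic_div_cube.congr_both ?_ fun _ => rfl
  -- With I the alternating and P the positive sum, this equation reads I - π⁴/32 = -(I + P).
  have h1 := hasSum_integral_mul_logCot_sq.unique
    ((hasSum_oddHarmonic_div_cube.add hasSum_oddHarmonic_div_cube_pos).neg.congr_fun fun n => by
      rw [pow_succ]; ring)
  have h2 := nielsen_three_neg_one
  rw [nielsen_three_half, nielsen_three_one, pl_one_eq_zetaReal (by norm_num), pl_three_half,
    pl_two_half, pl_one_eq_zetaReal le_rfl, ← li4Half_eq] at h2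
  rw [nielsen_three_one, h2] at h1
  have h5 := zetaReal_four
  rw [zetaReal_two] at *
  -- The coefficient of `h5` expresses π⁴/64 = (45/32) ζ(4).
  linear_combination -h1 / 2 + 45 / 32 * h5

/-- The Euler sum `∑ (-1)^{n+1} h_n / n^2`. -/
lemma hasSum_alternating_oddHarmonic_div_sq :
    HasSum (fun n : ℕ => (-1) ^ n * oddHarmonic (n + 1) / ((n : ℝ) + 1) ^ 2)
      (Real.pi * catalanG - 7 / 4 * zetaReal 3) := by
  refine hasSum_oddHarmonic_div_sq.congr_both ?_ fun _ => rfl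
  refine HasSum.unique ?_ hasSum_integral_mul_logCot
  refine ((hasSum_catalanG.mul_left Real.pi).sub
    ((hasSum_one_div_odd_pow (s := 3) (by norm_num)).mul_left 2)).congr_both ?_ fun n => ?_
  · ring
  · ring

/-- The Euler sum `∑ (-1)^m h_m / (2m+1)^2`. -/
lemma hasSum_oddHarmonic_div_odd_sq :
    HasSum (fun m : ℕ => (-1) ^ m * oddHarmonic m / (2 * (m : ℝ) + 1) ^ 2)
      (-2 * W3 + Real.pi ^ 3 / 32 + Real.pi * Real.log 2 ^ 2 / 16) := by
  refine (hasSum_eulerSumEven.sub (hasSum_harm_div_odd_sq.div_const 2)).congr_both ?_ fun m => ?_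
  · rw [eulerSumEven_eq]; ring
  · rw [harm_two_mul]; ring

/-! ### The Euler sum `∑ (-1)^m h_m / (2m+1)^3` -/

lemma sum_range_inv_sub_reflect (m : ℕ) (e : ℝ → ℝ) :
    ∑ i ∈ range m, e (2 * (i : ℝ) + 1 - 2 * m) = ∑ i ∈ range m, e (-(2 * (i : ℝ) + 1)) := by
  rw [← sum_range_reflect]
  refine sum_congr rfl fun i hi => ?_
  have hi := mem_range.1 hi
  rw [Nat.sub_sub, Nat.cast_sub (by omega)]
  push_cast
  ring_nf

lemma sum_range_inv_sub (m M : ℕ) :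
    ∑ i ∈ range (m + M), 1 / (2 * (i : ℝ) + 1 - 2 * m) = oddHarmonic M - oddHarmonic m := by
  rw [sum_range_add, sum_range_inv_sub_reflect m (fun x => 1 / x), oddHarmonic_eq_sum,
    oddHarmonic_eq_sum, sub_eq_add_neg, add_comm, ← sum_neg_distrib]
  congr 1
  · refine sum_congr rfl fun i _ => ?_
    push_cast; ring_nf
  · refine sum_congr rfl fun i _ => ?_
    rw [one_div_neg_eq_neg_one_div]

lemma sum_range_inv_add (m M : ℕ) :
    ∑ i ∈ range M, 1 / (2 * (i : ℝ) + 1 + 2 * m) = oddHarmonic (m + M) - oddHarmonic m := by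
  rw [oddHarmonic_eq_sum, oddHarmonic_eq_sum, sum_range_add, add_sub_cancel_left]
  refine sum_congr rfl fun i _ => ?_
  push_cast; ring_nf

lemma tendsto_oddHarmonic_add_sub (j : ℕ) :
    Tendsto (fun M => oddHarmonic (M + j) - oddHarmonic M) atTop (𝓝 0) := by
  induction j with
  | zero => simp
  | succ j ih =>
    have h1 : Tendsto (fun M : ℕ => 1 / (2 * ((M + j : ℕ) : ℝ) + 1)) atTop (𝓝 0) := by
      refine squeeze_zero (fun M => by positivity) (fun M => ?_)
        (tendsto_one_div_add_atTop_nhds_zero_nat (𝕜 := ℝ))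
      push_cast
      gcongr
      have : (0 : ℝ) ≤ M := by positivity
      have : (0 : ℝ) ≤ j := by positivity
      linarith
    simpa using (ih.add h1).congr fun M => by
      rw [← add_assoc, oddHarmonic_succ]; ring

lemma harm_eq_harmonic (n : ℕ) : harm n = harmonic n := by
  rw [harm, harmonic]; push_cast
  simp

/-- The difference is 2(H_M - H_{2M}), in which Euler's constant cancels. -/
lemma tendsto_harm_sub_two_mul_oddHarmonic :
    Tendsto (fun M => harm M - 2 * oddHarmonic M) atTop (𝓝 (-2 * Real.log 2)) := by
  have h := Real.tendsto_harmonic_sub_log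
  have h2 := h.comp (tendsto_id.const_mul_atTop' (r := 2) (by norm_num))
  have h3 := ((h.sub h2).const_mul 2).sub_const (2 * Real.log 2)
  rw [sub_self, mul_zero, zero_sub, ← neg_mul] at h3
  refine h3.congr' ?_
  filter_upwards [eventually_gt_atTop 0] with M hM
  have hM : (M : ℝ) ≠ 0 := by positivity
  have := harm_two_mul M
  simp only [Function.comp_apply, id, ← harm_eq_harmonic]
  push_cast
  rw [Real.log_mul two_ne_zero hM]
  linarith

/-! ### A double series over odd and even integers, summed in both orders. -/

lemma two_mul_add_one_sq_sub_ne_zero (m n : ℕ) :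
    (2 * (m : ℝ) + 1) - 2 * ((n : ℝ) + 1) ≠ 0 := by
  intro h
  have h' : (2 * (m : ℤ) + 1) - 2 * ((n : ℤ) + 1) = 0 := by exact_mod_cast h
  omega

lemma one_le_abs_odd_sub_even (m n : ℕ) :
    1 ≤ |(2 * (m : ℝ) + 1) - 2 * ((n : ℝ) + 1)| := by
  have h : (1 : ℤ) ≤ |(2 * (m : ℤ) + 1) - 2 * ((n : ℤ) + 1)| :=
    Int.one_le_abs (by omega)
  exact_mod_cast h

/-- This decomposition serves the summation over N with o fixed: the factor 1/o³ comes out. -/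
lemma partialFraction_cube {o N : ℝ} (ho : o ≠ 0) (hN : N ≠ 0) (h1 : o - 2 * N ≠ 0)
    (h2 : o + 2 * N ≠ 0) : 1 / (N * (o * (o ^ 2 - 4 * N ^ 2))) =
      1 / o ^ 3 * (1 / N + 1 / (o - 2 * N) - 1 / (o + 2 * N)) := by
  rw [show o ^ 2 - 4 * N ^ 2 = (o - 2 * N) * (o + 2 * N) by ring]
  obtain ⟨d, hd⟩ : ∃ d, d = o - 2 * N := ⟨_, rfl⟩
  obtain ⟨t, ht⟩ : ∃ t, t = o + 2 * N := ⟨_, rfl⟩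
  rw [← hd] at h1 ⊢
  rw [← ht] at h2 ⊢
  field_simp
  rw [hd, ht]
  ring

/-- The same fraction prepared for summation over o with N fixed: 1/(4N³) comes out, and
Leibniz-type series remain. -/
lemma partialFraction_sq {o N : ℝ} (ho : o ≠ 0) (hN : N ≠ 0) (h1 : o - 2 * N ≠ 0)
    (h2 : o + 2 * N ≠ 0) : 1 / (N * (o * (o ^ 2 - 4 * N ^ 2))) =
      1 / (4 * N ^ 3) * ((1 / (o - 2 * N) + 1 / (o + 2 * N)) / 2 - 1 / o) := by
  rw [show o ^ 2 - 4 * N ^ 2 = (o - 2 * N) * (o + 2 * N) by ring]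
  obtain ⟨d, hd⟩ : ∃ d, d = o - 2 * N := ⟨_, rfl⟩
  obtain ⟨t, ht⟩ : ∃ t, t = o + 2 * N := ⟨_, rfl⟩
  rw [← hd] at h1 ⊢
  rw [← ht] at h2 ⊢
  field_simp
  rw [hd, ht]
  ring

/-- The terms of the double series evaluated in two ways. -/
noncomputable def oddEvenTerm (n m : ℕ) : ℝ :=
  (-1) ^ m / (((n : ℝ) + 1) * ((2 * m + 1) * ((2 * m + 1) ^ 2 - 4 * ((n : ℝ) + 1) ^ 2)))

lemma summable_rpow_three_half : Summable fun n : ℕ => ((n : ℝ) + 1) ^ (-(3 / 2) : ℝ) := by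
  have h : Summable fun n : ℕ => (n : ℝ) ^ (-(3 / 2) : ℝ) :=
    Real.summable_nat_rpow.2 (by norm_num)
  refine ((summable_nat_add_iff 1).2 h).congr fun n => by push_cast; rfl

lemma rpow_neg_three_half {x : ℝ} (hx : 0 < x) : x ^ (-(3 / 2) : ℝ) = 1 / (x * √x) := by
  rw [Real.rpow_neg hx.le, show (3 / 2 : ℝ) = 1 + 1 / 2 by norm_num, Real.rpow_add hx,
    Real.rpow_one, ← Real.sqrt_eq_rpow, one_div]

/-- By parity |o - 2N| ≥ 1, and o + 2N ≥ √N √(m+1) by the inequality of means. The resulting product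
majorant justifies exchanging the order of summation. -/
lemma abs_oddEvenTerm_le (n m : ℕ) : |oddEvenTerm n m| ≤
    ((n : ℝ) + 1) ^ (-(3 / 2) : ℝ) * ((m : ℝ) + 1) ^ (-(3 / 2) : ℝ) := by
  rw [rpow_neg_three_half (by positivity), rpow_neg_three_half (by positivity), oddEvenTerm,
    abs_div, abs_pow, abs_neg, abs_one, one_pow, abs_mul, abs_mul,
    show (2 * (m : ℝ) + 1) ^ 2 - 4 * ((n : ℝ) + 1) ^ 2 =
      ((2 * (m : ℝ) + 1) - 2 * ((n : ℝ) + 1)) * ((2 * (m : ℝ) + 1) + 2 * ((n : ℝ) + 1)) by ring,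
    abs_mul, abs_of_pos (show (0 : ℝ) < (n : ℝ) + 1 by positivity),
    abs_of_pos (show (0 : ℝ) < 2 * (m : ℝ) + 1 by positivity),
    abs_of_pos (show (0 : ℝ) < 2 * (m : ℝ) + 1 + 2 * ((n : ℝ) + 1) by positivity),
    one_div_mul_one_div]
  have h1 := one_le_abs_odd_sub_even m n
  have hs1 := Real.sq_sqrt (show (0 : ℝ) ≤ (n : ℝ) + 1 by positivity)
  have hs2 := Real.sq_sqrt (show (0 : ℝ) ≤ (m : ℝ) + 1 by positivity)
  have h2 : √((n : ℝ) + 1) * √((m : ℝ) + 1) ≤ 2 * m + 1 + 2 * ((n : ℝ) + 1) := by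
    have : (0 : ℝ) ≤ n := by positivity
    have : (0 : ℝ) ≤ m := by positivity
    nlinarith [sq_nonneg (√((n : ℝ) + 1) - √((m : ℝ) + 1))]
  have h3 : (m : ℝ) + 1 ≤ 2 * m + 1 := by
    have : (0 : ℝ) ≤ m := by positivity
    linarith
  refine one_div_le_one_div_of_le (by positivity) ?_
  calc ((n : ℝ) + 1) * √((n : ℝ) + 1) * (((m : ℝ) + 1) * √((m : ℝ) + 1))
      = ((n : ℝ) + 1) * (((m : ℝ) + 1) * (1 * (√((n : ℝ) + 1) * √((m : ℝ) + 1)))) := by ring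
    _ ≤ _ := by gcongr

lemma summable_oddEvenTerm : Summable fun p : ℕ × ℕ => oddEvenTerm p.1 p.2 := by
  refine Summable.of_norm_bounded (summable_rpow_three_half.mul_of_nonneg summable_rpow_three_half
    (fun n => ?_) fun n => ?_) fun p => abs_oddEvenTerm_le p.1 p.2
  all_goals simp only [Pi.zero_apply]; positivity

lemma HasSum.of_tendsto {f : ℕ → ℝ} {a : ℝ} (hf : Summable f)
    (h : Tendsto (fun N => ∑ i ∈ range N, f i) atTop (𝓝 a)) : HasSum f a :=
  hf.hasSum_iff_tendsto_nat.2 h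

/-- The divergent parts of the three partial sums combine to H_M - 2h_M, up to index shifts that
tend to 0; this is the source of -2 log 2. -/
lemma hasSum_oddEvenTerm_left (m : ℕ) : HasSum (fun n => oddEvenTerm n m)
    ((-1) ^ m / (2 * m + 1) ^ 3 *
      (2 * oddHarmonic m + 1 / (2 * m + 1) - 2 * Real.log 2)) := by
  refine HasSum.of_tendsto (summable_oddEvenTerm.prod_symm.prod_factor m) ?_
  -- Partial sums of length M + m make the denominators 2n+1-2m run from -(2m-1) to 2M-1, so that
  -- their sum is exactly h_M - h_m.
  rw [← tendsto_add_atTop_iff_nat m]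
  have h := ((((tendsto_add_atTop_iff_nat m).2 tendsto_harm_sub_two_mul_oddHarmonic).add
    ((tendsto_oddHarmonic_add_sub m).const_mul 2)).sub
    (tendsto_oddHarmonic_add_sub (2 * m + 1))).add_const (oddHarmonic m + oddHarmonic (m + 1))
  have h' := h.const_mul ((-1 : ℝ) ^ m / (2 * m + 1) ^ 3)
  have e : (-1 : ℝ) ^ m / (2 * m + 1) ^ 3 * (-2 * Real.log 2 + 2 * 0 - 0 +
      (oddHarmonic m + oddHarmonic (m + 1))) = (-1) ^ m / (2 * m + 1) ^ 3 *
      (2 * oddHarmonic m + 1 / (2 * m + 1) - 2 * Real.log 2) := by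
    rw [oddHarmonic_succ]; ring
  rw [e] at h'
  refine h'.congr fun M => ?_
  have e1 : ∀ n : ℕ, oddEvenTerm n m = (-1) ^ m / (2 * m + 1) ^ 3 *
      (1 / ((n : ℝ) + 1) - 1 / (2 * (n : ℝ) + 1 - 2 * m) -
        1 / (2 * (n : ℝ) + 1 + 2 * (m + 1 : ℕ))) := by
    intro n
    have h1 := two_mul_add_one_sq_sub_ne_zero m n
    rw [oddEvenTerm, div_eq_mul_one_div, partialFraction_cube (by positivity) (by positivity) h1
      (by positivity)]
    rw [show (2 * (m : ℝ) + 1) - 2 * ((n : ℝ) + 1) = -(2 * (n : ℝ) + 1 - 2 * m) by ring,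
      one_div_neg_eq_neg_one_div]
    push_cast
    ring_nf
  simp_rw [e1]
  rw [← mul_sum, sum_sub_distrib, sum_sub_distrib, sum_range_inv_add, add_comm M m,
    sum_range_inv_sub, ← harm]
  rw [show m + 1 + (m + M) = M + (2 * m + 1) by ring, add_comm m M]
  ring

/-- Shifting Leibniz's series by 2n costs the sign (-1)^n. The negative denominators on the left
reflect to a partial Leibniz sum, which cancels the piece missing on the right, so two full copies
of π/4 remain. -/
lemma tendsto_sum_leibniz_shift (n : ℕ) :
    Tendsto (fun N => ∑ m ∈ range N, ((-1 : ℝ) ^ m / (2 * (m : ℝ) + 1 - 2 * n) +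
      (-1 : ℝ) ^ m / (2 * (m : ℝ) + 1 + 2 * n))) atTop (𝓝 ((-1) ^ n * (Real.pi / 2))) := by
  have h := Real.tendsto_sum_pi_div_four
  rw [← tendsto_add_atTop_iff_nat n]
  have h' := (h.add ((tendsto_add_atTop_iff_nat (2 * n)).2 h)).const_mul ((-1 : ℝ) ^ n)
  rw [show Real.pi / 4 + Real.pi / 4 = Real.pi / 2 by ring] at h'
  refine h'.congr fun N => ?_
  have hn : ((-1 : ℝ) ^ n) * (-1) ^ n = 1 := by rw [← pow_add, (Even.add_self n).neg_one_pow]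
  have h1 : ∑ m ∈ range (n + N), (-1 : ℝ) ^ m / (2 * (m : ℝ) + 1 - 2 * n) = (-1) ^ n *
      (∑ i ∈ range n, (-1 : ℝ) ^ i / (2 * i + 1) + ∑ i ∈ range N, (-1 : ℝ) ^ i / (2 * i + 1)) := by
    rw [sum_range_add, ← sum_range_reflect, mul_add, mul_sum, mul_sum]
    congr 1
    · refine sum_congr rfl fun i hi => ?_
      have hi := mem_range.1 hi
      have e : (-1 : ℝ) ^ (n - 1 - i) = -((-1) ^ n * (-1) ^ i) := by
        have : (-1 : ℝ) ^ n = (-1) ^ (n - 1 - i) * (-1) ^ i * (-1) := by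
          rw [← pow_add, ← pow_succ]; congr 1; omega
        rw [this]
        have h2 : ((-1 : ℝ) ^ i) * (-1) ^ i = 1 := by rw [← pow_add, (Even.add_self i).neg_one_pow]
        linear_combination (-(-1 : ℝ) ^ (n - 1 - i)) * h2
      rw [e, Nat.sub_sub, Nat.cast_sub (by omega)]
      push_cast
      rw [show 2 * ((n : ℝ) - (1 + i)) + 1 - 2 * n = -(2 * i + 1) by ring, neg_div_neg_eq]
      ring
    · refine sum_congr rfl fun i _ => ?_
      rw [pow_add]; push_cast
      rw [show 2 * ((n : ℝ) + i) + 1 - 2 * n = 2 * i + 1 by ring]; ring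
  have h2 : ∑ m ∈ range (N + n), (-1 : ℝ) ^ m / (2 * (m : ℝ) + 1 + 2 * n) = (-1) ^ n *
      (∑ i ∈ range (N + 2 * n), (-1 : ℝ) ^ i / (2 * i + 1) -
        ∑ i ∈ range n, (-1 : ℝ) ^ i / (2 * i + 1)) := by
    rw [show N + 2 * n = n + (N + n) by ring, sum_range_add _ n, add_sub_cancel_left, mul_sum]
    refine sum_congr rfl fun i _ => ?_
    rw [pow_add]; push_cast
    rw [show 2 * ((n : ℝ) + i) + 1 = 2 * i + 1 + 2 * n by ring]
    linear_combination (-((-1 : ℝ) ^ i / (2 * i + 1 + 2 * n))) * hn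
  rw [sum_add_distrib, h2, add_comm N n, h1]
  ring

lemma hasSum_oddEvenTerm_right (n : ℕ) : HasSum (oddEvenTerm n)
    (Real.pi / 16 * ((-1) ^ (n + 1) - 1) * (1 / ((n : ℝ) + 1) ^ 3)) := by
  refine HasSum.of_tendsto (summable_oddEvenTerm.prod_factor n) ?_
  have h := (((tendsto_sum_leibniz_shift (n + 1)).div_const 2).sub
    Real.tendsto_sum_pi_div_four).const_mul (1 / (4 * ((n : ℝ) + 1) ^ 3))
  have e : 1 / (4 * ((n : ℝ) + 1) ^ 3) * ((-1) ^ (n + 1) * (Real.pi / 2) / 2 - Real.pi / 4) =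
      Real.pi / 16 * ((-1) ^ (n + 1) - 1) * (1 / ((n : ℝ) + 1) ^ 3) := by
    field_simp; ring
  rw [e] at h
  refine h.congr fun N => ?_
  rw [sum_div, ← sum_sub_distrib, mul_sum]
  refine sum_congr rfl fun m _ => ?_
  have h1 := two_mul_add_one_sq_sub_ne_zero m n
  rw [oddEvenTerm, div_eq_mul_one_div _ (((n : ℝ) + 1) * _), partialFraction_sq (by positivity)
    (by positivity) h1 (by positivity)]
  push_cast
  rw [show 2 * (m : ℝ) + 1 - 2 * (n + 1) = 2 * m + 1 - 2 * n - 2 by ring]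
  ring

/-- With S the sum sought, the two orders of summation give 2S + β(4) - (π³/16) log 2 =
(π/16)(Li_3(-1) - ζ(3)) = -(7π/64) ζ(3). -/
lemma hasSum_oddHarmonic_div_odd_cube :
    HasSum (fun m : ℕ => (-1) ^ m * oddHarmonic m / (2 * (m : ℝ) + 1) ^ 3)
      (-(7 * Real.pi / 64 * zetaReal 3 + dirichletBeta 4 - Real.pi ^ 3 * Real.log 2 / 16) / 2) := by
  have hs : Summable fun m : ℕ => (-1) ^ m * oddHarmonic m / (2 * (m : ℝ) + 1) ^ 3 := by
    refine summable_of_le_harm_div_sq 1 fun m => ?_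
    rw [abs_div, abs_mul, abs_pow, abs_neg, abs_one, one_pow, one_mul,
      abs_of_nonneg (oddHarmonic_nonneg m), abs_of_pos (by positivity), one_mul]
    have h1 : oddHarmonic m ≤ harm (m + 1) := (oddHarmonic_le_harm m).trans (harm_mono (by omega))
    have h2 : ((m : ℝ) + 1) ^ 2 ≤ (2 * (m : ℝ) + 1) ^ 3 := by
      have : (0 : ℝ) ≤ m := by positivity
      calc ((m : ℝ) + 1) ^ 2 ≤ (2 * (m : ℝ) + 1) ^ 2 := by gcongr; linarith
        _ ≤ (2 * (m : ℝ) + 1) ^ 3 := pow_le_pow_right₀ (by linarith) (by norm_num)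
    have := harm_nonneg (m + 1)
    gcongr
  have hb : HasSum (fun m : ℕ => (-1 : ℝ) ^ m / (2 * (m : ℝ) + 1) ^ 4) (dirichletBeta 4) := by
    refine Summable.hasSum (Summable.of_norm ?_)
    refine (hasSum_one_div_odd_pow (s := 4) (by norm_num)).summable.congr fun m => ?_
    rw [norm_div, norm_pow, norm_neg, norm_one, one_pow, Real.norm_of_nonneg (by positivity)]
  have hprod := summable_oddEvenTerm
  have e1 := (hprod.hasSum.prod_fiberwise hasSum_oddEvenTerm_right)
  have hsw : HasSum (fun p : ℕ × ℕ => oddEvenTerm p.2 p.1) (∑' p : ℕ × ℕ, oddEvenTerm p.1 p.2) :=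
    (Equiv.prodComm ℕ ℕ).hasSum_iff.2 hprod.hasSum
  have e2 := hsw.prod_fiberwise hasSum_oddEvenTerm_left
  have hz := hasSum_zetaReal (s := 3) (by norm_num)
  have ha : HasSum (fun n : ℕ => (-1 : ℝ) ^ (n + 1) / ((n : ℝ) + 1) ^ 3) (pl 3 (-1 : ℝ)) :=
    hasSum_pl (by norm_num) (by simp)
  have e3 := e1.unique (((ha.sub hz).mul_left (Real.pi / 16)).congr_fun fun n => by ring)
  have e4 := e2.unique ((((hs.hasSum.mul_left 2).add hb).sub
    (hasSum_dirichletBeta_three.mul_left (2 * Real.log 2))).congr_fun fun m => by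
      field_simp)
  rw [pl_neg_one (by norm_num)] at e3
  refine hs.hasSum.congr_both ?_ fun _ => rfl
  rw [e3] at e4
  linarith

/-! ### The conditionally convergent sums -/

lemma hasSum_arctan_sq {x : ℝ} (hx : x ∈ Set.Ioo (0 : ℝ) 1) :
    HasSum (fun n : ℕ => (-1) ^ n * (oddHarmonic (n + 1) / ((n : ℝ) + 1)) * x ^ (2 * n + 2))
      (Real.arctan x ^ 2) := by
  have hx1 : ‖x‖ < 1 := by rw [Real.norm_of_nonneg hx.1.le]; exact hx.2
  have h1 : HasSum (fun n : ℕ => (-1) ^ n / (2 * (n : ℝ) + 1) * x ^ (2 * n + 1))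
      (Real.arctan x) := by
    refine (Real.hasSum_arctan hx1).congr_fun fun n => ?_
    push_cast; ring
  have n1 : ∀ n : ℕ, ‖(-1 : ℝ) ^ n / (2 * (n : ℝ) + 1)‖ ≤ 1 := fun n => by
    rw [norm_div, norm_pow, norm_neg, norm_one, one_pow, Real.norm_of_nonneg (by positivity)]
    exact div_le_one_of_le₀ (by linarith [n.cast_nonneg (α := ℝ)]) (by positivity)
  have hn := summable_norm_mul_pow (e := fun n => 2 * n + 1) hx1 n1 (fun n => by omega)
  have h := hasSum_cauchyProduct h1 h1 hn hn
  rw [← sq] at h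
  refine h.congr_fun fun n => ?_
  rw [← sum_antidiagonal_inv_mul_inv_odd, mul_sum, sum_mul]
  refine sum_congr rfl fun p hp => ?_
  rw [← mem_antidiagonal.1 hp]
  ring

/-- The inequality reduces to (n+1)/(2n+3) ≤ h_{n+1}, and each of the n+1 summands of h_{n+1} is at
least 1/(2n+3). -/
lemma antitone_oddHarmonic_div : Antitone fun n : ℕ => oddHarmonic (n + 1) / ((n : ℝ) + 1) := by
  refine antitone_nat_of_succ_le fun n => ?_
  have h : ((n : ℝ) + 1) / (2 * ((n + 1 : ℕ) : ℝ) + 1) ≤ oddHarmonic (n + 1) := by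
    rw [oddHarmonic_eq_sum]
    calc ((n : ℝ) + 1) / (2 * ((n + 1 : ℕ) : ℝ) + 1)
        = ∑ i ∈ range (n + 1), 1 / (2 * ((n + 1 : ℕ) : ℝ) + 1) := by
          rw [sum_const, card_range, nsmul_eq_mul]; push_cast; ring
      _ ≤ _ := by
        refine sum_le_sum fun i hi => ?_
        have : (i : ℝ) ≤ (n + 1 : ℕ) := by exact_mod_cast (mem_range.1 hi).le
        gcongr
  rw [oddHarmonic_succ (n + 1), div_le_div_iff₀ (by positivity) (by positivity)]
  rw [div_le_iff₀ (by positivity)] at h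
  have e : (oddHarmonic (n + 1) + 1 / (2 * ((n + 1 : ℕ) : ℝ) + 1)) * ((n : ℝ) + 1) =
      oddHarmonic (n + 1) * (n + 1) + ((n : ℝ) + 1) / (2 * ((n + 1 : ℕ) : ℝ) + 1) := by ring
  have h' : ((n : ℝ) + 1) / (2 * ((n + 1 : ℕ) : ℝ) + 1) ≤ oddHarmonic (n + 1) := by
    rwa [div_le_iff₀ (by positivity)]
  rw [e]
  push_cast at h' ⊢
  linarith

lemma tendsto_oddHarmonic_div :
    Tendsto (fun n : ℕ => oddHarmonic (n + 1) / ((n : ℝ) + 1)) atTop (𝓝 0) := by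
  have h : Tendsto (fun n : ℕ => 2 * (1 / √((n : ℝ) + 1))) atTop (𝓝 0) := by
    have h1 : Tendsto (fun n : ℕ => √((n : ℝ) + 1)) atTop atTop :=
      Real.tendsto_sqrt_atTop.comp (tendsto_atTop_add_const_right _ _ tendsto_natCast_atTop_atTop)
    simpa using (h1.inv_tendsto_atTop).const_mul 2
  refine squeeze_zero (fun n => div_nonneg (oddHarmonic_nonneg _) (by positivity)) (fun n => ?_) h
  have h1 := (oddHarmonic_le_harm (n + 1)).trans (harm_le_sqrt (n + 1))
  push_cast at h1
  rw [div_le_iff₀ (by positivity)]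
  refine h1.trans (le_of_eq ?_)
  have h2 := Real.mul_self_sqrt (show (0 : ℝ) ≤ (n : ℝ) + 1 by positivity)
  have h3 : √((n : ℝ) + 1) ≠ 0 := by positivity
  field_simp
  linarith

/-- `∑ (-1)^{n+1} h_n / n = π²/16`, as a limit of partial sums. -/
lemma tendsto_sum_alternating_oddHarmonic_div :
    Tendsto (fun N => ∑ n ∈ range N, (-1 : ℝ) ^ n * (oddHarmonic (n + 1) / ((n : ℝ) + 1))) atTop
      (𝓝 (Real.pi ^ 2 / 16)) := by
  -- Leibniz's criterion supplies some limit; Abel's theorem then identifies it with the value at z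
  -- → 1 of arctan²(√z)/z, where z stands for x².
  obtain ⟨l, hl⟩ :=
    antitone_oddHarmonic_div.tendsto_alternating_series_of_tendsto_zero tendsto_oddHarmonic_div
  have hA := Real.tendsto_tsum_powerSeries_nhdsWithin_lt hl
  have hB : Tendsto (fun z : ℝ => Real.arctan √z ^ 2 / z) (𝓝[<] 1) (𝓝 (Real.pi ^ 2 / 16)) := by
    have hc : ContinuousAt (fun z : ℝ => Real.arctan √z ^ 2 / z) 1 := by
      refine ContinuousAt.div (Continuous.continuousAt ?_) continuousAt_id one_ne_zero
      exact (Real.continuous_arctan.comp Real.continuous_sqrt).pow 2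
    have := hc.tendsto.mono_left (nhdsWithin_le_nhds (s := Set.Iio 1))
    simp only [Real.sqrt_one, Real.arctan_one] at this
    convert this using 2
    ring
  have e : l = Real.pi ^ 2 / 16 := by
    refine tendsto_nhds_unique hA (hB.congr' ?_)
    filter_upwards [Ioo_mem_nhdsLT (zero_lt_one (α := ℝ))] with z hz
    have hz' : √z ∈ Set.Ioo (0 : ℝ) 1 := ⟨Real.sqrt_pos.2 hz.1, by
      rw [Real.sqrt_lt' one_pos]; simpa using hz.2⟩
    have h := (hasSum_arctan_sq hz').div_const z
    rw [← h.tsum_eq]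
    refine tsum_congr fun n => ?_
    have h2 := Real.sq_sqrt hz.1.le
    rw [show 2 * n + 2 = 2 * (n + 1) by ring, pow_mul, h2, pow_succ]
    have := hz.1.ne'
    field_simp
  rwa [← e]

/-- Integration by parts leaves ∫ log(1+t²)/(1+t²) dt, already known from ∫ `logCos`. -/
lemma integral_arctan_sq :
    ∫ x in (0 : ℝ)..1, Real.arctan x ^ 2 =
      Real.pi ^ 2 / 16 + Real.pi * Real.log 2 / 4 - catalanG := by
  have hpos : ∀ x : ℝ, 1 + x ^ 2 ≠ 0 := fun x => by positivity
  have hc : Continuous fun x : ℝ => Real.log (1 + x ^ 2) / (1 + x ^ 2) :=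
    ((by fun_prop : Continuous fun x : ℝ => 1 + x ^ 2).log hpos).div (by fun_prop) hpos
  have hc2 : Continuous fun x : ℝ => Real.arctan x ^ 2 := Real.continuous_arctan.pow 2
  have h := intervalIntegral.integral_eq_sub_of_hasDerivAt (a := 0) (b := 1)
    (f := fun x => x * Real.arctan x ^ 2 - Real.log (1 + x ^ 2) * Real.arctan x)
    (f' := fun x => Real.arctan x ^ 2 - Real.log (1 + x ^ 2) / (1 + x ^ 2)) (fun x _ => ?_)
    ((hc2.sub hc).intervalIntegrable _ _)
  · rw [intervalIntegral.integral_sub (hc2.intervalIntegrable _ _) (hc.intervalIntegrable _ _),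
      integral_log_one_add_sq_div] at h
    simp only [Real.arctan_one, Real.arctan_zero] at h
    norm_num at h
    linarith
  · have ha := Real.hasDerivAt_arctan x
    have hl := ((hasDerivAt_pow 2 x).const_add 1).log (hpos x)
    refine (((hasDerivAt_id x).mul (ha.pow 2)).sub (hl.mul ha)).congr_deriv ?_
    have := hpos x
    simp only [id, Pi.pow_apply]
    push_cast
    field_simp
    ring

lemma summable_oddHarmonic_div_mul :
    Summable fun n : ℕ => oddHarmonic (n + 1) / (((n : ℝ) + 1) * (2 * n + 3)) := by
  refine summable_of_le_harm_div_sq 1 fun n => ?_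
  rw [abs_of_nonneg (div_nonneg (oddHarmonic_nonneg _) (by positivity)), one_mul]
  have := oddHarmonic_le_harm (n + 1)
  have h2 : ((n : ℝ) + 1) ^ 2 ≤ ((n : ℝ) + 1) * (2 * n + 3) := by
    rw [sq]; exact mul_le_mul_of_nonneg_left (by linarith [n.cast_nonneg (α := ℝ)]) (by positivity)
  have := harm_nonneg (n + 1)
  gcongr

/-- `∑ (-1)^{n+1} h_n / (n (2n+1))`. -/
lemma hasSum_oddHarmonic_div_mul :
    HasSum (fun n : ℕ => (-1 : ℝ) ^ n * (oddHarmonic (n + 1) / (((n : ℝ) + 1) * (2 * n + 3))))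
      (Real.pi ^ 2 / 16 + Real.pi * Real.log 2 / 4 - catalanG) := by
  have h := hasSum_integral_mul_weight (ω := fun _ => 1) (m := fun k => 1 / ((k : ℝ) + 1))
    (c := fun n => (-1) ^ n * (oddHarmonic (n + 1) / ((n : ℝ) + 1))) (e := fun n => 2 * n + 2)
    (fun _ _ => zero_le_one) (fun k => Continuous.intervalIntegrable (by fun_prop) _ _)
    (fun k => by simp [integral_pow]) (fun x hx => hasSum_arctan_sq hx) ?_
  · simp only [mul_one, integral_arctan_sq] at h
    refine h.congr_fun fun n => ?_
    push_cast
    rw [show 2 * (n : ℝ) + 2 + 1 = 2 * n + 3 by ring, mul_assoc, div_mul_div_comm, mul_one]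
  · refine summable_oddHarmonic_div_mul.congr fun n => ?_
    rw [abs_mul, abs_pow, abs_neg, abs_one, one_pow, one_mul,
      abs_of_nonneg (div_nonneg (oddHarmonic_nonneg _) (by positivity))]
    push_cast
    rw [show 2 * (n : ℝ) + 2 + 1 = 2 * n + 3 by ring, div_mul_div_comm, mul_one]

/-! ### Series for the polygamma functions -/

lemma hasDerivAt_log_Gamma {x : ℝ} (hx : 0 < x) :
    HasDerivAt (Real.log ∘ Real.Gamma) (polygamma 0 x) x := by
  have h : ∀ m : ℕ, x ≠ -m := fun m => by
    have : (0 : ℝ) ≤ m := m.cast_nonneg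
    linarith
  exact (Real.differentiableAt_Gamma h).hasDerivAt.log (Real.Gamma_pos_of_pos hx).ne'

lemma log_Gamma_add_one {x : ℝ} (hx : 0 < x) :
    (Real.log ∘ Real.Gamma) (x + 1) = (Real.log ∘ Real.Gamma) x + Real.log x := by
  simp only [Function.comp_apply]
  rw [Real.Gamma_add_one hx.ne', Real.log_mul hx.ne' (Real.Gamma_pos_of_pos hx).ne', add_comm]

lemma polygamma_zero_add_one {x : ℝ} (hx : 0 < x) :
    polygamma 0 (x + 1) = polygamma 0 x + 1 / x := by
  have h1 : HasDerivAt (fun y => (Real.log ∘ Real.Gamma) (y + 1)) (polygamma 0 (x + 1)) x :=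
    (hasDerivAt_log_Gamma (by linarith)).comp_add_const x 1
  have h2 := (hasDerivAt_log_Gamma hx).add (Real.hasDerivAt_log hx.ne')
  rw [one_div]
  refine h1.unique (h2.congr_of_eventuallyEq ?_)
  filter_upwards [eventually_gt_nhds hx] with y hy using log_Gamma_add_one hy

/-- The chord of log Γ over [x, x+1] has slope log x, so convexity traps log x between ψ(x) and
ψ(x+1). These bounds make ψ(x+N) - log N tend to 0, which yields the series for differences of ψ. -/
lemma slope_log_Gamma {x : ℝ} (hx : 0 < x) :
    slope (Real.log ∘ Real.Gamma) x (x + 1) = Real.log x := by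
  rw [slope_def_field, log_Gamma_add_one hx, add_sub_cancel_left, add_sub_cancel_left, div_one]

lemma polygamma_zero_le_log {x : ℝ} (hx : 0 < x) : polygamma 0 x ≤ Real.log x := by
  rw [← slope_log_Gamma hx]
  exact Real.convexOn_log_Gamma.le_slope_of_hasDerivAt (Set.mem_Ioi.2 hx)
    (Set.mem_Ioi.2 (by linarith)) (by linarith) (hasDerivAt_log_Gamma hx)

lemma log_sub_le_polygamma_zero {x : ℝ} (hx : 0 < x) : Real.log x - 1 / x ≤ polygamma 0 x := by
  rw [sub_le_iff_le_add, ← polygamma_zero_add_one hx, ← slope_log_Gamma hx]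
  exact Real.convexOn_log_Gamma.slope_le_of_hasDerivAt (Set.mem_Ioi.2 hx)
    (Set.mem_Ioi.2 (by linarith)) (by linarith) (hasDerivAt_log_Gamma (by linarith))

lemma polygamma_zero_add_natCast {x : ℝ} (hx : 0 < x) (N : ℕ) :
    polygamma 0 (x + N) = polygamma 0 x + ∑ i ∈ range N, 1 / ((i : ℝ) + x) := by
  induction N with
  | zero => simp
  | succ N ih =>
    push_cast
    rw [← add_assoc, polygamma_zero_add_one (by positivity), ih, sum_range_succ, add_comm x (N : ℝ)]
    ring

lemma tendsto_one_div_add_natCast (x : ℝ) :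
    Tendsto (fun N : ℕ => 1 / (x + N)) atTop (𝓝 0) := by
  simp only [one_div]
  exact (tendsto_atTop_add_const_left _ _ tendsto_natCast_atTop_atTop).inv_tendsto_atTop

lemma tendsto_polygamma_zero_sub_log {x : ℝ} (hx : 0 < x) :
    Tendsto (fun N : ℕ => polygamma 0 (x + N) - Real.log (x + N)) atTop (𝓝 0) := by
  refine tendsto_of_tendsto_of_tendsto_of_le_of_le (g := fun N : ℕ => -(1 / (x + N)))
    (h := fun _ => 0) ?_ tendsto_const_nhds (fun N => ?_) fun N => ?_
  · simpa using (tendsto_one_div_add_natCast x).neg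
  · have := log_sub_le_polygamma_zero (x := x + N) (by positivity)
    simp only; linarith
  · have := polygamma_zero_le_log (x := x + N) (by positivity)
    simp only; linarith

lemma tendsto_log_add_natCast_sub {x : ℝ} (hx : 0 < x) :
    Tendsto (fun N : ℕ => Real.log (x + N) - Real.log N) atTop (𝓝 0) := by
  have h : Tendsto (fun N : ℕ => Real.log (1 + x / N)) atTop (𝓝 0) := by
    have h1 : Tendsto (fun N : ℕ => 1 + x / (N : ℝ)) atTop (𝓝 1) := by
      simpa using (tendsto_const_div_atTop_nhds_zero_nat x).const_add 1
    simpa using h1.log one_ne_zero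
  refine h.congr' ?_
  filter_upwards [eventually_gt_atTop 0] with N hN
  have hN : (0 : ℝ) < N := by exact_mod_cast hN
  rw [← Real.log_div (by positivity) (by positivity)]
  congr 1
  field_simp
  ring

lemma tendsto_sum_polygamma_zero {x y : ℝ} (hx : 0 < x) (hy : 0 < y) :
    Tendsto (fun N => ∑ i ∈ range N, (1 / ((i : ℝ) + y) - 1 / ((i : ℝ) + x))) atTop
      (𝓝 (polygamma 0 x - polygamma 0 y)) := by
  have h := (((tendsto_polygamma_zero_sub_log hy).add (tendsto_log_add_natCast_sub hy)).sub
    ((tendsto_polygamma_zero_sub_log hx).add (tendsto_log_add_natCast_sub hx))).add_const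
      (polygamma 0 x - polygamma 0 y)
  simp only [add_zero, sub_zero, zero_add] at h
  refine h.congr fun N => ?_
  rw [polygamma_zero_add_natCast hx, polygamma_zero_add_natCast hy, sum_sub_distrib]
  ring

lemma summable_one_div_add_pow {δ : ℝ} (hδ : 0 < δ) {s : ℕ} (hs : 2 ≤ s) :
    Summable fun n : ℕ => 1 / ((n : ℝ) + δ) ^ s := by
  refine ((Real.summable_one_div_nat_add_rpow δ s).2 (by exact_mod_cast hs)).congr fun n => ?_
  rw [abs_of_pos (by positivity), Real.rpow_natCast]

lemma summable_one_div_sub_one_div {x y : ℝ} (hx : 0 < x) (hy : 0 < y) :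
    Summable fun n : ℕ => 1 / ((n : ℝ) + y) - 1 / ((n : ℝ) + x) := by
  have hm : 0 < min x y := lt_min hx hy
  refine Summable.of_norm_bounded ((summable_one_div_add_pow hm le_rfl).mul_left |x - y|)
    fun n => ?_
  have : 1 / ((n : ℝ) + y) - 1 / ((n : ℝ) + x) = (x - y) * (1 / (((n : ℝ) + y) * (n + x))) := by
    field_simp; ring
  rw [this, norm_mul, Real.norm_eq_abs, Real.norm_of_nonneg (by positivity), sq]
  gcongr
  · exact min_le_right _ _
  · exact min_le_left _ _

lemma hasSum_polygamma_zero {x y : ℝ} (hx : 0 < x) (hy : 0 < y) :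
    HasSum (fun n : ℕ => 1 / ((n : ℝ) + y) - 1 / ((n : ℝ) + x)) (polygamma 0 x - polygamma 0 y) :=
  HasSum.of_tendsto (summable_one_div_sub_one_div hx hy) (tendsto_sum_polygamma_zero hx hy)

lemma polygamma_succ (n : ℕ) (x : ℝ) : polygamma (n + 1) x = deriv (polygamma n) x := by
  rw [polygamma, iteratedDeriv_succ]; rfl

lemma hasDerivAt_one_div_add_pow (n s : ℕ) {x : ℝ} (hx : 0 < x) :
    HasDerivAt (fun y : ℝ => 1 / ((n : ℝ) + y) ^ s) (-s * (1 / ((n : ℝ) + x) ^ (s + 1))) x := by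
  have h1 : HasDerivAt (fun y : ℝ => ((n : ℝ) + y) ^ s) (s * ((n : ℝ) + x) ^ (s - 1) * 1) x :=
    ((hasDerivAt_id x).const_add (n : ℝ)).pow s
  have h2 : ((n : ℝ) + x) ^ s ≠ 0 := by positivity
  simp only [one_div]
  refine (h1.inv h2).congr_deriv ?_
  rcases s with _ | s
  · simp
  · simp only [Nat.add_sub_cancel]
    have h3 : (n : ℝ) + x ≠ 0 := by positivity
    field_simp
    ring

lemma norm_neg_mul_one_div_le (n s : ℕ) {x y : ℝ} (hx : 0 < x) (hy : y ∈ Set.Ioi (x / 2)) :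
    ‖-(s : ℝ) * (1 / ((n : ℝ) + y) ^ (s + 1))‖ ≤ s * (1 / ((n : ℝ) + x / 2) ^ (s + 1)) := by
  have hy : x / 2 < y := hy
  have : 0 < y := by linarith
  rw [norm_mul, norm_neg, Real.norm_of_nonneg (by positivity), Real.norm_of_nonneg (by positivity)]
  gcongr

/-- What is differentiated termwise is the series for ψ(y) - ψ(x), with x as fixed reference point;
the half-line y > x/2 gives a uniform majorant. -/
lemma hasDerivAt_polygamma_zero {x : ℝ} (hx : 0 < x) :
    HasDerivAt (polygamma 0) (∑' n : ℕ, 1 / ((n : ℝ) + x) ^ 2) x := by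
  have hd : ∀ (n : ℕ) (y : ℝ), y ∈ Set.Ioi (x / 2) → HasDerivAt
      (fun z => 1 / ((n : ℝ) + x) - 1 / ((n : ℝ) + z)) (1 / ((n : ℝ) + y) ^ 2) y := by
    intro n y hy
    have h := (hasDerivAt_one_div_add_pow n 1 ((half_pos hx).trans hy)).const_sub
      (1 / ((n : ℝ) + x))
    simpa using h
  have hb : ∀ (n : ℕ) (y : ℝ), y ∈ Set.Ioi (x / 2) →
      ‖1 / ((n : ℝ) + y) ^ 2‖ ≤ 1 / ((n : ℝ) + x / 2) ^ 2 := by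
    intro n y hy
    simpa using norm_neg_mul_one_div_le n 1 hx hy
  have h0 : Summable fun n : ℕ => 1 / ((n : ℝ) + x) - 1 / ((n : ℝ) + x) := by
    simp only [sub_self]; exact summable_zero
  have h := hasDerivAt_tsum_of_isPreconnected (summable_one_div_add_pow (half_pos hx) le_rfl)
    isOpen_Ioi isPreconnected_Ioi hd hb (Set.mem_Ioi.2 (half_lt_self hx)) h0
    (Set.mem_Ioi.2 (half_lt_self hx))
  refine (h.add_const (polygamma 0 x)).congr_of_eventuallyEq ?_
  filter_upwards [eventually_gt_nhds hx] with y hy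
  rw [(hasSum_polygamma_zero hy hx).tsum_eq]
  ring

lemma polygamma_one {x : ℝ} (hx : 0 < x) : polygamma 1 x = ∑' n : ℕ, 1 / ((n : ℝ) + x) ^ 2 := by
  rw [polygamma_succ 0, (hasDerivAt_polygamma_zero hx).deriv]

lemma hasSum_polygamma_one {x : ℝ} (hx : 0 < x) :
    HasSum (fun n : ℕ => 1 / ((n : ℝ) + x) ^ 2) (polygamma 1 x) := by
  rw [polygamma_one hx]
  exact (summable_one_div_add_pow hx le_rfl).hasSum

lemma hasDerivAt_polygamma_one {x : ℝ} (hx : 0 < x) :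
    HasDerivAt (polygamma 1) (∑' n : ℕ, -(2 : ℕ) * (1 / ((n : ℝ) + x) ^ (2 + 1))) x := by
  have h := hasDerivAt_tsum_of_isPreconnected (𝕜 := ℝ) (t := Set.Ioi (x / 2))
    (u := fun n : ℕ => (2 : ℕ) * (1 / ((n : ℝ) + x / 2) ^ (2 + 1)))
    (g := fun n y => 1 / ((n : ℝ) + y) ^ 2)
    (g' := fun n y => -(2 : ℕ) * (1 / ((n : ℝ) + y) ^ (2 + 1)))
    ((summable_one_div_add_pow (half_pos hx) (by norm_num)).mul_left _) isOpen_Ioi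
    isPreconnected_Ioi
    (fun n y hy => hasDerivAt_one_div_add_pow n 2 ((half_pos hx).trans hy))
    (fun n y hy => norm_neg_mul_one_div_le n 2 hx hy)
    (y₀ := x) (half_lt_self hx) (summable_one_div_add_pow hx le_rfl) (half_lt_self hx)
  refine h.congr_of_eventuallyEq ?_
  filter_upwards [eventually_gt_nhds hx] with y hy using polygamma_one hy

lemma hasSum_polygamma_two {x : ℝ} (hx : 0 < x) :
    HasSum (fun n : ℕ => 1 / ((n : ℝ) + x) ^ 3) (-(polygamma 2 x) / 2) := by
  have hs := summable_one_div_add_pow hx (s := 3) (by norm_num)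
  rw [polygamma_succ 1, (hasDerivAt_polygamma_one hx).deriv, tsum_mul_left]
  refine hs.hasSum.congr_both ?_ fun _ => rfl
  push_cast; ring

lemma realHarmonic_sub (x y : ℝ) :
    realHarmonic x - realHarmonic y = polygamma 0 (x + 1) - polygamma 0 (y + 1) := by
  rw [realHarmonic, realHarmonic]; ring

/-! ### The auxiliary sums `∑ (-1)^n / ((2n+1) (2n+2+q)^p)` -/

/-- The difference of polygamma values `ψ^{(i)}((q+4)/4) - ψ^{(i)}((q+2)/4)`. -/
noncomputable def polygammaDiff (i : ℕ) (q : ℝ) : ℝ :=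
  polygamma i ((q + 4) / 4) - polygamma i ((q + 2) / 4)

/-- Summand of the auxiliary series. -/
noncomputable def auxTerm (p : ℕ) (q : ℝ) (n : ℕ) : ℝ :=
  (-1) ^ n / ((2 * (n : ℝ) + 1) * (2 * n + 2 + q) ^ p)

/-- The value of the auxiliary series with exponent one. -/
noncomputable def auxOne (q : ℝ) : ℝ := (Real.pi - polygammaDiff 0 q) / (4 * (q + 1))

/-- The value of the auxiliary series with exponent two. -/
noncomputable def auxTwo (q : ℝ) : ℝ := (auxOne q + polygammaDiff 1 q / 16) / (q + 1)

/-- The value of the auxiliary series with exponent three. -/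
noncomputable def auxThree (q : ℝ) : ℝ := (auxTwo q - polygammaDiff 2 q / 128) / (q + 1)

section ShiftedSums

variable {q : ℝ}

lemma summable_auxTerm {p : ℕ} (hp : 1 ≤ p) (hq : 0 ≤ q) : Summable (auxTerm p q) := by
  refine Summable.of_norm_bounded summable_one_div_two_mul_add_one_sq fun n => ?_
  have h0 : (0 : ℝ) ≤ n := n.cast_nonneg
  rw [auxTerm, norm_div, norm_pow, norm_neg, norm_one, one_pow, Real.norm_of_nonneg (by positivity),
    sq]
  have h1 : 2 * (n : ℝ) + 1 ≤ (2 * n + 2 + q) ^ p :=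
    (by linarith : 2 * (n : ℝ) + 1 ≤ 2 * n + 2 + q).trans
      (le_self_pow₀ (by linarith) (by omega))
  gcongr

/-- The two factors 2n+2+q and 2n+1 differ by q+1, so one partial fraction step lowers the exponent.
-/
lemma auxTerm_succ (p : ℕ) (hq : 0 ≤ q) (n : ℕ) :
    auxTerm (p + 1) q n = (auxTerm p q n - (-1) ^ n / (2 * (n : ℝ) + 2 + q) ^ (p + 1)) / (q + 1) := by
  rw [auxTerm, auxTerm]
  have : 2 * (n : ℝ) + 2 + q ≠ 0 := by positivity
  field_simp
  ring

lemma sum_range_two_mul (f : ℕ → ℝ) (N : ℕ) :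
    ∑ n ∈ range (2 * N), f n = ∑ i ∈ range N, (f (2 * i) + f (2 * i + 1)) := by
  induction N with
  | zero => simp
  | succ N ih => rw [show 2 * (N + 1) = 2 * N + 1 + 1 by ring, sum_range_succ, sum_range_succ, ih,
      sum_range_succ]; ring

lemma hasSum_auxOne (hq : 0 ≤ q) : HasSum (auxTerm 1 q) (auxOne q) := by
  have hs := summable_auxTerm le_rfl hq
  -- The pieces `auxTerm 0` and (-1)^n/(2n+2+q) converge only conditionally. Partial sums of even
  -- length are compared instead, pairing consecutive terms into the series for a difference of ψ.
  have h2 : Tendsto (fun N : ℕ => 2 * N) atTop atTop := tendsto_id.const_mul_atTop' (by norm_num)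
  have hA := hs.hasSum.tendsto_sum_nat.comp h2
  have hB := ((Real.tendsto_sum_pi_div_four.comp h2).sub ((tendsto_sum_polygamma_zero
    (x := (q + 4) / 4) (y := (q + 2) / 4) (by positivity) (by positivity)).div_const 4)).div_const
      (q + 1)
  have e : auxOne q = (Real.pi / 4 - (polygamma 0 ((q + 4) / 4) - polygamma 0 ((q + 2) / 4)) / 4) /
      (q + 1) := by
    rw [auxOne, polygammaDiff]
    have : q + 1 ≠ 0 := by positivity
    field_simp
  rw [e]
  refine hs.hasSum.congr_both (tendsto_nhds_unique hB (hA.congr fun N => ?_)) fun _ => rfl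
  simp only [Function.comp_apply, auxTerm_succ 0 hq]
  rw [← sum_div, sum_sub_distrib]
  congr 2
  · exact sum_congr rfl fun n _ => by rw [auxTerm, pow_zero, mul_one]
  · rw [sum_range_two_mul, sum_div]
    refine sum_congr rfl fun i _ => ?_
    rw [pow_succ (-1 : ℝ), pow_mul]
    push_cast
    simp only [neg_one_sq, one_pow, pow_one]
    have h1 : 2 * (2 * (i : ℝ)) + 2 + q = 4 * (i + (q + 2) / 4) := by ring
    have h2 : 2 * (2 * (i : ℝ) + 1) + 2 + q = 4 * (i + (q + 4) / 4) := by ring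
    rw [h1, h2]
    generalize (i : ℝ) + (q + 2) / 4 = u
    generalize (i : ℝ) + (q + 4) / 4 = v
    ring

lemma hasSum_alternating_shift {p : ℕ} {f : ℝ → ℝ} (hq : 0 ≤ q)
    (hf : ∀ x : ℝ, 0 < x → HasSum (fun n : ℕ => 1 / ((n : ℝ) + x) ^ p) (f x)) :
    HasSum (fun n : ℕ => (-1) ^ n / (2 * (n : ℝ) + 2 + q) ^ p)
      ((f ((q + 2) / 4) - f ((q + 4) / 4)) / 4 ^ p) := by
  have h1 := (hf ((q + 2) / 4) (by positivity)).div_const (4 ^ p)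
  have h2 := (hf ((q + 4) / 4) (by positivity)).neg.div_const (4 ^ p)
  have h := HasSum.even_add_odd (f := fun n : ℕ => (-1) ^ n / (2 * (n : ℝ) + 2 + q) ^ p)
    (h1.congr_fun fun i => ?_) (h2.congr_fun fun i => ?_)
  · refine h.congr_both ?_ fun _ => rfl
    ring
  · push_cast
    rw [show 2 * (2 * (i : ℝ)) + 2 + q = 4 * (i + (q + 2) / 4) by ring, mul_pow, pow_mul, neg_one_sq,
      one_pow, div_div, mul_comm]
  · push_cast
    rw [show 2 * (2 * (i : ℝ) + 1) + 2 + q = 4 * (i + (q + 4) / 4) by ring, mul_pow, pow_succ,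
      pow_mul, neg_one_sq, one_pow, ← neg_div, div_div, mul_comm (4 ^ p : ℝ), one_mul]

lemma hasSum_auxTwo (hq : 0 ≤ q) : HasSum (auxTerm 2 q) (auxTwo q) := by
  refine (((hasSum_auxOne hq).sub (hasSum_alternating_shift hq
    (fun x hx => hasSum_polygamma_one hx))).div_const (q + 1)).congr_both ?_ (auxTerm_succ 1 hq)
  rw [auxTwo, polygammaDiff]; ring

lemma hasSum_auxThree (hq : 0 ≤ q) : HasSum (auxTerm 3 q) (auxThree q) := by
  refine (((hasSum_auxTwo hq).sub (hasSum_alternating_shift hq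
    (fun x hx => hasSum_polygamma_two hx))).div_const (q + 1)).congr_both ?_ (auxTerm_succ 2 hq)
  rw [auxThree, polygammaDiff]; ring

/-! ### Partial sums of shifted Euler sums -/

/-- Summand of the alternating Euler sum with shift `q` and exponent `p`. -/
noncomputable def shiftTerm (p : ℕ) (q : ℝ) (n : ℕ) : ℝ :=
  (-1) ^ n * (2 * oddHarmonic (n + 1)) / (2 * (n : ℝ) + 2 + q) ^ p

/-- Comes from h_{N+2} = h_{N+1} + 1/(2N+3). The additional initial terms at index 0 cancel, since
h_1 = 1. -/
lemma sum_shiftTerm_add_two (p : ℕ) (q : ℝ) (N : ℕ) :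
    ∑ n ∈ range N, shiftTerm p (q + 2) n =
      2 * ∑ n ∈ range (N + 1), auxTerm p q n - ∑ n ∈ range (N + 1), shiftTerm p q n := by
  induction N with
  | zero => simp [shiftTerm, auxTerm, oddHarmonic_succ, oddHarmonic_zero]; ring
  | succ N ih =>
    rw [sum_range_succ, ih, sum_range_succ _ (N + 1), sum_range_succ _ (N + 1)]
    have : shiftTerm p (q + 2) N = 2 * auxTerm p q (N + 1) - shiftTerm p q (N + 1) := by
      rw [shiftTerm, shiftTerm, auxTerm, oddHarmonic_succ (N + 1)]
      push_cast
      rw [show 2 * ((N : ℝ) + 1) + 2 + q = 2 * N + 2 + (q + 2) by ring, div_mul_eq_div_div, pow_succ]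
      ring
    rw [this]; ring

/-- Convergence of the partial sums of the shifted alternating Euler sum. -/
def ShiftSum (p : ℕ) (q L : ℝ) : Prop :=
  Tendsto (fun N => ∑ n ∈ range N, shiftTerm p q n) atTop (𝓝 L)

lemma ShiftSum.add_two {p : ℕ} {L r : ℝ} (h : ShiftSum p q L) (hr : HasSum (auxTerm p q) r) :
    ShiftSum p (q + 2) (2 * r - L) := by
  have h1 := ((tendsto_add_atTop_iff_nat 1).2 hr.tendsto_sum_nat).const_mul 2
  exact (h1.sub ((tendsto_add_atTop_iff_nat 1).2 h)).congr fun N => (sum_shiftTerm_add_two p q N).symm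

lemma sum_Icc_one_succ (f : ℕ → ℝ) (k : ℕ) :
    ∑ j ∈ Icc 1 (k + 1), f j = f 1 + ∑ j ∈ Icc 1 k, f (j + 1) := by
  induction k with
  | zero => simp
  | succ k ih => rw [sum_Icc_succ_top (by omega), ih, sum_Icc_succ_top (by omega)]; ring

/-- Unrolls the recurrence L ↦ 2R - L; the summand j = 1 belongs to the last step, j = k to the
first one, at q. -/
lemma ShiftSum.iterate {p : ℕ} {L : ℝ} {R : ℝ → ℝ} (hq : 0 ≤ q) (h : ShiftSum p q L)
    (hR : ∀ x, 0 ≤ x → HasSum (auxTerm p x) (R x)) (k : ℕ) :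
    ShiftSum p (q + 2 * k)
      (∑ j ∈ Icc 1 k, (-1) ^ (j + 1) * (2 * R (q + 2 * k - 2 * j)) + (-1) ^ k * L) := by
  induction k with
  | zero => simpa using h
  | succ k ih =>
    have h1 := ih.add_two (hR (q + 2 * k) (by positivity))
    rw [sum_Icc_one_succ]
    convert h1 using 1
    · push_cast; ring
    · push_cast
      rw [show q + 2 * ((k : ℝ) + 1) - 2 * 1 = q + 2 * k by ring, sub_add_eq_sub_sub,
        sub_eq_add_neg (2 * R (q + 2 * k)) (∑ j ∈ Icc 1 k, _), ← sum_neg_distrib, pow_succ (-1) k]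
      have : ∀ j ∈ Icc 1 k, (-1) ^ (j + 1 + 1) * (2 * R (q + 2 * ((k : ℝ) + 1) - 2 * ((j : ℝ) + 1))) =
          -((-1) ^ (j + 1) * (2 * R (q + 2 * k - 2 * j))) := by
        intro j _
        rw [show q + 2 * ((k : ℝ) + 1) - 2 * ((j : ℝ) + 1) = q + 2 * k - 2 * j by ring, pow_succ]
        ring
      rw [sum_congr rfl this]
      ring

lemma HasSum.shiftSum {p : ℕ} {L : ℝ} (h : HasSum (shiftTerm p q) L) : ShiftSum p q L :=
  h.tendsto_sum_nat

lemma shiftSum_one_zero : ShiftSum 1 0 (Real.pi ^ 2 / 16) := by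
  refine tendsto_sum_alternating_oddHarmonic_div.congr fun N => sum_congr rfl fun n _ => ?_
  rw [shiftTerm]
  field_simp
  ring

lemma shiftSum_one_one : ShiftSum 1 1 (catalanG - Real.pi * Real.log 2 / 4) := by
  have h := tendsto_sum_alternating_oddHarmonic_div.sub hasSum_oddHarmonic_div_mul.tendsto_sum_nat
  rw [show Real.pi ^ 2 / 16 - (Real.pi ^ 2 / 16 + Real.pi * Real.log 2 / 4 - catalanG) =
    catalanG - Real.pi * Real.log 2 / 4 by ring] at h
  refine h.congr fun N => ?_
  rw [← sum_sub_distrib]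
  refine sum_congr rfl fun n _ => ?_
  rw [shiftTerm, show 2 * (n : ℝ) + 2 + 1 = 2 * n + 3 by ring]
  field_simp
  ring

lemma shiftSum_zero {p : ℕ} {L : ℝ}
    (h : HasSum (fun n : ℕ => (-1) ^ n * oddHarmonic (n + 1) / ((n : ℝ) + 1) ^ p) L) :
    ShiftSum p 0 (2 / 2 ^ p * L) := by
  refine ((h.mul_left (2 / 2 ^ p)).congr_fun fun n => ?_).shiftSum
  rw [shiftTerm, show 2 * (n : ℝ) + 2 + 0 = 2 * (n + 1) by ring, mul_pow]
  field_simp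

/-- Re-indexing m = n + 1 changes the sign, and the term m = 0 is absent because h_0 = 0. -/
lemma shiftSum_one {p : ℕ} {L : ℝ}
    (h : HasSum (fun m : ℕ => (-1) ^ m * oddHarmonic m / (2 * (m : ℝ) + 1) ^ p) L) :
    ShiftSum p 1 (-2 * L) := by
  have h1 := (hasSum_nat_add_iff' 1).2 h
  simp only [range_one, sum_singleton, oddHarmonic_zero, mul_zero, zero_div, sub_zero] at h1
  refine ((h1.mul_left (-2)).congr_fun fun n => ?_).shiftSum
  rw [shiftTerm]
  push_cast
  rw [show 2 * ((n : ℝ) + 1) + 1 = 2 * n + 2 + 1 by ring, pow_succ]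
  ring

/-- The Euler sum of the theorem in terms of the shifted sums. -/
lemma hasSum_of_shiftSum {m L₁ L₂ L₃ : ℝ} (hm : 0 < m) (h1 : ShiftSum 1 m L₁) (h2 : ShiftSum 2 m L₂)
    (h3 : ShiftSum 3 m L₃) :
    HasSum (fun n : ℕ => (-1) ^ n * (2 * oddHarmonic (n + 1)) /
        (((n : ℝ) + 1) * (2 * n + 2 + m) ^ 3))
      (Real.pi ^ 2 / 8 / m ^ 3 - 2 * L₁ / m ^ 3 - 2 * L₂ / m ^ 2 - 2 * L₃ / m) := by
  refine HasSum.of_tendsto (summable_of_le_harm_div_sq 1 fun n => ?_) ?_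
  · rw [abs_div, abs_mul, abs_pow, abs_neg, abs_one, one_pow, one_mul, one_mul,
      abs_of_nonneg (by linarith [oddHarmonic_nonneg (n + 1)]), abs_of_pos (by positivity),
      div_le_div_iff₀ (by positivity) (by positivity)]
    have h0 : (0 : ℝ) ≤ n := n.cast_nonneg
    have e1 : 2 * ((n : ℝ) + 1) ≤ (2 * n + 2 + m) ^ 3 :=
      (by linarith : 2 * ((n : ℝ) + 1) ≤ 2 * n + 2 + m).trans
        (le_self_pow₀ (by linarith) (by norm_num))
    have e2 := oddHarmonic_le_harm (n + 1)
    have e3 := oddHarmonic_nonneg (n + 1)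
    have e4 := harm_nonneg (n + 1)
    calc 2 * oddHarmonic (n + 1) * ((n : ℝ) + 1) ^ 2
        = oddHarmonic (n + 1) * (((n : ℝ) + 1) * (2 * ((n : ℝ) + 1))) := by ring
      _ ≤ harm (n + 1) * (((n : ℝ) + 1) * (2 * n + 2 + m) ^ 3) := by gcongr
  -- Partial fractions of 1/(N (2N+m)^3) in N, applied to partial sums because two of the four
  -- series converge only conditionally.
  · have h := ((((tendsto_sum_alternating_oddHarmonic_div.const_mul (2 / m ^ 3)).sub
      (h1.const_mul (2 / m ^ 3))).sub (h2.const_mul (2 / m ^ 2))).sub (h3.const_mul (2 / m)))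
    rw [show Real.pi ^ 2 / 8 / m ^ 3 - 2 * L₁ / m ^ 3 - 2 * L₂ / m ^ 2 - 2 * L₃ / m =
      2 / m ^ 3 * (Real.pi ^ 2 / 16) - 2 / m ^ 3 * L₁ - 2 / m ^ 2 * L₂ - 2 / m * L₃ by ring]
    refine h.congr fun N => ?_
    rw [mul_sum, mul_sum, mul_sum, mul_sum, ← sum_sub_distrib, ← sum_sub_distrib,
      ← sum_sub_distrib]
    refine sum_congr rfl fun n _ => ?_
    rw [shiftTerm, shiftTerm, shiftTerm]
    have : 2 * (n : ℝ) + 2 + m ≠ 0 := by positivity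
    field_simp
    ring

end ShiftedSums

/-! ### Closed forms -/

/-- Euler's constant cancels in the difference, leaving ψ values only. -/
lemma realHarmonic_sub_eq (q : ℝ) {x y : ℝ} (hx : x + 1 = (q + 2) / 4) (hy : y + 1 = (q + 4) / 4) :
    Real.pi + realHarmonic x - realHarmonic y = Real.pi - polygammaDiff 0 q := by
  rw [add_sub_assoc, realHarmonic_sub, hx, hy, polygammaDiff]; ring

lemma sum_mul_const_eq {k : ℕ} {f g : ℕ → ℝ} (c : ℝ) (h : ∀ j ∈ Icc 1 k, f j = c * g j) :
    ∑ j ∈ Icc 1 k, f j = c * ∑ j ∈ Icc 1 k, g j := by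
  rw [mul_sum]; exact sum_congr rfl h

lemma two_mul_auxOne (q : ℝ) (hq : 0 < q + 1) :
    2 * auxOne q = (Real.pi - polygammaDiff 0 q) / (2 * (q + 1)) := by
  rw [auxOne]; field_simp; ring

lemma two_mul_auxTwo (q : ℝ) (hq : 0 < q + 1) :
    2 * auxTwo q = (4 * (Real.pi - polygammaDiff 0 q) + (q + 1) * polygammaDiff 1 q) /
      (8 * (q + 1) ^ 2) := by
  rw [auxTwo, auxOne]; field_simp; ring

lemma two_mul_auxThree (q : ℝ) (hq : 0 < q + 1) :
    2 * auxThree q = (32 * (Real.pi - polygammaDiff 0 q) + 8 * (q + 1) * polygammaDiff 1 q -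
      (q + 1) ^ 2 * polygammaDiff 2 q) / (64 * (q + 1) ^ 3) := by
  rw [auxThree, auxTwo, auxOne]; field_simp; ring

/-- The shift 2k+1 is reached from q = 1 in k steps. -/
lemma hasSum_odd (k : ℕ) :
    HasSum (fun n : ℕ => (-1) ^ n * (2 * oddHarmonic (n + 1)) /
        (((n : ℝ) + 1) * (2 * n + 2 + (1 + 2 * k)) ^ 3))
      (Real.pi ^ 2 / 8 / (1 + 2 * (k : ℝ)) ^ 3
        - 2 * (∑ j ∈ Icc 1 k, (-1) ^ (j + 1) * (2 * auxOne (1 + 2 * k - 2 * j)) +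
            (-1) ^ k * (catalanG - Real.pi * Real.log 2 / 4)) / (1 + 2 * (k : ℝ)) ^ 3
        - 2 * (∑ j ∈ Icc 1 k, (-1) ^ (j + 1) * (2 * auxTwo (1 + 2 * k - 2 * j)) +
            (-1) ^ k * (-2 * (-2 * W3 + Real.pi ^ 3 / 32 + Real.pi * Real.log 2 ^ 2 / 16))) /
              (1 + 2 * (k : ℝ)) ^ 2
        - 2 * (∑ j ∈ Icc 1 k, (-1) ^ (j + 1) * (2 * auxThree (1 + 2 * k - 2 * j)) +
            (-1) ^ k * (-2 * (-(7 * Real.pi / 64 * zetaReal 3 + dirichletBeta 4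
              - Real.pi ^ 3 * Real.log 2 / 16) / 2))) / (1 + 2 * (k : ℝ))) :=
  hasSum_of_shiftSum (by positivity)
    (shiftSum_one_one.iterate zero_le_one (fun _ => hasSum_auxOne) k)
    ((shiftSum_one hasSum_oddHarmonic_div_odd_sq).iterate zero_le_one (fun _ => hasSum_auxTwo) k)
    ((shiftSum_one hasSum_oddHarmonic_div_odd_cube).iterate zero_le_one (fun _ => hasSum_auxThree) k)

/-- The shift 2k+2 is reached from q = 0 in k+1 steps, which is why j runs to k+1. -/
lemma hasSum_even (k : ℕ) :
    HasSum (fun n : ℕ => (-1) ^ n * (2 * oddHarmonic (n + 1)) /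
        (((n : ℝ) + 1) * (2 * n + 2 + (0 + 2 * (k + 1 : ℕ))) ^ 3))
      (Real.pi ^ 2 / 8 / (0 + 2 * ((k + 1 : ℕ) : ℝ)) ^ 3
        - 2 * (∑ j ∈ Icc 1 (k + 1), (-1) ^ (j + 1) * (2 * auxOne (0 + 2 * (k + 1 : ℕ) - 2 * j)) +
            (-1) ^ (k + 1) * (Real.pi ^ 2 / 16)) / (0 + 2 * ((k + 1 : ℕ) : ℝ)) ^ 3
        - 2 * (∑ j ∈ Icc 1 (k + 1), (-1) ^ (j + 1) * (2 * auxTwo (0 + 2 * (k + 1 : ℕ) - 2 * j)) +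
            (-1) ^ (k + 1) * (2 / 2 ^ 2 * (Real.pi * catalanG - 7 / 4 * zetaReal 3))) /
              (0 + 2 * ((k + 1 : ℕ) : ℝ)) ^ 2
        - 2 * (∑ j ∈ Icc 1 (k + 1), (-1) ^ (j + 1) * (2 * auxThree (0 + 2 * (k + 1 : ℕ) - 2 * j)) +
            (-1) ^ (k + 1) * (2 / 2 ^ 3 * (4 * (1 / 2 * (11 / 4 * zetaReal 4
              - 7 / 4 * zetaReal 3 * Real.log 2 + 1 / 2 * zetaReal 2 * Real.log 2 ^ 2
              - 1 / 12 * Real.log 2 ^ 4 - 2 * Li4Half) - 25 / 128 * zetaReal 4)))) /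
              (0 + 2 * ((k + 1 : ℕ) : ℝ))) :=
  hasSum_of_shiftSum (by positivity)
    (shiftSum_one_zero.iterate le_rfl (fun _ => hasSum_auxOne) (k + 1))
    ((shiftSum_zero hasSum_alternating_oddHarmonic_div_sq).iterate le_rfl (fun _ => hasSum_auxTwo)
      (k + 1))
    ((shiftSum_zero hasSum_alternating_oddHarmonic_div_cube).iterate le_rfl
      (fun _ => hasSum_auxThree) (k + 1))

/-! ### The finite sums over j in the notation of the theorem. -/

lemma odd_index_pos {k j : ℕ} (hj : j ∈ Icc 1 k) : (0 : ℝ) < k + 1 - j := by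
  have : (j : ℝ) ≤ k := by exact_mod_cast (mem_Icc.1 hj).2
  linarith

lemma even_index_pos {k j : ℕ} (hj : j ∈ Icc 1 (k + 1)) : (0 : ℝ) < 2 * k + 3 - 2 * j := by
  have : (j : ℝ) ≤ k + 1 := by exact_mod_cast (mem_Icc.1 hj).2
  linarith

lemma sum_odd_auxThree (k : ℕ) :
    ∑ j ∈ Icc 1 k, (-1 : ℝ) ^ (j + 1) * (1 / (512 * ((k : ℝ) + 1 - j) ^ 3) * (32 * Real.pi - 32
      * polygamma 0 ((2 * (k : ℝ) + 5 - 2 * j) / 4) + 32 * polygamma 0 ((2 * (k : ℝ) + 3 - 2 *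
      j) / 4) + 16 * ((k : ℝ) + 1 - j) * (polygamma 1 ((2 * (k : ℝ) + 5 - 2 * j) / 4) -
      polygamma 1 ((2 * (k : ℝ) + 3 - 2 * j) / 4)) - 4 * ((k : ℝ) + 1 - j) ^ 2 * (polygamma 2
      ((2 * (k : ℝ) + 5 - 2 * j) / 4) - polygamma 2 ((2 * (k : ℝ) + 3 - 2 * j) / 4)))) =
    1 * ∑ j ∈ Icc 1 k, (-1) ^ (j + 1) * (2 * auxThree (1 + 2 * (k : ℝ) - 2 * j)) := by
  refine sum_mul_const_eq _ fun j hj => ?_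
  have h := odd_index_pos hj
  have hq : (1 + 2 * (k : ℝ) - 2 * j) + 1 = 2 * (k + 1 - j) := by ring
  have ha : (2 * (k : ℝ) + 5 - 2 * j) / 4 = ((1 + 2 * (k : ℝ) - 2 * j) + 4) / 4 := by ring
  have hb : (2 * (k : ℝ) + 3 - 2 * j) / 4 = ((1 + 2 * (k : ℝ) - 2 * j) + 2) / 4 := by ring
  rw [two_mul_auxThree _ (by rw [hq]; positivity), hq, ha, hb]
  simp only [polygammaDiff]
  field_simp
  ring

lemma sum_odd_auxOne (k : ℕ) :
    ∑ j ∈ Icc 1 k, (-1 : ℝ) ^ (j + 1) * ((Real.pi + realHarmonic ((2 * (k : ℝ) - 1 - 2 * j) / 4)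
      - realHarmonic ((2 * (k : ℝ) - 2 * j + 1) / 4)) / (2 * ((k : ℝ) + 1 - j))) =
    2 * ∑ j ∈ Icc 1 k, (-1) ^ (j + 1) * (2 * auxOne (1 + 2 * (k : ℝ) - 2 * j)) := by
  refine sum_mul_const_eq _ fun j hj => ?_
  have h := odd_index_pos hj
  have hq : (1 + 2 * (k : ℝ) - 2 * j) + 1 = 2 * (k + 1 - j) := by ring
  rw [two_mul_auxOne _ (by rw [hq]; positivity), hq,
    realHarmonic_sub_eq (1 + 2 * (k : ℝ) - 2 * j) (by ring) (by ring)]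
  field_simp

lemma sum_odd_auxTwo (k : ℕ) :
    ∑ j ∈ Icc 1 k, (-1 : ℝ) ^ (j + 1) / (64 * ((k : ℝ) + 1 - j) ^ 2) * (-4 * Real.pi + 4 *
      polygamma 0 ((2 * (k : ℝ) + 5 - 2 * j) / 4) - 4 * polygamma 0 ((2 * (k : ℝ) + 3 - 2 * j) /
      4) - 2 * ((k : ℝ) + 1 - j) * (polygamma 1 ((2 * (k : ℝ) + 5 - 2 * j) / 4) - polygamma 1
      ((2 * (k : ℝ) + 3 - 2 * j) / 4))) =
    -1 / 2 * ∑ j ∈ Icc 1 k, (-1) ^ (j + 1) * (2 * auxTwo (1 + 2 * (k : ℝ) - 2 * j)) := by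
  refine sum_mul_const_eq _ fun j hj => ?_
  have h := odd_index_pos hj
  have hq : (1 + 2 * (k : ℝ) - 2 * j) + 1 = 2 * (k + 1 - j) := by ring
  have ha : (2 * (k : ℝ) + 5 - 2 * j) / 4 = ((1 + 2 * (k : ℝ) - 2 * j) + 4) / 4 := by ring
  have hb : (2 * (k : ℝ) + 3 - 2 * j) / 4 = ((1 + 2 * (k : ℝ) - 2 * j) + 2) / 4 := by ring
  rw [two_mul_auxTwo _ (by rw [hq]; positivity), hq, ha, hb]
  simp only [polygammaDiff]
  field_simp
  ring

lemma sum_odd_auxOne_half (k : ℕ) :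
    ∑ j ∈ Icc 1 k, (-1 : ℝ) ^ (j + 1) * ((Real.pi + realHarmonic ((2 * (k : ℝ) - 1 - 2 * j) / 4)
      - realHarmonic ((2 * (k : ℝ) + 1 - 2 * j) / 4)) / (8 * ((k : ℝ) + 1 - j))) =
    1 / 2 * ∑ j ∈ Icc 1 k, (-1) ^ (j + 1) * (2 * auxOne (1 + 2 * (k : ℝ) - 2 * j)) := by
  refine sum_mul_const_eq _ fun j hj => ?_
  have h := odd_index_pos hj
  have hq : (1 + 2 * (k : ℝ) - 2 * j) + 1 = 2 * (k + 1 - j) := by ring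
  rw [two_mul_auxOne _ (by rw [hq]; positivity), hq,
    realHarmonic_sub_eq (1 + 2 * (k : ℝ) - 2 * j) (by ring) (by ring)]
  field_simp
  ring

lemma sum_even_auxThree (k : ℕ) :
    ∑ j ∈ Icc 1 (k + 1), (-1 : ℝ) ^ (j + 1) * (1 / (64 * (2 * (k : ℝ) + 3 - 2 * j) ^ 3) * (32 *
      Real.pi - 32 * polygamma 0 (((k : ℝ) + 3 - j) / 2) + 32 * polygamma 0 (((k : ℝ) + 2 - j) /
      2) + 8 * (2 * (k : ℝ) + 3 - 2 * j) * (polygamma 1 (((k : ℝ) + 3 - j) / 2) - polygamma 1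
      (((k : ℝ) + 2 - j) / 2)) - (2 * (k : ℝ) + 3 - 2 * j) ^ 2 * (polygamma 2 (((k : ℝ) + 3 - j)
      / 2) - polygamma 2 (((k : ℝ) + 2 - j) / 2)))) =
    1 * ∑ j ∈ Icc 1 (k + 1), (-1) ^ (j + 1) * (2 * auxThree (0 + 2 * ((k + 1 : ℕ) : ℝ) - 2 * j)) := by
  refine sum_mul_const_eq _ fun j hj => ?_
  have h := even_index_pos hj
  have hq : (0 + 2 * ((k + 1 : ℕ) : ℝ) - 2 * j) + 1 = 2 * k + 3 - 2 * j := by push_cast; ring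
  have ha : ((k : ℝ) + 3 - j) / 2 = ((0 + 2 * ((k + 1 : ℕ) : ℝ) - 2 * j) + 4) / 4 := by push_cast; ring
  have hb : ((k : ℝ) + 2 - j) / 2 = ((0 + 2 * ((k + 1 : ℕ) : ℝ) - 2 * j) + 2) / 4 := by push_cast; ring
  rw [two_mul_auxThree _ (by rw [hq]; positivity), hq, ha, hb]
  simp only [polygammaDiff]
  field_simp
  ring

lemma sum_even_auxOne (k : ℕ) :
    ∑ j ∈ Icc 1 (k + 1), (-1 : ℝ) ^ (j + 1) * ((Real.pi + realHarmonic (((k : ℝ) - j) / 2) -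
      realHarmonic (((k : ℝ) - j + 1) / 2)) / (2 * (k : ℝ) + 3 - 2 * j)) =
    2 * ∑ j ∈ Icc 1 (k + 1), (-1) ^ (j + 1) * (2 * auxOne (0 + 2 * ((k + 1 : ℕ) : ℝ) - 2 * j)) := by
  refine sum_mul_const_eq _ fun j hj => ?_
  have h := even_index_pos hj
  have hq : (0 + 2 * ((k + 1 : ℕ) : ℝ) - 2 * j) + 1 = 2 * k + 3 - 2 * j := by push_cast; ring
  rw [two_mul_auxOne _ (by rw [hq]; positivity), hq,
    realHarmonic_sub_eq (0 + 2 * ((k + 1 : ℕ) : ℝ) - 2 * j) (by push_cast; ring) (by push_cast; ring)]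
  field_simp

lemma sum_even_auxTwo (k : ℕ) :
    ∑ j ∈ Icc 1 (k + 1), (-1 : ℝ) ^ (j + 1) / (16 * (2 * (k : ℝ) + 3 - 2 * j) ^ 2) * (-4 *
      Real.pi + 4 * polygamma 0 (((k : ℝ) + 3 - j) / 2) - 4 * polygamma 0 (((k : ℝ) + 2 - j) /
      2) - (2 * (k : ℝ) + 3 - 2 * j) * polygamma 1 (((k : ℝ) + 3 - j) / 2) + (2 * (k : ℝ) + 3 -
      2 * j) * polygamma 1 (((k : ℝ) + 2 - j) / 2)) =
    -1 / 2 * ∑ j ∈ Icc 1 (k + 1), (-1) ^ (j + 1) * (2 * auxTwo (0 + 2 * ((k + 1 : ℕ) : ℝ) - 2 * j)) := by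
  refine sum_mul_const_eq _ fun j hj => ?_
  have h := even_index_pos hj
  have hq : (0 + 2 * ((k + 1 : ℕ) : ℝ) - 2 * j) + 1 = 2 * k + 3 - 2 * j := by push_cast; ring
  have ha : ((k : ℝ) + 3 - j) / 2 = ((0 + 2 * ((k + 1 : ℕ) : ℝ) - 2 * j) + 4) / 4 := by push_cast; ring
  have hb : ((k : ℝ) + 2 - j) / 2 = ((0 + 2 * ((k + 1 : ℕ) : ℝ) - 2 * j) + 2) / 4 := by push_cast; ring
  rw [two_mul_auxTwo _ (by rw [hq]; positivity), hq, ha, hb]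
  simp only [polygammaDiff]
  field_simp
  ring

lemma sum_even_auxOne_half (k : ℕ) :
    ∑ j ∈ Icc 1 (k + 1), (-1 : ℝ) ^ (j + 1) * ((Real.pi + realHarmonic (((k : ℝ) - j) / 2) -
      realHarmonic (((k : ℝ) + 1 - j) / 2)) / (4 * (2 * (k : ℝ) + 3 - 2 * j))) =
    1 / 2 * ∑ j ∈ Icc 1 (k + 1), (-1) ^ (j + 1) * (2 * auxOne (0 + 2 * ((k + 1 : ℕ) : ℝ) - 2 * j)) := by
  refine sum_mul_const_eq _ fun j hj => ?_
  have h := even_index_pos hj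
  have hq : (0 + 2 * ((k + 1 : ℕ) : ℝ) - 2 * j) + 1 = 2 * k + 3 - 2 * j := by push_cast; ring
  rw [two_mul_auxOne _ (by rw [hq]; positivity), hq,
    realHarmonic_sub_eq (0 + 2 * ((k + 1 : ℕ) : ℝ) - 2 * j) (by push_cast; ring) (by push_cast; ring)]
  field_simp
  ring

theorem theorem3p7 (k : ℕ) :
    (∃ S : ℝ,
      HasSum (fun n : ℕ => (-1 : ℝ) ^ ((n + 1) + 1) * (2 * oddHarmonic (n + 1)) /
        (((n : ℝ) + 1) * (2 * ((n : ℝ) + 1) + 2 * (k : ℝ) + 1) ^ 3)) S ∧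
      HasSum (fun n : ℕ => (-1 : ℝ) ^ n * milgram n 1 /
        (((n : ℝ) + 1) * (2 * (n : ℝ) + 2 * (k : ℝ) + 3) ^ 3)) S ∧
      S =
        -2 / (2 * (k : ℝ) + 1) *
          ((∑ j ∈ Finset.Icc 1 k, (-1 : ℝ) ^ (j + 1) *
              (1 / (512 * ((k : ℝ) + 1 - j) ^ 3) *
                (32 * Real.pi
                  - 32 * polygamma 0 ((2 * (k : ℝ) + 5 - 2 * j) / 4)
                  + 32 * polygamma 0 ((2 * (k : ℝ) + 3 - 2 * j) / 4)
                  + 16 * ((k : ℝ) + 1 - j) *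
                      (polygamma 1 ((2 * (k : ℝ) + 5 - 2 * j) / 4)
                        - polygamma 1 ((2 * (k : ℝ) + 3 - 2 * j) / 4))
                  - 4 * ((k : ℝ) + 1 - j) ^ 2 *
                      (polygamma 2 ((2 * (k : ℝ) + 5 - 2 * j) / 4)
                        - polygamma 2 ((2 * (k : ℝ) + 3 - 2 * j) / 4)))))
            + (-1 : ℝ) ^ k *
                (7 * Real.pi / 64 * zetaReal 3 + dirichletBeta 4
                  - Real.pi ^ 3 * Real.log 2 / 16))
        - 2 / (2 * (k : ℝ) + 1) ^ 2 *
          (-Real.pi ^ 2 / 16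
            + (k : ℝ) / (2 * (k : ℝ) + 1) *
                (Real.pi ^ 2 / 8
                  - (∑ j ∈ Finset.Icc 1 k, (-1 : ℝ) ^ (j + 1) *
                      ((Real.pi + realHarmonic ((2 * (k : ℝ) - 1 - 2 * j) / 4)
                          - realHarmonic ((2 * (k : ℝ) - 2 * j + 1) / 4)) /
                        (2 * ((k : ℝ) + 1 - j))))
                  - (-1 : ℝ) ^ k * (2 * catalanG)
                  + (-1 : ℝ) ^ k * (Real.pi * Real.log 2) / 2)
            - 2 *
                ((∑ j ∈ Finset.Icc 1 k, (-1 : ℝ) ^ (j + 1) / (64 * ((k : ℝ) + 1 - j) ^ 2) *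
                    (-4 * Real.pi
                      + 4 * polygamma 0 ((2 * (k : ℝ) + 5 - 2 * j) / 4)
                      - 4 * polygamma 0 ((2 * (k : ℝ) + 3 - 2 * j) / 4)
                      - 2 * ((k : ℝ) + 1 - j) *
                          (polygamma 1 ((2 * (k : ℝ) + 5 - 2 * j) / 4)
                            - polygamma 1 ((2 * (k : ℝ) + 3 - 2 * j) / 4))))
                  + (-1 : ℝ) ^ k / 96 *
                      (3 * Real.pi ^ 3 + 6 * Real.pi * Real.log 2 ^ 2 - 192 * W3))
            + 2 *
                ((-1 : ℝ) ^ k / 8 * (4 * catalanG - Real.pi * Real.log 2)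
                  + ∑ j ∈ Finset.Icc 1 k, (-1 : ℝ) ^ (j + 1) *
                      ((Real.pi + realHarmonic ((2 * (k : ℝ) - 1 - 2 * j) / 4)
                          - realHarmonic ((2 * (k : ℝ) + 1 - 2 * j) / 4)) /
                        (8 * ((k : ℝ) + 1 - j)))))) ∧
    (∃ S : ℝ,
      HasSum (fun n : ℕ => (-1 : ℝ) ^ ((n + 1) + 1) * (2 * oddHarmonic (n + 1)) /
        (((n : ℝ) + 1) * (2 * ((n : ℝ) + 1) + 2 * (k : ℝ) + 2) ^ 3)) S ∧
      HasSum (fun n : ℕ => (-1 : ℝ) ^ n * milgram n 1 /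
        (((n : ℝ) + 1) * (2 * (n : ℝ) + 2 * (k : ℝ) + 4) ^ 3)) S ∧
      S =
        -1 / ((k : ℝ) + 1) *
          ((∑ j ∈ Finset.Icc 1 (k + 1), (-1 : ℝ) ^ (j + 1) *
              (1 / (64 * (2 * (k : ℝ) + 3 - 2 * j) ^ 3) *
                (32 * Real.pi
                  - 32 * polygamma 0 (((k : ℝ) + 3 - j) / 2)
                  + 32 * polygamma 0 (((k : ℝ) + 2 - j) / 2)
                  + 8 * (2 * (k : ℝ) + 3 - 2 * j) *
                      (polygamma 1 (((k : ℝ) + 3 - j) / 2)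
                        - polygamma 1 (((k : ℝ) + 2 - j) / 2))
                  - (2 * (k : ℝ) + 3 - 2 * j) ^ 2 *
                      (polygamma 2 (((k : ℝ) + 3 - j) / 2)
                        - polygamma 2 (((k : ℝ) + 2 - j) / 2)))))
            + (-1 : ℝ) ^ (k + 1) *
                (1 / 2 *
                    (11 / 4 * zetaReal 4 - 7 / 4 * zetaReal 3 * Real.log 2
                      + 1 / 2 * zetaReal 2 * Real.log 2 ^ 2
                      - 1 / 12 * Real.log 2 ^ 4 - 2 * Li4Half)
                  - 25 / 128 * zetaReal 4))
        - 1 / (2 * ((k : ℝ) + 1) ^ 2) *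
          (-Real.pi ^ 2 / 16
            + (2 * (k : ℝ) + 1) / (4 * ((k : ℝ) + 1)) *
                (Real.pi ^ 2 / 8 + (-1 : ℝ) ^ k * Real.pi ^ 2 / 8
                  - ∑ j ∈ Finset.Icc 1 (k + 1), (-1 : ℝ) ^ (j + 1) *
                      ((Real.pi + realHarmonic (((k : ℝ) - j) / 2)
                          - realHarmonic (((k : ℝ) - j + 1) / 2)) /
                        (2 * (k : ℝ) + 3 - 2 * j)))
            - 2 *
                ((∑ j ∈ Finset.Icc 1 (k + 1),
                    (-1 : ℝ) ^ (j + 1) / (16 * (2 * (k : ℝ) + 3 - 2 * j) ^ 2) *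
                    (-4 * Real.pi
                      + 4 * polygamma 0 (((k : ℝ) + 3 - j) / 2)
                      - 4 * polygamma 0 (((k : ℝ) + 2 - j) / 2)
                      - (2 * (k : ℝ) + 3 - 2 * j) * polygamma 1 (((k : ℝ) + 3 - j) / 2)
                      + (2 * (k : ℝ) + 3 - 2 * j) * polygamma 1 (((k : ℝ) + 2 - j) / 2)))
                  + (-1 : ℝ) ^ (k + 1) / 16 * (-4 * catalanG * Real.pi + 7 * zetaReal 3))
            + 2 *
                ((∑ j ∈ Finset.Icc 1 (k + 1), (-1 : ℝ) ^ (j + 1) *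
                    ((Real.pi + realHarmonic (((k : ℝ) - j) / 2)
                        - realHarmonic (((k : ℝ) + 1 - j) / 2)) /
                      (4 * (2 * (k : ℝ) + 3 - 2 * j))))
                  + (-1 : ℝ) ^ (k + 1) * Real.pi ^ 2 / 32))) := by
  refine ⟨⟨_, (hasSum_odd k).congr_fun fun n => ?_, (hasSum_odd k).congr_fun fun n => ?_, ?_⟩,
    ⟨_, (hasSum_even k).congr_fun fun n => ?_, (hasSum_even k).congr_fun fun n => ?_, ?_⟩⟩
  · rw [show 2 * (n : ℝ) + 2 + (1 + 2 * k) = 2 * (n + 1) + 2 * k + 1 by ring, pow_succ (-1 : ℝ) (n + 1),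
      pow_succ (-1 : ℝ) n]
    ring
  · rw [milgram_one, show 2 * (n : ℝ) + 2 + (1 + 2 * k) = 2 * n + 2 * k + 3 by ring]
  · rw [sum_odd_auxThree, sum_odd_auxOne, sum_odd_auxTwo, sum_odd_auxOne_half]
    -- The exponent-one sum A occurs twice in the closed form. Its coefficients combine as 1 -
    -- 2k/(2k+1) = 1/(2k+1), giving the single term over (2k+1)^3; the terms in π² collapse in the
    -- same way.
    generalize ∑ j ∈ Icc 1 k, (-1 : ℝ) ^ (j + 1) * (2 * auxOne (1 + 2 * (k : ℝ) - 2 * j)) = A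
    generalize ∑ j ∈ Icc 1 k, (-1 : ℝ) ^ (j + 1) * (2 * auxTwo (1 + 2 * (k : ℝ) - 2 * j)) = B
    generalize ∑ j ∈ Icc 1 k, (-1 : ℝ) ^ (j + 1) * (2 * auxThree (1 + 2 * (k : ℝ) - 2 * j)) = C
    rw [add_comm (1 : ℝ) (2 * k)]
    field_simp
    ring
  · push_cast
    rw [show 2 * (n : ℝ) + 2 + (0 + 2 * (k + 1)) = 2 * (n + 1) + 2 * k + 2 by ring,
      pow_succ (-1 : ℝ) (n + 1), pow_succ (-1 : ℝ) n]
    ring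
  · push_cast
    rw [milgram_one, show 2 * (n : ℝ) + 2 + (0 + 2 * (k + 1)) = 2 * n + 2 * k + 4 by ring]
  · rw [sum_even_auxThree, sum_even_auxOne, sum_even_auxTwo, sum_even_auxOne_half]
    -- Here the two occurrences of A combine as 1 - (2k+1)/(2k+2) = 1/(2k+2).
    generalize ∑ j ∈ Icc 1 (k + 1), (-1 : ℝ) ^ (j + 1) *
      (2 * auxOne (0 + 2 * ((k + 1 : ℕ) : ℝ) - 2 * j)) = A
    generalize ∑ j ∈ Icc 1 (k + 1), (-1 : ℝ) ^ (j + 1) *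
      (2 * auxTwo (0 + 2 * ((k + 1 : ℕ) : ℝ) - 2 * j)) = B
    generalize ∑ j ∈ Icc 1 (k + 1), (-1 : ℝ) ^ (j + 1) *
      (2 * auxThree (0 + 2 * ((k + 1 : ℕ) : ℝ) - 2 * j)) = C
    rw [zero_add, pow_succ (-1 : ℝ) k, Nat.cast_succ]
    field_simp
    ring
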